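/- **Conventions.** Manifolds are smooth, Hausdorff and second countable. An $L_\infty$-bundle $\mathscr M=(M,L,\lambda)$ consists of a manifold $M$, a finite-dimensional graded vector bundle $L=L^1\oplus\dots\oplus L^r$ over $M$, and smooth bundle maps $\lambda_k:\mathrm{Sym}^kL\to L$ ($k\ge 0$) of degree $1$ making each fiber $L|_P$ a curved $L_\infty[1]$-algebra, i.e. $\lambda\circ\lambda=0$, where on homogeneous elements $$(\lambda\circ\mu)_n(x_1,\dots,x_n)=\sum_{k}\ \sum_{\sigma\in \mathrm{Sh}(k,n-k)}\pm\,\lambda_{n-k+1}\big(\mu_k(x_{\sigma(1)},\dots,x_{\sigma(k)}),x_{\sigma(k+1)},\dots,x_{\sigma(n)}\big)$$ with Koszul signs. Its classical locus $\pi_0(\mathscr M)\subset M$ is the zero set of the curvature $\lambda_0\in\Gamma(M,L^1)$; its tangent complex at a classical point $P$ is $$TM|_P\xrightarrow{D_P\lambda_0}L^1|_P\xrightarrow{\lambda_1}L^2|_P\xrightarrow{\lambda_1}\cdots .$$ A morphism $(f,\phi):(M,L,\lambda)\to(N,L',\lambda')$ consists of a smooth map $f:M\to N$ and smooth bundle maps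 $\phi_k:\mathrm{Sym}^kL\to L'$ ($k\ge1$) of degree $0$ over $f$ that form a morphism of curved $L_\infty[1]$-algebras on each fiber, i.e. $\phi\circ\lambda=\lambda'\bullet\phi$, where $$(\lambda'\bullet\phi)_n(x_1,\dots,x_n)=\sum_j\frac1{j!}\sum_{B_1\sqcup\dots\sqcup B_j=\{1,\dots,n\}}\pm\,\lambda'_j\big(\phi(x_{B_1}),\dots,\phi(x_{B_j})\big)$$ is summed over ordered partitions into non-empty blocks; morphisms are composed by composing the base maps and by $\bullet$. It is a fibration if $f$ is a submersion and $\phi_1:L\to f^*L'$ is surjective in every degree. It is étale at $P\in\pi_0(\mathscr M)$ if $(Df,\phi_1)$ induces a quasi-isomorphism from the tangent complex of $\mathscr M$ at $P$ to that of $\mathscr N=(N,L',\lambda')$ at $f(P)$. **Theorem (inverse function theorem).** Let $\mathscr M=(M,L,\lambda)$ and $\mathscr N=(N,L',\lambda')$ be $L_\infty$-bundles and $(f,\phi):\mathscr M\to\mathscr N$ a fibration. Let $Z\subset\pi_0(\mathscr M)$ be a subset such that $(f,\phi)$ is étale at every point of $Z$. Then there are a manifold $Y$, a local diffeomorphism $g:Y\to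 N$, a continuous map $Z\to Y$ and a morphism of $L_\infty$-bundles $\mathscr Y\to\mathscr M$, where $\mathscr Y=(Y,g^*L',g^*\lambda')$ is the pullback of $\mathscr N$ along $g$, such that the diagram $$\begin{array}{ccc}Z&\longrightarrow&\mathscr M\\ \downarrow&\nearrow&\downarrow\\ \mathscr Y&\longrightarrow&\mathscr N\end{array}$$ commutes. That is, the composition $\mathscr Y\to\mathscr M\xrightarrow{(f,\phi)}\mathscr N$ is the canonical morphism $\mathscr Y\to\mathscr N$ (given by $g$ on bases and by the identity on fibers), and the composition $Z\to Y\to M$ is the inclusion. If, moreover, $f:\pi_0(\mathscr M)\to\pi_0(\mathscr N)$ is injective, then $Y$ can be chosen to be an open submanifold of $N$, with $g:Y\to N$ the inclusion. -/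

import Mathlib

open scoped Manifold ContDiff Bundle

universe u v w

/-! ### Algebra: operations on graded vector spaces, Koszul signs, curved `L∞[1]`-algebras

A graded vector space is a family `V : ℕ → Type*`.  Only finitely many `V i` will be nonzero, so
its total space is `∀ i, V i`. -/

namespace LInfty

/-- A sequence of multilinear operations `Vᵏ → W`, `k = 0, 1, 2, …`, on total spaces. -/
abbrev Ops (V W : ℕ → Type*) [∀ i, AddCommGroup (V i)] [∀ i, Module ℝ (V i)]
    [∀ i, AddCommGroup (W i)] [∀ i, Module ℝ (W i)] :=
  ∀ k : ℕ, MultilinearMap ℝ (fun _ : Fin k => ∀ i, V i) (∀ i, W i)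

/-- The tuple of homogeneous elements with components `v a` of degree `d a`. -/
def homog {V : ℕ → Type*} [∀ i, AddCommGroup (V i)] {n : ℕ} (d : Fin n → ℕ)
    (v : ∀ a, V (d a)) : Fin n → ∀ i, V i :=
  fun a => Pi.single (d a) (v a)

/-- A map `p : Fin n → Fin j` distributes inputs `0, …, n-1` over `j` blocks; `block p c` is the
`c`-th block. -/
def block {n j : ℕ} (p : Fin n → Fin j) (c : Fin j) : Finset (Fin n) :=
  Finset.univ.filter fun a => p a = c

/-- The subfamily of `x` indexed by `B`, listed in increasing order of the index. -/
def sub {n : ℕ} {α : Type*} (x : Fin n → α) (B : Finset (Fin n)) : Fin B.card → α :=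
  fun a => x (B.orderEmbOfFin rfl a)

/-- The Koszul sign of reordering inputs of degrees `d 0, …, d (n-1)` block by block, keeping
the order inside each block of `p`: a factor `(-1)^(d a * d b)` for each inversion `a < b`,
`p b < p a`. -/
def koszulSign {n j : ℕ} (p : Fin n → Fin j) (d : Fin n → ℕ) : ℝ :=
  ∏ a, ∏ b, if a < b ∧ p b < p a then (-1 : ℝ) ^ (d a * d b) else 1

section Algebra

variable {V W X : ℕ → Type*} [∀ i, AddCommGroup (V i)] [∀ i, Module ℝ (V i)]
  [∀ i, AddCommGroup (W i)] [∀ i, Module ℝ (W i)] [∀ i, AddCommGroup (X i)] [∀ i, Module ℝ (X i)]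

/-- All operations are homogeneous of degree `r`. -/
def HasDegree (φ : Ops V W) (r : ℕ) : Prop :=
  ∀ (k : ℕ) (d : Fin k → ℕ) (v : ∀ a, V (d a)) (j : ℕ), j ≠ (∑ a, d a) + r →
    φ k (homog d v) j = 0

/-- Graded symmetry: `φ_k` is a map `Symᵏ V → W`.  Here `σ` moves the `a`-th input to position
`σ a`. -/
def IsGradedSymmetric (φ : Ops V W) : Prop :=
  ∀ (k : ℕ) (σ : Equiv.Perm (Fin k)) (d : Fin k → ℕ) (v : ∀ a, V (d a)),
    φ k (fun c => homog d v (σ.symm c)) = koszulSign σ d • φ k (homog d v)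

/-- The composition `φ ∘ μ`: on homogeneous `x_1, …, x_n` it is the sum over all
`(k, n-k)`-unshuffles of `± φ_{n-k+1}(μ_k(x_{σ(1)}, …, x_{σ(k)}), x_{σ(k+1)}, …, x_{σ(n)})`.
An unshuffle is encoded by the map `p : Fin n → Fin 2` that sends the inputs of `μ` to `0` and
the other ones to `1`. -/
noncomputable def circ (φ : Ops V W) (μ : Ops V V) {n : ℕ} (d : Fin n → ℕ)
    (v : ∀ a, V (d a)) : ∀ i, W i :=
  ∑ p : Fin n → Fin 2, koszulSign p d •
    φ ((block p 1).card + 1)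
      (Matrix.vecCons (μ (block p 0).card (sub (homog d v) (block p 0)))
        (sub (homog d v) (block p 1)))

/-- The composition `ψ • φ`: on homogeneous `x_1, …, x_n` it is the sum over `j` and over all
ordered partitions of the inputs into `j` blocks `B_1, …, B_j` of
`± (1 / j!) ψ_j(φ(x_{B_1}), …, φ(x_{B_j}))`.  It is used for `φ` with `φ_0 = 0` only, so that
empty blocks do not contribute and `j ≤ n`. -/
noncomputable def bullet (ψ : Ops W X) (φ : Ops V W) {n : ℕ} (d : Fin n → ℕ)
    (v : ∀ a, V (d a)) : ∀ i, X i :=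
  ∑ j ∈ Finset.range (n + 1), ((j.factorial : ℝ)⁻¹) •
    ∑ p : Fin n → Fin j, koszulSign p d •
      ψ j (fun c => φ (block p c).card (sub (homog d v) (block p c)))

/-- Curved `L∞[1]`-algebra structures: graded symmetric operations of degree `1` with
`μ ∘ μ = 0`. -/
structure IsCurvedLInfty (μ : Ops V V) : Prop where
  degree : HasDegree μ 1
  symm : IsGradedSymmetric μ
  jacobi : ∀ (n : ℕ) (d : Fin n → ℕ) (v : ∀ a, V (d a)), circ μ μ d v = 0

/-- Morphisms of curved `L∞[1]`-algebras: graded symmetric operations `φ_k`, `k ≥ 1`, of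
degree `0` with `φ ∘ μ = μ' • φ`.  (There is no `φ_0`, which is encoded as `φ_0 = 0`.) -/
structure IsLInftyMorphism (μ : Ops V V) (μ' : Ops W W) (φ : Ops V W) : Prop where
  zero : φ 0 = 0
  degree : HasDegree φ 0
  symm : IsGradedSymmetric φ
  compat : ∀ (n : ℕ) (d : Fin n → ℕ) (v : ∀ a, V (d a)), circ φ μ d v = bullet μ' φ d v

/-- The component `V i → W j` of the first operation. -/
noncomputable def linearPart (φ : Ops V W) (i j : ℕ) : V i →ₗ[ℝ] W j :=
  LinearMap.proj j ∘ₗ (MultilinearMap.ofSubsingleton ℝ (∀ i, V i) (∀ i, W i) (0 : Fin 1)).symm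
    (φ 1) ∘ₗ LinearMap.single ℝ V i

variable (V) in
/-- The identity morphism: `φ_1 = id`, and `φ_k = 0` for `k ≠ 1`. -/
noncomputable def idOps : Ops V V
  | 1 => MultilinearMap.ofSubsingleton ℝ (∀ i, V i) (∀ i, V i) (0 : Fin 1) LinearMap.id
  | _ => 0

/-- For complexes `A → B → C` and `A' → B' → C'`, the map `f : B → B'` (part of a morphism of
complexes) induces a bijection of the cohomologies at `B` and `B'`. -/
def BijectiveOnCohomology {A B C A' B' C' : Type*}
    [AddCommGroup A] [Module ℝ A] [AddCommGroup B] [Module ℝ B] [AddCommGroup C] [Module ℝ C]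
    [AddCommGroup A'] [Module ℝ A'] [AddCommGroup B'] [Module ℝ B']
    [AddCommGroup C'] [Module ℝ C'] (δ₀ : A →ₗ[ℝ] B) (δ₁ : B →ₗ[ℝ] C)
    (δ₀' : A' →ₗ[ℝ] B') (δ₁' : B' →ₗ[ℝ] C') (f : B →ₗ[ℝ] B') : Prop :=
  (∀ x, δ₁ x = 0 → f x ∈ LinearMap.range δ₀' → x ∈ LinearMap.range δ₀) ∧
    ∀ y, δ₁' y = 0 → ∃ x, δ₁ x = 0 ∧ y - f x ∈ LinearMap.range δ₀'

/-! Proof that `idOps` is a morphism. -/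

theorem idOps_of_ne {k : ℕ} (hk : k ≠ 1) : idOps V k = 0 := by
  match k, hk with
  | 0, _ => rfl
  | 1, h => exact absurd rfl h
  | _ + 2, _ => rfl

theorem idOps_apply {k : ℕ} (hk : k = 1) (x : Fin k → ∀ i, V i) :
    idOps V k x = x ⟨0, by omega⟩ := by
  subst hk; rfl

theorem koszulSign_mul_self {n j : ℕ} (p : Fin n → Fin j) (d : Fin n → ℕ) :
    koszulSign p d * koszulSign p d = 1 := by
  unfold koszulSign
  simp only [← Finset.prod_mul_distrib]
  refine Finset.prod_eq_one fun a _ => Finset.prod_eq_one fun b _ => ?_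
  split_ifs
  · rw [← mul_pow]; norm_num
  · norm_num

theorem koszulSign_const {n j : ℕ} (p : Fin n → Fin j) (c : Fin j) (hp : ∀ a, p a = c)
    (d : Fin n → ℕ) : koszulSign p d = 1 := by
  unfold koszulSign
  refine Finset.prod_eq_one fun a _ => Finset.prod_eq_one fun b _ => ?_
  simp [hp]

theorem apply_sub_congr (φ : Ops V W) {n : ℕ} (x : Fin n → ∀ i, V i) (B : Finset (Fin n))
    (hB : B = Finset.univ) : φ B.card (sub x B) = φ n x := by
  have key : ∀ (m : ℕ) (h : B.card = m) (hm : m = n),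
      φ m (fun a => x (B.orderEmbOfFin h a)) = φ n x := by
    rintro m h rfl
    congr 1
    funext a
    congr 1
    subst hB
    have := Finset.orderEmbOfFin_unique (s := (Finset.univ : Finset (Fin m))) h
      (f := id) (by simp) strictMono_id
    exact (congrFun this a).symm
  exact key _ rfl (by rw [hB]; simp)

theorem idOps_isLInftyMorphism {μ : Ops V V} (hμ : IsCurvedLInfty μ) :
    IsLInftyMorphism μ μ (idOps V) where
  zero := rfl
  degree := by
    intro k d v j hj
    by_cases hk : k = 1
    · subst hk
      rw [idOps_apply rfl]
      simp only [homog]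
      apply Pi.single_eq_of_ne
      simpa using hj
    · rw [idOps_of_ne hk]; rfl
  symm := by
    intro k σ d v
    by_cases hk : k = 1
    · subst hk
      rw [koszulSign_const _ 0 (fun a => Subsingleton.elim _ _), one_smul,
        Subsingleton.elim σ 1]
      rfl
    · rw [idOps_of_ne hk]; simp
  compat := by
    intro n d v
    have hL : circ (idOps V) μ d v = μ n (homog d v) := by
      unfold circ
      rw [Finset.sum_eq_single (fun _ => 0)]
      · have h1 : (block (fun _ : Fin n => (0 : Fin 2)) 1).card = 0 := by
          simp [block]
        rw [koszulSign_const _ 0 (fun _ => rfl), one_smul, idOps_apply (by omega)]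
        exact apply_sub_congr μ _ _ (by simp [block])
      · intro p _ hp
        rw [idOps_of_ne, zero_apply, smul_zero]
        intro h
        apply hp
        funext a
        have h0 : block p 1 = ∅ := Finset.card_eq_zero.mp (by omega)
        have : a ∉ block p 1 := by rw [h0]; simp
        simp only [block, Finset.mem_filter, Finset.mem_univ, true_and] at this
        have h2 := (p a).isLt
        apply Fin.ext
        have h3 : (p a : ℕ) ≠ 1 := fun h => this (Fin.ext h)
        simp only [Fin.val_zero]
        omega
      · simp
    have hterm : ∀ (j : ℕ) (p : Fin n → Fin j), ¬ Function.Bijective p →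
        μ j (fun c => idOps V (block p c).card (sub (homog d v) (block p c))) = 0 := by
      intro j p hp
      obtain ⟨c, hc⟩ : ∃ c, (block p c).card ≠ 1 := by
        by_contra! hall
        apply hp
        rw [Function.bijective_iff_existsUnique]
        intro c
        obtain ⟨a, ha⟩ := Finset.card_eq_one.mp (hall c)
        have hmem : ∀ b, p b = c ↔ b = a := by
          intro b
          have : b ∈ block p c ↔ b ∈ ({a} : Finset (Fin n)) := by rw [ha]
          simpa [block] using this
        exact ⟨a, (hmem a).2 rfl, fun b hb => (hmem b).1 hb⟩
      apply (μ j).map_coord_zero c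
      rw [idOps_of_ne hc]; rfl
    have hR : bullet μ (idOps V) d v = μ n (homog d v) := by
      unfold bullet
      rw [Finset.sum_eq_single n]
      · have h1 : ∀ p : Fin n → Fin n, koszulSign p d •
            μ n (fun c => idOps V (block p c).card (sub (homog d v) (block p c))) =
            if Function.Bijective p then μ n (homog d v) else 0 := by
          intro p
          split_ifs with hp
          · let σ : Equiv.Perm (Fin n) := Equiv.ofBijective p hp
            have harg : (fun c => idOps V (block p c).card (sub (homog d v) (block p c))) =
                fun c => homog d v (σ.symm c) := by
              funext c
              have hb : block p c = {σ.symm c} := by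
                ext b
                simp only [block, Finset.mem_filter, Finset.mem_univ, true_and,
                  Finset.mem_singleton, Equiv.eq_symm_apply]
                rfl
              have hcard : (block p c).card = 1 := by rw [hb]; simp
              rw [idOps_apply hcard]
              have hm := (block p c).orderEmbOfFin_mem rfl ⟨0, by omega⟩
              have h3 : (block p c).orderEmbOfFin rfl ⟨0, by omega⟩ = σ.symm c := by
                rw [← Finset.mem_singleton, ← hb]; exact hm
              simp only [sub]
              rw [h3]
            rw [harg, hμ.symm n σ d v, smul_smul]
            have : (σ : Fin n → Fin n) = p := rfl
            rw [this, koszulSign_mul_self, one_smul]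
          · rw [hterm n p hp, smul_zero]
        simp_rw [h1]
        rw [← Finset.sum_filter, Finset.sum_const, ← Nat.cast_smul_eq_nsmul ℝ, smul_smul]
        have hc : (Finset.univ.filter
            fun p : Fin n → Fin n => Function.Bijective p).card = n.factorial := by
          rw [← Fintype.card_subtype]
          rw [← Fintype.card_congr (Equiv.ofBijective
            (fun σ : Equiv.Perm (Fin n) =>
              (⟨σ, σ.bijective⟩ : {p : Fin n → Fin n // Function.Bijective p}))
            ⟨fun σ τ h => Equiv.coe_fn_injective (congrArg Subtype.val h),
             fun p => ⟨Equiv.ofBijective p.1 p.2, rfl⟩⟩)]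
          rw [Fintype.card_perm, Fintype.card_fin]
        rw [hc, inv_mul_cancel₀ (by positivity), one_smul]
      · intro j _ hj
        rw [Finset.sum_eq_zero, smul_zero]
        intro p _
        rw [hterm j p, smul_zero]
        intro hb
        exact hj (by simpa using (Fintype.card_of_bijective hb).symm)
      · simp
    rw [hL, hR]

end Algebra

/-! ### Geometry: `L∞`-bundles and their morphisms -/

/-- A finite-dimensional graded vector bundle `L = L¹ ⊕ … ⊕ Lⁿ` of positive amplitude over a
manifold `M`: a smooth vector bundle `L i` of rank `rank i` for each `i`, which is zero
unless `1 ≤ i ≤ n` (for some `n`). -/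
structure GradedBundle (m : ℕ) (M : Type u) [TopologicalSpace M]
    [ChartedSpace (EuclideanSpace ℝ (Fin m)) M] where
  rank : ℕ → ℕ
  rank_zero : rank 0 = 0
  bounded : ∃ n, ∀ i, n < i → rank i = 0
  L : ℕ → M → Type v
  [addCommGroup : ∀ i P, AddCommGroup (L i P)]
  [module : ∀ i P, Module ℝ (L i P)]
  [topFiber : ∀ i P, TopologicalSpace (L i P)]
  [topTotal : ∀ i, TopologicalSpace
    (Bundle.TotalSpace (EuclideanSpace ℝ (Fin (rank i))) (L i))]
  [fiberBundle : ∀ i, FiberBundle (EuclideanSpace ℝ (Fin (rank i))) (L i)]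
  [vectorBundle : ∀ i, VectorBundle ℝ (EuclideanSpace ℝ (Fin (rank i))) (L i)]
  [smooth : ∀ i, ContMDiffVectorBundle ∞ (EuclideanSpace ℝ (Fin (rank i))) (L i) (𝓡 m)]

attribute [instance] GradedBundle.addCommGroup GradedBundle.module GradedBundle.topFiber
  GradedBundle.topTotal GradedBundle.fiberBundle GradedBundle.vectorBundle GradedBundle.smooth

section Geometry

variable {l m n : ℕ}
  {M : Type*} [TopologicalSpace M] [ChartedSpace (EuclideanSpace ℝ (Fin m)) M]
  {N : Type*} [TopologicalSpace N] [ChartedSpace (EuclideanSpace ℝ (Fin n)) N]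
  {Y : Type*} [TopologicalSpace Y] [ChartedSpace (EuclideanSpace ℝ (Fin l)) Y]

/-- The model fibre of `L i`. -/
abbrev GradedBundle.Model (E : GradedBundle m M) (i : ℕ) : Type :=
  EuclideanSpace ℝ (Fin (E.rank i))

/-- Smoothness at `P` of a section of the graded bundle `f^* E`, for a map `f` to the base of
`E`. -/
def GradedBundle.SmoothAlongAt (E : GradedBundle n N) (f : M → N)
    (s : ∀ P, ∀ i, E.L i (f P)) (P : M) : Prop :=
  ∀ i, ContMDiffAt (𝓡 m) ((𝓡 n).prod 𝓘(ℝ, E.Model i)) ∞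
    (fun Q => Bundle.TotalSpace.mk' (E.Model i) (f Q) (s Q i)) P

/-- Smoothness at `P` of a section of a graded bundle. -/
def GradedBundle.SmoothAt (E : GradedBundle m M) (s : ∀ P, ∀ i, E.L i P) (P : M) : Prop :=
  E.SmoothAlongAt (m := m) id s P

/-- A family of fibrewise operations `Symᵏ E|_P → E'|_{f P}` is smooth, i.e. given by morphisms
of smooth vector bundles over `f`, if it takes smooth (local) sections to smooth ones. -/
def SmoothOps (E : GradedBundle m M) (E' : GradedBundle n N) (f : M → N)
    (φ : ∀ P, Ops (fun i => E.L i P) (fun i => E'.L i (f P))) : Prop :=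
  ∀ (k : ℕ) (s : Fin k → ∀ P, ∀ i, E.L i P) (P : M), (∀ a, E.SmoothAt (s a) P) →
    E'.SmoothAlongAt (m := m) f (fun Q => φ Q k (fun a => s a Q)) P

/-- The pullback of a graded vector bundle along a smooth map. -/
noncomputable def GradedBundle.pullback (E : GradedBundle n N)
    (g : C^∞⟮𝓡 l, Y; 𝓡 n, N⟯) : GradedBundle l Y where
  rank := E.rank
  rank_zero := E.rank_zero
  bounded := E.bounded
  L i := g *ᵖ (E.L i)
  addCommGroup i y := inferInstanceAs (AddCommGroup (E.L i (g y)))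
  module i y := inferInstanceAs (Module ℝ (E.L i (g y)))
  topFiber i y := inferInstanceAs (TopologicalSpace (E.L i (g y)))
  topTotal i := inferInstanceAs (TopologicalSpace
    (Bundle.TotalSpace (EuclideanSpace ℝ (Fin (E.rank i))) (g *ᵖ (E.L i))))
  fiberBundle i := inferInstanceAs
    (FiberBundle (EuclideanSpace ℝ (Fin (E.rank i))) (g *ᵖ (E.L i)))
  vectorBundle i := VectorBundle.pullback (K := C^∞⟮𝓡 l, Y; 𝓡 n, N⟯)
    (F := EuclideanSpace ℝ (Fin (E.rank i))) (E := E.L i) (𝕜 := ℝ) g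
  smooth i := ContMDiffVectorBundle.pullback (F := EuclideanSpace ℝ (Fin (E.rank i)))
    (E := E.L i) (𝕜 := ℝ) (𝓡 l) g

/-- An `L∞`-bundle `(M, L, λ)` over `M`: a graded vector bundle with a smooth family of
fibrewise curved `L∞[1]`-algebra structures.  (For degree reasons `λ_k = 0` for `k ≥ n`
if `L = L¹ ⊕ … ⊕ Lⁿ`.) -/
structure LInftyBundle (m : ℕ) (M : Type u) [TopologicalSpace M]
    [ChartedSpace (EuclideanSpace ℝ (Fin m)) M] extends GradedBundle.{u, v} m M where
  op : ∀ P, Ops (fun i => L i P) (fun i => L i P)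
  isCurvedLInfty : ∀ P, IsCurvedLInfty (op P)
  smoothOps : SmoothOps toGradedBundle toGradedBundle id op

/-! Proof that smooth families of operations can be pulled back along smooth maps. -/

theorem SmoothOps.along {E : GradedBundle m M} {E' : GradedBundle n N} {f : M → N}
    (hf : ContMDiff (𝓡 m) (𝓡 n) ∞ f)
    {φ : ∀ P, Ops (fun i => E.L i P) (fun i => E'.L i (f P))} (hφ : SmoothOps E E' f φ)
    {g : Y → M} {y₀ : Y} (hg : ContMDiffAt (𝓡 l) (𝓡 m) ∞ g y₀) {k : ℕ}
    (s : Fin k → ∀ y, ∀ i, E.L i (g y))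
    (hs : ∀ a, E.SmoothAlongAt (m := l) g (s a) y₀) :
    E'.SmoothAlongAt (m := l) (fun y => f (g y)) (fun y => φ (g y) k (fun a => s a y)) y₀ := by
  classical
  obtain ⟨B, hB⟩ := E.bounded
  let e := fun i => trivializationAt (E.Model i) (E.L i) (g y₀)
  let J := Σ i : Fin (B + 1), Fin (E.rank i)
  let fr : J → ∀ Q, ∀ i, E.L i Q := fun r Q =>
    Pi.single (r.1 : ℕ) ((e r.1).symmₗ ℝ Q (EuclideanSpace.single r.2 (1 : ℝ)))
  let c : Fin k → J → Y → ℝ := fun a r y =>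
    ((e r.1) (Bundle.TotalSpace.mk' (E.Model r.1) (g y) (s a y r.1))).2 r.2
  have he : ∀ i, g y₀ ∈ (e i).baseSet := fun i =>
    FiberBundle.mem_baseSet_trivializationAt (E.Model i) (E.L i) (g y₀)
  -- the frame is smooth
  have hfr : ∀ r, E.SmoothAt (m := m) (fr r) (g y₀) := by
    intro r i
    by_cases hi : i = (r.1 : ℕ)
    · subst hi
      refine (Bundle.Trivialization.contMDiffAt_section_iff (e r.1) (he r.1)).2 ?_
      refine (contMDiffAt_const (c := (EuclideanSpace.single r.2 (1 : ℝ) : E.Model r.1))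
        ).congr_of_eventuallyEq ?_
      filter_upwards [(e r.1).open_baseSet.mem_nhds (he r.1)] with Q hQ
      simp only [fr, Pi.single_eq_same]
      rw [Bundle.Trivialization.coe_symmₗ _ hQ]
      exact congrArg Prod.snd ((e r.1).apply_mk_symm hQ _)
    · have : (fun Q => Bundle.TotalSpace.mk' (E.Model i) (id Q) (fr r Q i)) =
          fun Q => Bundle.TotalSpace.mk' (E.Model i) Q 0 := by
        funext Q
        exact congrArg _ (Pi.single_eq_of_ne hi _)
      rw [this]
      exact (Bundle.contMDiff_zeroSection ℝ (E.L i)).contMDiffAt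
  -- the coefficients are smooth
  have hc : ∀ a r, ContMDiffAt (𝓡 l) 𝓘(ℝ, ℝ) ∞ (c a r) y₀ := by
    intro a r
    have h1 := (Bundle.contMDiffAt_totalSpace.1 (hs a r.1)).2
    exact ((EuclideanSpace.proj r.2 : E.Model r.1 →L[ℝ] ℝ).contDiff.contMDiff.contMDiffAt).comp
      y₀ h1
  -- expansion in the frame
  have hexp : ∀ᶠ y in nhds y₀, ∀ a, s a y = ∑ r : J, c a r y • fr r (g y) := by
    have hev : ∀ᶠ y in nhds y₀, ∀ i : Fin (B + 1), g y ∈ (e i).baseSet :=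
      Filter.eventually_all.2 fun i =>
        hg.continuousAt ((e i).open_baseSet.mem_nhds (he i))
    filter_upwards [hev] with y hy a
    funext i
    by_cases hi : i < B + 1
    · obtain ⟨i, rfl⟩ : ∃ i' : Fin (B + 1), (i' : ℕ) = i := ⟨⟨i, hi⟩, rfl⟩
      rw [Finset.sum_apply, Fintype.sum_sigma, Finset.sum_eq_single i]
      · simp only [Pi.smul_apply, fr, Pi.single_eq_same, c]
        rw [Finset.sum_congr rfl fun x _ => (map_smul _ _ _).symm]
        refine Eq.trans ?_ (map_sum ((e i).symmₗ ℝ (g y)) _ _)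
        have h2 : ∑ x : Fin (E.rank i),
            ((e i) (Bundle.TotalSpace.mk' (E.Model i) (g y) (s a y i))).2 x •
              (EuclideanSpace.single x (1 : ℝ) : E.Model i) =
            ((e i) (Bundle.TotalSpace.mk' (E.Model i) (g y) (s a y i))).2 := by
          ext x
          simp [Pi.single_apply]
        rw [h2, Bundle.Trivialization.coe_symmₗ _ (hy i)]
        exact ((e i).symm_apply_apply_mk (hy i) (s a y i)).symm
      · intro i' _ hne
        refine Finset.sum_eq_zero fun x _ => ?_
        simp only [Pi.smul_apply, fr]
        rw [Pi.single_eq_of_ne (fun h => hne (Fin.ext h).symm), smul_zero]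
      · simp
    · have hr : E.rank i = 0 := hB i (by omega)
      have hsub : Subsingleton (E.L i (g y)) := by
        have : Subsingleton (E.Model i) := by
          unfold GradedBundle.Model; rw [hr]; infer_instance
        exact ((trivializationAt (E.Model i) (E.L i) (g y)).continuousLinearEquivAt ℝ (g y)
          (FiberBundle.mem_baseSet_trivializationAt _ _ _)).toEquiv.subsingleton
      exact Subsingleton.elim _ _
  intro i
  have hfg : ContMDiffAt (𝓡 l) (𝓡 n) ∞ (fun y => f (g y)) y₀ :=
    hf.contMDiffAt.comp y₀ hg
  refine Bundle.contMDiffAt_totalSpace.2 ⟨hfg, ?_⟩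
  let e' := trivializationAt (E'.Model i) (E'.L i) (f (g y₀))
  have hbase : ∀ᶠ y in nhds y₀, f (g y) ∈ e'.baseSet :=
    hfg.continuousAt (e'.open_baseSet.mem_nhds
      (FiberBundle.mem_baseSet_trivializationAt (E'.Model i) (E'.L i) (f (g y₀))))
  have hsum : ContMDiffAt (𝓡 l) 𝓘(ℝ, E'.Model i) ∞
      (fun y => ∑ r : Fin k → J, (∏ a, c a (r a) y) •
        (e' (Bundle.TotalSpace.mk' (E'.Model i) (f (g y))
          (φ (g y) k (fun a => fr (r a) (g y)) i))).2) y₀ := by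
    refine contMDiffAt_finsetSum fun r _ => ?_
    have h0 : ContMDiffAt (𝓡 l) 𝓘(ℝ, ℝ) ∞ (fun y => ∏ a, c a (r a) y) y₀ :=
      contMDiffAt_finsetProd fun a _ => hc a (r a)
    have h1 := hφ k (fun a => fr (r a)) (g y₀) (fun a => hfr (r a)) i
    exact h0.smul ((Bundle.contMDiffAt_totalSpace.1 h1).2.comp y₀ hg)
  refine hsum.congr_of_eventuallyEq ?_
  filter_upwards [hexp, hbase] with y hy hy'
  have h3 : φ (g y) k (fun a => s a y) = ∑ r : Fin k → J, (∏ a, c a (r a) y) •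
      φ (g y) k (fun a => fr (r a) (g y)) := by
    rw [show (fun a => s a y) = fun a => ∑ r : J, c a r y • fr r (g y) from funext hy]
    rw [MultilinearMap.map_sum]
    exact Finset.sum_congr rfl fun r _ => MultilinearMap.map_smul_univ _ _ _
  have h4 : ∀ w : E'.L i (f (g y)),
      (e' (Bundle.TotalSpace.mk' (E'.Model i) (f (g y)) w)).2 = e'.linearMapAt ℝ (f (g y)) w := by
    intro w
    rw [Bundle.Trivialization.coe_linearMapAt_of_mem _ hy']
  have h5 : (e' (Bundle.TotalSpace.mk' (E'.Model i) (f (g y))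
      (φ (g y) k (fun a => s a y) i))).2 = ∑ r : Fin k → J, (∏ a, c a (r a) y) •
        (e' (Bundle.TotalSpace.mk' (E'.Model i) (f (g y))
          (φ (g y) k (fun a => fr (r a) (g y)) i))).2 := by
    simp_rw [h4]
    rw [h3, Finset.sum_apply, map_sum]
    simp_rw [Pi.smul_apply, map_smul]
  exact h5

theorem GradedBundle.smoothAt_pullback_iff (E : GradedBundle n N) (g : C^∞⟮𝓡 l, Y; 𝓡 n, N⟯)
    (s : ∀ y, ∀ i, E.L i (g y)) (y₀ : Y) :
    (E.pullback g).SmoothAt s y₀ ↔ E.SmoothAlongAt (m := l) g s y₀ := by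
  refine forall_congr' fun i => ?_
  refine Bundle.contMDiffAt_totalSpace.trans (Iff.trans ?_ Bundle.contMDiffAt_totalSpace.symm)
  exact and_congr (iff_of_true contMDiffAt_id g.contMDiff.contMDiffAt) Iff.rfl

/-- The pullback `(Y, g^* L, g^* λ)` of an `L∞`-bundle along a smooth map `g`. -/
noncomputable def LInftyBundle.pullback (𝓝 : LInftyBundle n N)
    (g : C^∞⟮𝓡 l, Y; 𝓡 n, N⟯) : LInftyBundle l Y where
  toGradedBundle := 𝓝.toGradedBundle.pullback g
  op y := 𝓝.op (g y)
  isCurvedLInfty y := 𝓝.isCurvedLInfty (g y)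
  smoothOps _ s y hs := (𝓝.toGradedBundle.smoothAt_pullback_iff g _ y).2
    (𝓝.smoothOps.along contMDiff_id g.contMDiff.contMDiffAt s
      fun a => (𝓝.toGradedBundle.smoothAt_pullback_iff g (s a) y).1 (hs a))

/-- The curvature `λ_0`, a section of `L¹`. -/
def LInftyBundle.curvature (𝓜 : LInftyBundle m M) (P : M) : 𝓜.L 1 P :=
  𝓜.op P 0 (fun a => a.elim0) 1

/-- The classical (Maurer-Cartan) locus `π₀`: the zero set of the curvature. -/
def LInftyBundle.classicalLocus (𝓜 : LInftyBundle m M) : Set M :=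
  {P | 𝓜.curvature P = 0}

/-- The derivative `T_P M → L¹|_P` at a zero `P` of the curvature, computed in the preferred
trivialization of `L¹` at `P` (at a zero it does not depend on the trivialization). -/
noncomputable def LInftyBundle.curvatureDeriv (𝓜 : LInftyBundle m M) (P : M) :
    TangentSpace (𝓡 m) P →ₗ[ℝ] 𝓜.L 1 P :=
  (trivializationAt (𝓜.Model 1) (𝓜.L 1) P).symmₗ ℝ P ∘ₗ
    (mfderiv (𝓡 m) 𝓘(ℝ, 𝓜.Model 1)
      (fun Q => (trivializationAt (𝓜.Model 1) (𝓜.L 1) P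
        (Bundle.TotalSpace.mk' (𝓜.Model 1) Q (𝓜.curvature Q))).2) P).toLinearMap

/-- The differential `λ_1 : Lⁱ|_P → Lⁱ⁺¹|_P`. -/
noncomputable def LInftyBundle.differential (𝓜 : LInftyBundle m M) (P : M) (i : ℕ) :
    𝓜.L i P →ₗ[ℝ] 𝓜.L (i + 1) P :=
  linearPart (𝓜.op P) i (i + 1)

/-- A morphism of `L∞`-bundles: a smooth map `f` of the bases and a smooth family of morphisms
of curved `L∞[1]`-algebras `(L, λ)|_P → (L', λ')|_{f P}`. -/
structure LInftyBundle.Hom (𝓜 : LInftyBundle m M) (𝓝 : LInftyBundle n N) where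
  base : C^∞⟮𝓡 m, M; 𝓡 n, N⟯
  op : ∀ P, Ops (fun i => 𝓜.L i P) (fun i => 𝓝.L i (base P))
  isMorphism : ∀ P, IsLInftyMorphism (𝓜.op P) (𝓝.op (base P)) (op P)
  smoothOps : SmoothOps 𝓜.toGradedBundle 𝓝.toGradedBundle base op

namespace LInftyBundle.Hom

/-- The linear part `φ_1 : Lⁱ|_P → L'ⁱ|_{f P}`. -/
noncomputable def linear {𝓜 : LInftyBundle m M} {𝓝 : LInftyBundle n N} (Φ : Hom 𝓜 𝓝) (P : M)
    (i : ℕ) : 𝓜.L i P →ₗ[ℝ] 𝓝.L i (Φ.base P) :=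
  linearPart (Φ.op P) i i

/-- Fibrations: `f` is a submersion and `φ_1 : L → f^* L'` is surjective in each degree. -/
structure IsFibration {𝓜 : LInftyBundle m M} {𝓝 : LInftyBundle n N} (Φ : Hom 𝓜 𝓝) : Prop where
  submersion : ∀ P, Function.Surjective (mfderiv (𝓡 m) (𝓡 n) Φ.base P)
  surjective : ∀ P i, Function.Surjective (Φ.linear P i)

/-- `(f, φ)` is étale at the classical point `P` if it induces a quasi-isomorphism of the
tangent complexes `T_P M → L¹|_P → L²|_P → …` and `T_{f P} N → L'¹|_{f P} → L'²|_{f P} → …`;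
here this is spelled out in degree `0`, in degree `1` and in the degrees `i + 1 ≥ 2`. -/
structure IsEtaleAt {𝓜 : LInftyBundle m M} {𝓝 : LInftyBundle n N} (Φ : Hom 𝓜 𝓝) (P : M) :
    Prop where
  degree_zero : BijectiveOnCohomology
    (0 : ℝ →ₗ[ℝ] TangentSpace (𝓡 m) P) (𝓜.curvatureDeriv P)
    (0 : ℝ →ₗ[ℝ] TangentSpace (𝓡 n) (Φ.base P)) (𝓝.curvatureDeriv (Φ.base P))
    (mfderiv (𝓡 m) (𝓡 n) Φ.base P).toLinearMap
  degree_one : BijectiveOnCohomology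
    (𝓜.curvatureDeriv P) (𝓜.differential P 1)
    (𝓝.curvatureDeriv (Φ.base P)) (𝓝.differential (Φ.base P) 1) (Φ.linear P 1)
  degree_ge_two : ∀ i, 1 ≤ i → BijectiveOnCohomology
    (𝓜.differential P i) (𝓜.differential P (i + 1))
    (𝓝.differential (Φ.base P) i) (𝓝.differential (Φ.base P) (i + 1)) (Φ.linear P (i + 1))

/-- The canonical morphism from the pullback of `𝓝` along `g` to `𝓝`: it is `g` on bases and the
identity on fibres. -/
noncomputable def pullbackProj (𝓝 : LInftyBundle n N) (g : C^∞⟮𝓡 l, Y; 𝓡 n, N⟯) :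
    Hom (𝓝.pullback g) 𝓝 where
  base := g
  op y := idOps (fun i => 𝓝.L i (g y))
  isMorphism y := idOps_isLInftyMorphism (𝓝.isCurvedLInfty (g y))
  smoothOps := by
    intro k s y hs
    by_cases hk : k = 1
    · subst hk
      exact (𝓝.toGradedBundle.smoothAt_pullback_iff g (s 0) y).1 (hs 0)
    · intro i
      have h0 : ContMDiffAt (𝓡 l) ((𝓡 n).prod 𝓘(ℝ, 𝓝.Model i)) ∞
          (fun Q => Bundle.TotalSpace.mk' (𝓝.Model i) (g Q) (0 : 𝓝.L i (g Q))) y :=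
        (Bundle.contMDiff_zeroSection ℝ (𝓝.L i)).contMDiffAt.comp y g.contMDiff.contMDiffAt
      refine h0.congr_of_eventuallyEq (Filter.Eventually.of_forall fun Q => ?_)
      simp only [idOps_of_ne hk]
      rfl

/-- The triangle of morphisms of `L∞`-bundles commutes, i.e. `Φ ∘ Ψ = Χ`: equality of the maps of
bases, and equality of the operations `(Φ • Ψ)_k` and `Χ_k`, `k ≥ 1`, which is expressed on
homogeneous elements and, to compare fibres over `Φ (Ψ P)` and `Χ P`, in the disjoint union of
the fibres. -/
def IsComposition {𝓨 : LInftyBundle l Y} {𝓜 : LInftyBundle m M} {𝓝 : LInftyBundle n N}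
    (Φ : Hom 𝓜 𝓝) (Ψ : Hom 𝓨 𝓜) (Χ : Hom 𝓨 𝓝) : Prop :=
  (∀ P, Φ.base (Ψ.base P) = Χ.base P) ∧
  ∀ (P : Y) (k : ℕ), 1 ≤ k → ∀ (d : Fin k → ℕ) (v : ∀ a, 𝓨.L (d a) P),
    (⟨Φ.base (Ψ.base P), bullet (Φ.op (Ψ.base P)) (Ψ.op P) d v⟩ : Σ Q : N, ∀ i, 𝓝.L i Q) =
      ⟨Χ.base P, Χ.op P k (homog d v)⟩

/-- `g : Y → N` is a local diffeomorphism and, for the pullback `𝓨` of `𝓝` along `g`, there are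
a morphism `Ψ : 𝓨 → 𝓜` and a (continuous) map `z : Z → Y` such that the diagram
```
  Z  ⟶  𝓜
  ↓  ↗  ↓ Φ
  𝓨  ⟶  𝓝
```
commutes, with the canonical morphism `𝓨 → 𝓝` at the bottom and the inclusion at the top. -/
def HasPartialSection {𝓜 : LInftyBundle m M} {𝓝 : LInftyBundle n N} (Φ : Hom 𝓜 𝓝) (Z : Set M)
    {Y : Type w} [TopologicalSpace Y] [ChartedSpace (EuclideanSpace ℝ (Fin n)) Y]
    (g : C^∞⟮𝓡 n, Y; 𝓡 n, N⟯) : Prop :=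
  IsLocalDiffeomorph (𝓡 n) (𝓡 n) ∞ g ∧
  ∃ (Ψ : Hom (𝓝.pullback g) 𝓜) (z : Z → Y), Continuous z ∧
    (∀ P : Z, Ψ.base (z P) = P) ∧ IsComposition Φ Ψ (pullbackProj 𝓝 g)

end LInftyBundle.Hom

end Geometry

end LInfty

/-!
# The inverse function theorem for fibrations of `L∞`-bundles

The idea is homotopy transfer with parameters.  Let `(f, φ) : 𝓜 → 𝓝` be a fibration which is
étale along `Z`, write `λ`, `λ'` for the operations of `𝓜`, `𝓝`, and let `K` be the kernel of `φ_1`.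

*Contraction.*  Since `φ_1` is surjective, it has a smooth splitting `s`.  Being étale at a point
of `Z` means that `K` is exact in degrees `≥ 2` and that `Dλ_0` identifies `ker Df` with the
cocycles of `K` in degree `1`.  Exactness at the points of `Z` gives, near `Z`, a smooth homotopy
`δ : L → L` of degree `-1` with values in `K` and `δ λ_1 δ = δ`, such that `K` in degrees `≥ 2` is
recovered from `δ` and `δ λ_1`.  It is built by descending induction on the degree: the step inverts
a smooth family of linear maps, which is possible locally and glues by a partition of unity because
the condition on the inverse is affine (`exists_contractionAbove`, `exists_isSmoothContraction`).
Away from the classical locus `λ_1` does not square to zero, so `δ` is no contraction of a complex,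
but only the identities just named are needed.

*Reduced locus.*  Let `S ⊆ M` be the set of points at which the component of the curvature in `K`
lies in the image of `δ`.  It contains the classical points at which `δ` is defined, and it is the zero
set of the harmonic part of the curvature.  By the inverse function theorem, applied to `f` together
with this harmonic part, `S` is the image of a smooth section of `f` near each point of `Z`
(`exists_local_section`).  So a neighborhood of `Z` in `S` is a manifold `Y` for which `g = f|_Y` is
a local diffeomorphism (`HasLocalSections.exists_isManifold`).

*The morphism.*  Consider the fixed point equation `Ψ = (s - δ λ_1 s) + θ • Ψ` at a point of `S`,
where `θ_k = (δ λ_1 s - s) φ_k - δ λ_k` for `k ≥ 2`.  It has a unique solution, since in each output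
degree the term `θ • Ψ` involves lower degrees of `Ψ` only.  The solution satisfies `φ • Ψ = id` and
`δ λ(Ψ) = 0` by construction.  The defect `E = λ • Ψ - Ψ ∘ λ'` is then killed by `φ_1` and `δ` and,
by a Bianchi identity, its lowest nonzero part is killed by `δ λ_1`, so that `E = 0` by induction
on the number of inputs; in arity `0` this is the defining condition of `S`
(`transfer_compat`, `transfer_bullet`).  The solution is given by a universal formula and hence
smooth, so it defines the morphism `g^* 𝓝 → 𝓜` (`IsSmoothContraction.exists_hom`).

*Signs.*  Operations are turned into polynomial functions on even elements of `A ⊗ V`, for a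
supercommutative algebra `A`.  For these functions the two compositions in the definitions become
composition and directional derivative, and all Koszul signs disappear.  Identities of
operations are recovered as coefficients at a generic point, with `A` generated by creation
operators (`exists_generic`).

*Injectivity.*  On `S`, a point is classical as soon as its image is
(`IsSmoothContraction.mem_classicalLocus`).  So if `f` is injective on classical points, then `g` is
injective over `π₀(𝓝)`, hence on a neighborhood of the preimage of `π₀(𝓝)`
(`exists_isOpen_injOn`), and `Y` can be shrunk to an open subset of `N`.
-/

namespace LInfty

open scoped TensorProduct

/-! ### Supercommutative algebras and Koszul signs -/

/-- A parity on a real algebra `A`: submodules `gr i`, depending only on `i` modulo `2`, which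
are multiplicative and commute up to the sign `(-1)^(i * j)`. -/
structure SuperGrading (A : Type*) [Ring A] [Algebra ℝ A] where
  gr : ℕ → Submodule ℝ A
  one_mem : 1 ∈ gr 0
  mul_mem : ∀ {i j a b}, a ∈ gr i → b ∈ gr j → a * b ∈ gr (i + j)
  comm : ∀ {i j a b}, a ∈ gr i → b ∈ gr j → a * b = (-1 : ℝ) ^ (i * j) • (b * a)
  add_two : ∀ i, gr (i + 2) = gr i

/-- The product of the `a t`, `t ∈ B`, in increasing order of the index `t`. -/
def ordProd {A : Type*} [Ring A] {n : ℕ} (a : Fin n → A) (B : Finset (Fin n)) : A :=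
  (List.ofFn (sub a B)).prod

/-- The Koszul sign of sorting a list by the values of `p`, keeping the order of elements with
the same value. -/
def listSign {T : Type*} {j : ℕ} (p : T → Fin j) (d : T → ℕ) : List T → ℝ
  | [] => 1
  | x :: l => listSign p d l *
      (l.map fun t => if p t < p x then (-1 : ℝ) ^ (d x * d t) else 1).prod

theorem koszulSign_eq_listSign {n j : ℕ} (p : Fin n → Fin j) (d : Fin n → ℕ) :
    koszulSign p d = listSign p d (List.finRange n) := by
  have key : ∀ l : List (Fin n), l.Pairwise (· < ·) →
      listSign p d l = (l.map fun a => (l.map fun b =>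
        if a < b ∧ p b < p a then (-1 : ℝ) ^ (d a * d b) else 1).prod).prod := by
    intro l
    induction l with
    | nil => intro _; rfl
    | cons x l ih =>
      intro h
      rw [List.pairwise_cons] at h
      simp only [listSign, List.map_cons, List.prod_cons, lt_self_iff_false, false_and, if_false,
        one_mul]
      rw [ih h.2, mul_comm]
      congr 1
      · refine congrArg List.prod (List.map_congr_left fun b hb => ?_)
        simp [h.1 b hb]
      · refine congrArg List.prod (List.map_congr_left fun a ha => ?_)
        rw [if_neg (fun hh => absurd hh.1 (not_lt.2 (h.1 a ha).le)), one_mul]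
  rw [key _ (List.pairwise_lt_finRange n)]
  simp only [koszulSign, Fin.prod_univ_def]

namespace SuperGrading

variable {A : Type*} [Ring A] [Algebra ℝ A] (S : SuperGrading A)

theorem list_prod_mem {T : Type*} {a : T → A} {d : T → ℕ} (ha : ∀ t, a t ∈ S.gr (d t))
    (l : List T) : (l.map a).prod ∈ S.gr (l.map d).sum := by
  induction l with
  | nil => exact S.one_mem
  | cons x l ih => exact S.mul_mem (ha x) ih

/-- Moving a homogeneous element `a` into the factor `c₀` of a product costs a sign for each factor
it passes. -/
theorem prod_insert {j : ℕ} {a : A} {i : ℕ} (ha : a ∈ S.gr i) {G : Fin j → A} {e : Fin j → ℕ}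
    (hG : ∀ c, G c ∈ S.gr (e c)) (c₀ : Fin j) (cs : List (Fin j)) (hs : cs.Pairwise (· < ·))
    (hc : c₀ ∈ cs) :
    (cs.map fun c => if c = c₀ then a * G c else G c).prod =
      (cs.map fun c => if c < c₀ then (-1 : ℝ) ^ (i * e c) else 1).prod •
        (a * (cs.map G).prod) := by
  induction cs with
  | nil => simp at hc
  | cons c cs ih =>
    rw [List.pairwise_cons] at hs
    simp only [List.map_cons, List.prod_cons]
    by_cases h : c = c₀
    · subst h
      have h1 : (cs.map fun c' => if c' = c then a * G c' else G c') = cs.map G :=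
        List.map_congr_left fun b hb => if_neg (hs.1 b hb).ne'
      have h2 : (cs.map fun c' => if c' < c then (-1 : ℝ) ^ (i * e c') else 1) =
          cs.map fun _ => 1 :=
        List.map_congr_left fun b hb => if_neg (hs.1 b hb).le.not_gt
      rw [h1, h2]
      simp [mul_assoc]
    · have hmem : c₀ ∈ cs := by
        rcases List.mem_cons.1 hc with h' | h'
        · exact absurd h'.symm h
        · exact h'
      rw [if_neg h, if_pos (hs.1 _ hmem), ih hs.2 hmem, mul_smul_comm, ← mul_assoc,
        S.comm (hG c) ha, smul_mul_assoc, smul_smul, mul_assoc, mul_comm (e c) i, mul_comm]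

/-- Sorting a product of homogeneous elements by the values of `p` produces the Koszul sign. -/
theorem prod_blocks_list {T : Type*} {j : ℕ} (p : T → Fin j) {a : T → A} {d : T → ℕ}
    (ha : ∀ t, a t ∈ S.gr (d t)) (l : List T) :
    ((List.finRange j).map fun c => ((l.filter fun t => p t = c).map a).prod).prod =
      listSign p d l • (l.map a).prod := by
  induction l with
  | nil => simp [listSign]
  | cons x l ih =>
    have h1 : ((List.finRange j).map
        fun c => (((x :: l).filter fun t => p t = c).map a).prod) =
        (List.finRange j).map fun c => if c = p x
          then a x * ((l.filter fun t => p t = c).map a).prod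
          else ((l.filter fun t => p t = c).map a).prod := by
      refine List.map_congr_left fun c _ => ?_
      by_cases h : c = p x
      · subst h; simp
      · rw [if_neg h, List.filter_cons_of_neg (by simpa using fun h' => h h'.symm)]
    rw [h1, S.prod_insert (ha x) (fun c => S.list_prod_mem ha _) (p x) _
      (List.pairwise_lt_finRange j) (List.mem_finRange _), ih, mul_smul_comm, smul_smul]
    simp only [List.map_cons, List.prod_cons, listSign]
    congr 1
    rw [mul_comm]
    congr 1
    clear ih h1
    induction l with
    | nil => simp
    | cons t l ih =>
      simp only [List.map_cons, List.prod_cons]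
      rw [← ih, ← Fin.prod_univ_def, ← Fin.prod_univ_def]
      have h2 : (if p t < p x then (-1 : ℝ) ^ (d x * d t) else 1) =
          ∏ c : Fin j, if c = p t then (if c < p x then (-1 : ℝ) ^ (d x * d t) else 1) else 1 := by
        rw [Finset.prod_ite_eq' Finset.univ (p t)]; simp
      rw [h2, ← Finset.prod_mul_distrib]
      refine Finset.prod_congr rfl fun c _ => ?_
      by_cases hc : c = p t
      · subst hc
        by_cases h3 : p t < p x
        · simp [h3, mul_add, pow_add]
        · simp [h3]
      · rw [List.filter_cons_of_neg (by simpa using fun h' => hc h'.symm), if_neg hc, one_mul]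

end SuperGrading

/-! ### Subfamilies -/

theorem sub_eq_comp {n k : ℕ} {α : Type*} (x : Fin n → α) (B : Finset (Fin n))
    (h : B.card = k) {e : Fin k → Fin n} (he : StrictMono e) (hB : ∀ i, e i ∈ B) :
    sub x B = fun i => x (e (i.cast h)) := by
  subst h
  have := Finset.orderEmbOfFin_unique (s := B) rfl hB he
  funext i
  simp only [sub, ← this]
  rfl

theorem ordProd_eq {A : Type*} [Ring A] {n k : ℕ} (a : Fin n → A) (B : Finset (Fin n))
    (h : B.card = k) {e : Fin k → Fin n} (he : StrictMono e) (hB : ∀ i, e i ∈ B) :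
    ordProd a B = (List.ofFn fun i => a (e i)).prod := by
  subst h
  rw [ordProd, sub_eq_comp a B rfl he hB]; rfl

theorem ordProd_eq_filter {A : Type*} [Ring A] {n : ℕ} (a : Fin n → A) (B : Finset (Fin n)) :
    ordProd a B = (((List.finRange n).filter (· ∈ B)).map a).prod := by
  have h : List.ofFn (B.orderEmbOfFin rfl) = (List.finRange n).filter (· ∈ B) := by
    refine List.Perm.eq_of_pairwise (le := (· < ·)) ?_ ?_ ?_ ?_
    · intro a b _ _ h1 h2; exact absurd h1 h2.not_gt
    · rw [List.pairwise_ofFn]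
      intro i j hij
      exact (B.orderEmbOfFin rfl).strictMono hij
    · exact (List.pairwise_lt_finRange n).filter _
    · rw [List.perm_ext_iff_of_nodup]
      · intro t
        rw [List.mem_ofFn, List.mem_filter]
        have := B.range_orderEmbOfFin rfl
        have h2 : t ∈ Set.range (B.orderEmbOfFin rfl) ↔ t ∈ (B : Set (Fin n)) := by rw [this]
        simp only [List.mem_finRange, true_and, decide_eq_true_eq]
        exact h2
      · exact List.nodup_ofFn.2 (B.orderEmbOfFin rfl).injective
      · exact (List.nodup_finRange n).filter _
  rw [ordProd, ← h, List.map_ofFn]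
  rfl

theorem ordProd_univ {A : Type*} [Ring A] {n : ℕ} (a : Fin n → A) :
    ordProd a Finset.univ = (List.ofFn a).prod :=
  ordProd_eq a _ (by simp) (e := id) strictMono_id (by simp)

theorem ordProd_map {A : Type*} [Ring A] {m n : ℕ} (a : Fin n → A) (e : Fin m ↪o Fin n)
    (C : Finset (Fin m)) :
    ordProd a (C.map e.toEmbedding) = ordProd (fun i => a (e i)) C :=
  ordProd_eq a _ (by simp) (e := fun i => e (C.orderEmbOfFin rfl i))
    (e.strictMono.comp (C.orderEmbOfFin rfl).strictMono) (by simp)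

/-- The value of the operation `φ_{|B|}` on the inputs indexed by `B`. -/
def opAt {V W : ℕ → Type*} [∀ i, AddCommGroup (V i)] [∀ i, Module ℝ (V i)]
    [∀ i, AddCommGroup (W i)] [∀ i, Module ℝ (W i)] (φ : Ops V W) {n : ℕ}
    (x : Fin n → ∀ i, V i) (B : Finset (Fin n)) : ∀ i, W i :=
  φ B.card (sub x B)

section

variable {V W : ℕ → Type*} [∀ i, AddCommGroup (V i)] [∀ i, Module ℝ (V i)]
    [∀ i, AddCommGroup (W i)] [∀ i, Module ℝ (W i)] (φ : Ops V W)

theorem opAt_eq {n k : ℕ} (x : Fin n → ∀ i, V i) (B : Finset (Fin n))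
    (h : B.card = k) {e : Fin k → Fin n} (he : StrictMono e) (hB : ∀ i, e i ∈ B) :
    opAt φ x B = φ k fun i => x (e i) := by
  subst h
  rw [opAt, sub_eq_comp x B rfl he hB]; rfl

theorem opAt_univ {n : ℕ} (x : Fin n → ∀ i, V i) : opAt φ x Finset.univ = φ n x :=
  opAt_eq φ x _ (by simp) (e := id) strictMono_id (by simp)

theorem opAt_map {m n : ℕ} (x : Fin n → ∀ i, V i) (e : Fin m ↪o Fin n) (C : Finset (Fin m)) :
    opAt φ x (C.map e.toEmbedding) = opAt φ (fun i => x (e i)) C :=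
  opAt_eq φ x _ (by simp) (e := fun i => e (C.orderEmbOfFin rfl i))
    (e.strictMono.comp (C.orderEmbOfFin rfl).strictMono) (by simp)

end

namespace SuperGrading

variable {A : Type*} [Ring A] [Algebra ℝ A] (S : SuperGrading A)

theorem ordProd_mem {n : ℕ} {a : Fin n → A} {d : Fin n → ℕ} (ha : ∀ t, a t ∈ S.gr (d t))
    (B : Finset (Fin n)) : ordProd a B ∈ S.gr (∑ t ∈ B, d t) := by
  rw [ordProd_eq_filter]
  have := S.list_prod_mem ha ((List.finRange n).filter (· ∈ B))
  convert this using 2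
  rw [← List.sum_toFinset _ ((List.nodup_finRange n).filter _)]
  congr 1
  ext; simp

theorem ofFn_prod_mem {n : ℕ} {a : Fin n → A} {d : Fin n → ℕ}
    (ha : ∀ t, a t ∈ S.gr (d t)) : (List.ofFn a).prod ∈ S.gr (∑ t, d t) := by
  rw [← ordProd_univ]
  exact S.ordProd_mem ha Finset.univ

/-- The product of the blocks of `p` is the Koszul sign times the product in the given order. -/
theorem prod_blocks {n j : ℕ} (p : Fin n → Fin j) {a : Fin n → A} {d : Fin n → ℕ}
    (ha : ∀ t, a t ∈ S.gr (d t)) :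
    (List.ofFn fun c => ordProd a (block p c)).prod = koszulSign p d • (List.ofFn a).prod := by
  rw [koszulSign_eq_listSign, List.ofFn_eq_map, List.ofFn_eq_map, ← S.prod_blocks_list p ha]
  refine congrArg List.prod (List.map_congr_left fun c _ => ?_)
  rw [ordProd_eq_filter]
  simp [block]

theorem prod_perm {n : ℕ} (σ : Equiv.Perm (Fin n)) {a : Fin n → A} {d : Fin n → ℕ}
    (ha : ∀ t, a t ∈ S.gr (d t)) :
    (List.ofFn fun c => a (σ.symm c)).prod = koszulSign σ d • (List.ofFn a).prod := by
  rw [← S.prod_blocks σ ha]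
  refine congrArg List.prod (congrArg List.ofFn (funext fun c => ?_))
  rw [ordProd_eq a (block σ c) (k := 1) (e := fun _ => σ.symm c)]
  · simp
  · have : block σ c = {σ.symm c} := by
      ext b; simp [block, Equiv.eq_symm_apply]
    simp [this]
  · exact Subsingleton.strictMono _
  · simp [block]

/-- A product of homogeneous elements vanishes if the product of two of them does. -/
theorem prod_eq_zero {n : ℕ} {a : Fin n → A} {d : Fin n → ℕ} (ha : ∀ t, a t ∈ S.gr (d t))
    {i j : Fin n} (hij : i ≠ j) (h : a i * a j = 0) : (List.ofFn a).prod = 0 := by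
  wlog hlt : i < j generalizing i j
  · refine this hij.symm ?_ (lt_of_le_of_ne (not_lt.1 hlt) hij.symm)
    rw [S.comm (ha j) (ha i), h, smul_zero]
  let p : Fin n → Fin 2 := fun t => if t = i ∨ t = j then 0 else 1
  have h1 := S.prod_blocks p ha
  have h2 : ordProd a (block p 0) = 0 := by
    have hb : block p 0 = {i, j} := by
      ext t
      simp only [block, p, Finset.mem_filter, Finset.mem_univ, true_and, Finset.mem_insert,
        Finset.mem_singleton]
      split_ifs with h <;> simp [h]
    rw [ordProd_eq a (block p 0) (k := 2) (e := ![i, j])]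
    · simpa [List.ofFn_succ] using h
    · rw [hb, Finset.card_pair hij]
    · intro x y hxy
      fin_cases x <;> fin_cases y <;> simp_all
    · intro x
      rw [hb]
      fin_cases x <;> simp
  have h3 : (List.ofFn fun c => ordProd a (block p c)).prod = 0 := by
    simp [List.ofFn_succ, h2]
  rw [h3] at h1
  have h4 := congrArg (fun z => koszulSign p d • z) h1
  simpa [smul_smul, koszulSign_mul_self] using h4.symm

/-- Homogeneous multiples of the same square-zero homogeneous element have product zero. -/
theorem mul_eq_zero_of_factor {i j k : ℕ} {e x y : A} (he : e ∈ S.gr i) (hx : x ∈ S.gr j)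
    (_hy : y ∈ S.gr k) (h : e * e = 0) : (e * x) * (e * y) = 0 := by
  rw [mul_assoc, ← mul_assoc x e y, S.comm hx he, smul_mul_assoc, mul_smul_comm, mul_assoc,
    ← mul_assoc e e, h, zero_mul, smul_zero]

/-- Any factor of a product of homogeneous elements can be moved to the front. -/
theorem ordProd_eq_mul {n : ℕ} {a : Fin n → A} {d : Fin n → ℕ} (ha : ∀ t, a t ∈ S.gr (d t))
    {B : Finset (Fin n)} {t : Fin n} (ht : t ∈ B) :
    ∃ b : A, ∃ k, b ∈ S.gr k ∧ ordProd a B = a t * b := by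
  let e := B.orderEmbOfFin rfl
  obtain ⟨i, hi⟩ : ∃ i, e i = t := by
    have := B.range_orderEmbOfFin rfl
    have h2 : t ∈ Set.range (B.orderEmbOfFin rfl) := by rw [this]; exact ht
    exact h2
  let p : Fin B.card → Fin 2 := fun s => if s = i then 0 else 1
  have h1 := S.prod_blocks p (fun s => ha (e s))
  have h2 : ordProd (fun s => a (e s)) (block p 0) = a t := by
    rw [ordProd_eq _ (block p 0) (k := 1) (e := fun _ => i)]
    · simp [hi]
    · have : block p 0 = {i} := by
        ext t; simp only [block, p, Finset.mem_filter, Finset.mem_univ, true_and,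
          Finset.mem_singleton]
        split_ifs with h <;> simp [h]
      simp [this]
    · exact Subsingleton.strictMono _
    · simp [block, p]
  refine ⟨koszulSign p (fun s => d (e s)) • ordProd (fun s => a (e s)) (block p 1), _,
    Submodule.smul_mem _ _ (S.ordProd_mem (fun s => ha (e s)) _), ?_⟩
  have h3 := congrArg (fun z => koszulSign p (fun s => d (e s)) • z) h1
  simp only [smul_smul, koszulSign_mul_self, one_smul] at h3
  rw [mul_smul_comm, ← h2]
  refine Eq.trans h3.symm ?_
  simp [List.ofFn_succ]

theorem ordProd_mul_eq_zero {n : ℕ} {a : Fin n → A} {d : Fin n → ℕ}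
    (ha : ∀ t, a t ∈ S.gr (d t)) (hsq : ∀ t, a t * a t = 0) {B C : Finset (Fin n)}
    (h : ¬ Disjoint B C) : ordProd a B * ordProd a C = 0 := by
  obtain ⟨t, htB, htC⟩ := Finset.not_disjoint_iff.1 h
  obtain ⟨x, j, hx, hB⟩ := S.ordProd_eq_mul ha htB
  obtain ⟨y, k, hy, hC⟩ := S.ordProd_eq_mul ha htC
  rw [hB, hC, S.mul_eq_zero_of_factor (ha t) hx hy (hsq t)]

theorem mul_self_of_odd {a : A} (ha : a ∈ S.gr 1) : a * a = 0 := by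
  have := S.comm ha ha
  simp only [mul_one, pow_one, neg_smul, one_smul] at this
  have h2 : (2 : ℝ) • (a * a) = 0 := by
    rw [two_smul]; nth_rewrite 1 [this]; simp
  exact (smul_eq_zero.1 h2).resolve_left two_ne_zero

end SuperGrading

end LInfty

namespace LInfty

open scoped TensorProduct

/-! ### Extension of operations to points with values in a supercommutative algebra -/

section Hat

variable (A : Type*) [Ring A] [Algebra ℝ A] [Module.Finite ℝ A]
  {V W X : Type*} [AddCommGroup V] [Module ℝ V] [AddCommGroup W] [Module ℝ W]
  [AddCommGroup X] [Module ℝ X]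

/-- The extension of scalars of a multilinear map `φ` to a (noncommutative) algebra `A`, with
`(a₁ ⊗ x₁, …, aₖ ⊗ xₖ) ↦ a₁ ⋯ aₖ ⊗ φ(x₁, …, xₖ)`. -/
noncomputable def hat {k : ℕ} (φ : MultilinearMap ℝ (fun _ : Fin k => V) W) :
    MultilinearMap ℝ (fun _ : Fin k => A ⊗[ℝ] V) (A ⊗[ℝ] W) :=
  ∑ κ : Fin k → Fin (Module.finrank ℝ A),
    (TensorProduct.mk ℝ A W (List.ofFn fun c => Module.finBasis ℝ A (κ c)).prod).compMultilinearMap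
      (φ.compLinearMap fun c =>
        (TensorProduct.lid ℝ V).toLinearMap ∘ₗ ((Module.finBasis ℝ A).coord (κ c)).rTensor V)

variable {A}

theorem hat_tmul {k : ℕ} (φ : MultilinearMap ℝ (fun _ : Fin k => V) W) (a : Fin k → A)
    (x : Fin k → V) :
    hat A φ (fun c => a c ⊗ₜ x c) = (List.ofFn a).prod ⊗ₜ φ x := by
  have h1 : (List.ofFn a).prod = ∑ κ : Fin k → Fin (Module.finrank ℝ A),
      (∏ c, (Module.finBasis ℝ A).coord (κ c) (a c)) •
        (List.ofFn fun c => Module.finBasis ℝ A (κ c)).prod := by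
    have h2 : a = fun c => ∑ t, (Module.finBasis ℝ A).coord t (a c) • Module.finBasis ℝ A t := by
      funext c
      exact ((Module.finBasis ℝ A).sum_repr (a c)).symm
    have h3 := (MultilinearMap.mkPiAlgebraFin ℝ k A).map_sum
      (fun c t => (Module.finBasis ℝ A).coord t (a c) • Module.finBasis ℝ A t)
    rw [← h2, MultilinearMap.mkPiAlgebraFin_apply] at h3
    rw [h3]
    refine Finset.sum_congr rfl fun κ _ => ?_
    rw [MultilinearMap.map_smul_univ, MultilinearMap.mkPiAlgebraFin_apply]
  rw [h1, TensorProduct.sum_tmul]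
  simp only [hat, sum_apply]
  refine Finset.sum_congr rfl fun κ _ => ?_
  simp only [LinearMap.compMultilinearMap_apply, MultilinearMap.compLinearMap_apply,
    LinearMap.comp_apply, LinearMap.rTensor_tmul, LinearEquiv.coe_coe, TensorProduct.lid_tmul,
    TensorProduct.mk_apply]
  rw [MultilinearMap.map_smul_univ, TensorProduct.tmul_smul, TensorProduct.smul_tmul']

/-- Multilinear maps which agree on the elements of a set agree on its span. -/
theorem eq_of_mem_span {k : ℕ} {P Q : Type*} [AddCommGroup P] [Module ℝ P] [AddCommGroup Q]
    [Module ℝ Q] {f g : MultilinearMap ℝ (fun _ : Fin k => P) Q} {s : Set P}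
    (h : ∀ y : Fin k → P, (∀ c, y c ∈ s) → f y = g y) (y : Fin k → P)
    (hy : ∀ c, y c ∈ Submodule.span ℝ s) : f y = g y := by
  choose n r z hz using fun c => Submodule.mem_span_set'.1 (hy c)
  rw [← funext hz, MultilinearMap.map_sum, MultilinearMap.map_sum]
  refine Finset.sum_congr rfl fun κ _ => ?_
  rw [MultilinearMap.map_smul_univ, MultilinearMap.map_smul_univ, h _ fun c => (z c (κ c)).2]

/-- Membership of the values of a multilinear map in a submodule can be tested on a spanning
set. -/
theorem map_mem_of_mem_span {k : ℕ} {P Q : Type*} [AddCommGroup P] [Module ℝ P] [AddCommGroup Q]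
    [Module ℝ Q] {f : MultilinearMap ℝ (fun _ : Fin k => P) Q} {s : Fin k → Set P}
    {T : Submodule ℝ Q} (h : ∀ y : Fin k → P, (∀ c, y c ∈ s c) → f y ∈ T) (y : Fin k → P)
    (hy : ∀ c, y c ∈ Submodule.span ℝ (s c)) : f y ∈ T := by
  choose n r z hz using fun c => Submodule.mem_span_set'.1 (hy c)
  rw [← funext hz, MultilinearMap.map_sum]
  refine Submodule.sum_mem _ fun κ _ => ?_
  rw [MultilinearMap.map_smul_univ]
  exact T.smul_mem _ (h _ fun c => (z c (κ c)).2)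

theorem hat_cons_smul {k : ℕ} (φ : MultilinearMap ℝ (fun _ : Fin (k + 1) => V) W) (e : A)
    (H : A ⊗[ℝ] V) (y : Fin k → A ⊗[ℝ] V) :
    hat A φ (Fin.cons (e • H) y) = e • hat A φ (Fin.cons H y) := by
  let μ : (A ⊗[ℝ] V) →ₗ[ℝ] A ⊗[ℝ] V := Algebra.lsmul ℝ ℝ _ e
  let ν : (A ⊗[ℝ] W) →ₗ[ℝ] A ⊗[ℝ] W := Algebra.lsmul ℝ ℝ _ e
  let s : Set (A ⊗[ℝ] V) := {t | ∃ (m : A) (n : V), m ⊗ₜ[ℝ] n = t}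
  have key := eq_of_mem_span (k := k + 1)
    (f := (hat A φ).compLinearMap (Fin.cons μ fun _ => LinearMap.id))
    (g := ν.compMultilinearMap (hat A φ)) (s := s) (fun y hy => by
      choose a x hax using hy
      obtain rfl : y = fun c => a c ⊗ₜ x c := (funext hax).symm
      have h1 : (fun c => (Fin.cons (α := fun _ => (A ⊗[ℝ] V) →ₗ[ℝ] A ⊗[ℝ] V) μ
          (fun _ => LinearMap.id) c) (a c ⊗ₜ[ℝ] x c)) =
          fun c => (Fin.cons (α := fun _ => A) (e * a 0) (fun c => a c.succ) c) ⊗ₜ x c := by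
        funext c
        refine Fin.cases ?_ (fun c => ?_) c
        · simp [μ, TensorProduct.smul_tmul']
        · simp
      rw [MultilinearMap.compLinearMap_apply, h1, hat_tmul, LinearMap.compMultilinearMap_apply,
        hat_tmul]
      simp [ν, List.ofFn_succ, TensorProduct.smul_tmul', mul_assoc])
    (Fin.cons H y) (fun c => by rw [TensorProduct.span_tmul_eq_top]; trivial)
  rw [MultilinearMap.compLinearMap_apply, LinearMap.compMultilinearMap_apply] at key
  refine Eq.trans (congrArg _ (funext fun c => ?_)) key
  refine Fin.cases ?_ (fun c => ?_) c
  · simp [μ]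
  · simp

theorem hat_comp {k : ℕ} (T : W →ₗ[ℝ] X) (φ : MultilinearMap ℝ (fun _ : Fin k => V) W)
    (y : Fin k → A ⊗[ℝ] V) :
    hat A (T.compMultilinearMap φ) y = T.lTensor A (hat A φ y) := by
  simp only [hat, sum_apply, LinearMap.compMultilinearMap_apply, map_sum,
    TensorProduct.mk_apply, LinearMap.lTensor_tmul, MultilinearMap.compLinearMap_apply]

theorem hat_add {k : ℕ} (φ ψ : MultilinearMap ℝ (fun _ : Fin k => V) W) :
    hat A (φ + ψ) = hat A φ + hat A ψ := by
  ext y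
  simp only [hat, sum_apply, LinearMap.compMultilinearMap_apply,
    TensorProduct.mk_apply, MultilinearMap.compLinearMap_apply, add_apply,
    TensorProduct.tmul_add, Finset.sum_add_distrib]

theorem hat_zero {k : ℕ} : hat A (0 : MultilinearMap ℝ (fun _ : Fin k => V) W) = 0 := by
  ext y
  simp [hat]

end Hat

/-! ### Expansion of symmetric multilinear maps -/

theorem sum_injective_eq {k n : ℕ} {Q : Type*} [AddCommGroup Q] [Module ℝ Q]
    (F : (Fin k → Fin n) → Q) (hsymm : ∀ κ (σ : Equiv.Perm (Fin k)), F (κ ∘ σ) = F κ)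
    (hzero : ∀ κ, ¬ Function.Injective κ → F κ = 0) :
    (k.factorial : ℝ)⁻¹ • ∑ κ, F κ =
      ∑ B ∈ (Finset.powersetCard k (Finset.univ : Finset (Fin n))).attach,
        F (B.1.orderEmbOfFin (Finset.mem_powersetCard.1 B.2).2) := by
  classical
  let e : ∀ B : {B // B ∈ Finset.powersetCard k (Finset.univ : Finset (Fin n))},
    Fin k ↪o Fin n := fun B => B.1.orderEmbOfFin (Finset.mem_powersetCard.1 B.2).2
  have he : ∀ B, Set.range (e B) = (B.1 : Set (Fin n)) := fun B => B.1.range_orderEmbOfFin _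
  have h1 : ∑ κ, F κ = ∑ z ∈ (Finset.powersetCard k (Finset.univ : Finset (Fin n))).attach ×ˢ
      (Finset.univ : Finset (Equiv.Perm (Fin k))), F (e z.1 ∘ z.2) := by
    symm
    refine Finset.sum_of_injOn (fun z => e z.1 ∘ z.2) ?_ (by simp) ?_ (fun _ _ => rfl)
    · rintro ⟨B, σ⟩ _ ⟨C, τ⟩ _ h
      have hB : B = C := by
        have h2 : Set.range (e B ∘ σ) = Set.range (e C ∘ τ) := congrArg Set.range h
        rw [σ.surjective.range_comp, τ.surjective.range_comp, he, he] at h2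
        exact Subtype.ext (Finset.coe_injective h2)
      subst hB
      have : σ = τ := by
        ext1 x
        exact (e B).injective (congrFun h x)
      rw [this]
    · intro κ _ hκ
      apply hzero
      intro hinj
      apply hκ
      have hcard : (Finset.univ.image κ) ∈ Finset.powersetCard k Finset.univ := by
        rw [Finset.mem_powersetCard]
        exact ⟨Finset.subset_univ _, by rw [Finset.card_image_of_injective _ hinj]; simp⟩
      let B : {B // B ∈ Finset.powersetCard k (Finset.univ : Finset (Fin n))} := ⟨_, hcard⟩
      have hex : ∀ x, ∃ y, e B y = κ x := by
        intro x
        have : κ x ∈ Set.range (e B) := by rw [he]; simp [B]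
        exact this
      choose τ hτ using hex
      have hτi : Function.Injective τ := fun x y hxy => hinj (by rw [← hτ, ← hτ, hxy])
      refine ⟨(B, Equiv.ofBijective τ (Finite.injective_iff_bijective.1 hτi)), by simp, ?_⟩
      funext x
      exact hτ x
  rw [h1, Finset.sum_product, Finset.smul_sum]
  refine Finset.sum_congr rfl fun B _ => ?_
  rw [Finset.sum_congr rfl fun σ _ => hsymm (e B) σ, Finset.sum_const, Finset.card_univ,
    Fintype.card_perm, Fintype.card_fin, ← Nat.cast_smul_eq_nsmul ℝ, smul_smul,
    inv_mul_cancel₀ (by positivity), one_smul]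

/-- A sum over families of subsets which is supported on disjoint families, written as a sum over
the union `U` of the family and over all distributions of `U` over the members. -/
theorem sum_disjoint_eq {n j : ℕ} {Q : Type*} [AddCommGroup Q]
    (T : (Fin j → Finset (Fin n)) → Q)
    (hT : ∀ B, ∀ c c', c ≠ c' → ¬ Disjoint (B c) (B c') → T B = 0) :
    ∑ B, T B = ∑ U : Finset (Fin n), ∑ p : Fin U.card → Fin j,
      T fun c => (block p c).map (U.orderEmbOfFin rfl).toEmbedding := by
  classical
  rw [Finset.sum_sigma']
  symm
  have hmem : ∀ (U : Finset (Fin n)) (p : Fin U.card → Fin j) (c : Fin j) (x : Fin n),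
      x ∈ (block p c).map (U.orderEmbOfFin rfl).toEmbedding ↔
        ∃ i, p i = c ∧ U.orderEmbOfFin rfl i = x := by
    intro U p c x
    simp [block]
  have hU : ∀ (U : Finset (Fin n)) (x : Fin n), x ∈ U ↔ ∃ i, U.orderEmbOfFin rfl i = x := by
    intro U x
    have : x ∈ Set.range (U.orderEmbOfFin rfl) ↔ x ∈ (U : Set (Fin n)) := by
      rw [U.range_orderEmbOfFin]
    exact this.symm
  refine Finset.sum_of_injOn (fun z : (U : Finset (Fin n)) × (Fin U.card → Fin j) =>
    fun c => (block z.2 c).map (z.1.orderEmbOfFin rfl).toEmbedding) ?_ (by simp) ?_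
    (fun _ _ => rfl)
  · rintro ⟨U, p⟩ _ ⟨U', p'⟩ _ h
    have h1 : ∀ c x, (∃ i, p i = c ∧ U.orderEmbOfFin rfl i = x) ↔
        ∃ i, p' i = c ∧ U'.orderEmbOfFin rfl i = x := by
      intro c x
      rw [← hmem, ← hmem]
      have := congrFun h c
      simp only at this
      rw [this]
    have hUU : U = U' := by
      ext x
      rw [hU, hU]
      constructor
      · rintro ⟨i, hi⟩
        obtain ⟨i', _, h'⟩ := (h1 _ x).1 ⟨i, rfl, hi⟩
        exact ⟨i', h'⟩
      · rintro ⟨i, hi⟩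
        obtain ⟨i', _, h'⟩ := (h1 _ x).2 ⟨i, rfl, hi⟩
        exact ⟨i', h'⟩
    subst hUU
    have : p = p' := by
      funext i
      obtain ⟨i', h2, h3⟩ := (h1 (p i) _).1 ⟨i, rfl, rfl⟩
      rw [← h2, (U.orderEmbOfFin rfl).injective h3]
    rw [this]
  · intro B _ hB
    by_contra hne
    apply hB
    have hdis : ∀ c c', c ≠ c' → Disjoint (B c) (B c') := by
      intro c c' hcc
      by_contra h
      exact hne (hT B c c' hcc h)
    let U := Finset.univ.biUnion B
    have hex : ∀ i : Fin U.card, ∃ c, U.orderEmbOfFin rfl i ∈ B c := by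
      intro i
      obtain ⟨c, _, hc⟩ := Finset.mem_biUnion.1 (U.orderEmbOfFin_mem rfl i)
      exact ⟨c, hc⟩
    choose p hp using hex
    refine ⟨⟨U, p⟩, by simp, ?_⟩
    funext c
    ext x
    simp only
    rw [hmem]
    constructor
    · rintro ⟨i, rfl, rfl⟩
      exact hp i
    · intro hx
      obtain ⟨i, hi⟩ := (hU U x).1 (by simp only [U, Finset.mem_biUnion]; exact ⟨c, by simp, hx⟩)
      refine ⟨i, ?_, hi⟩
      by_contra hne'
      have := hp i
      rw [hi] at this
      exact Finset.disjoint_left.1 (hdis _ _ hne') this hx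

end LInfty

namespace LInfty

open scoped TensorProduct

/-! ### Even and odd points -/

section Points

variable {A : Type*} [Ring A] [Algebra ℝ A] (S : SuperGrading A)
  {V W X : ℕ → Type*} [∀ i, AddCommGroup (V i)] [∀ i, Module ℝ (V i)]
  [∀ i, AddCommGroup (W i)] [∀ i, Module ℝ (W i)] [∀ i, AddCommGroup (X i)] [∀ i, Module ℝ (X i)]

variable (V) in
/-- The pure tensors `a ⊗ x` with `a² = 0`, where `a` and `x` have the same parity. -/
def evenGens : Set (A ⊗[ℝ] (∀ i, V i)) :=
  {z | ∃ (i : ℕ) (a : A) (x : V i), a ∈ S.gr i ∧ a * a = 0 ∧ z = a ⊗ₜ Pi.single i x}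

variable (V) in
/-- The (nilpotent) even `A`-valued points of a graded vector space. -/
def evenPts : Submodule ℝ (A ⊗[ℝ] (∀ i, V i)) := Submodule.span ℝ (evenGens S V)

variable (V) in
/-- The pure tensors `a ⊗ x`, where `a` and `x` have opposite parity. -/
def oddGens : Set (A ⊗[ℝ] (∀ i, V i)) :=
  {z | ∃ (i : ℕ) (a : A) (x : V i), a ∈ S.gr (i + 1) ∧ z = a ⊗ₜ Pi.single i x}

variable (V) in
/-- The odd `A`-valued points of a graded vector space. -/
def oddPts : Submodule ℝ (A ⊗[ℝ] (∀ i, V i)) := Submodule.span ℝ (oddGens S V)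

variable (V) in
/-- The multiples of `e` among the generators of the even points, for an odd scalar `e`. -/
def multGens (e : A) : Set (A ⊗[ℝ] (∀ i, V i)) :=
  {z | ∃ (i : ℕ) (a : A) (x : V i), a ∈ S.gr (i + 1) ∧ z = (e * a) ⊗ₜ Pi.single i x}

variable {S}

theorem multGens_subset {e : A} (he : e ∈ S.gr 1) : multGens S V e ⊆ evenGens S V := by
  rintro z ⟨i, a, x, ha, rfl⟩
  refine ⟨i, e * a, x, ?_, ?_, rfl⟩
  · rw [← S.add_two i]
    have := S.mul_mem he ha
    rwa [show 1 + (i + 1) = i + 2 by ring] at this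
  · exact S.mul_eq_zero_of_factor he ha ha (S.mul_self_of_odd he)

theorem smul_mem_span_multGens {e : A} {K : A ⊗[ℝ] (∀ i, V i)} (hK : K ∈ oddPts S V) :
    e • K ∈ Submodule.span ℝ (multGens S V e) := by
  let μ : (A ⊗[ℝ] (∀ i, V i)) →ₗ[ℝ] A ⊗[ℝ] (∀ i, V i) := Algebra.lsmul ℝ ℝ _ e
  change μ K ∈ _
  have : oddPts S V ≤ (Submodule.span ℝ (multGens S V e)).comap μ := by
    rw [oddPts, Submodule.span_le]
    rintro z ⟨i, a, x, ha, rfl⟩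
    exact Submodule.subset_span ⟨i, a, x, ha, rfl⟩
  exact this hK

theorem smul_mem_evenPts {e : A} (he : e ∈ S.gr 1) {K : A ⊗[ℝ] (∀ i, V i)}
    (hK : K ∈ oddPts S V) : e • K ∈ evenPts S V :=
  Submodule.span_mono (multGens_subset he) (smul_mem_span_multGens hK)

theorem exists_eq_sum_of_mem_evenPts {Y : A ⊗[ℝ] (∀ i, V i)} (hY : Y ∈ evenPts S V) :
    ∃ (n : ℕ) (d : Fin n → ℕ) (v : ∀ t, V (d t)) (a : Fin n → A), (∀ t, a t ∈ S.gr (d t)) ∧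
      (∀ t, a t * a t = 0) ∧ Y = ∑ t, a t ⊗ₜ homog d v t := by
  obtain ⟨n, r, z, rfl⟩ := Submodule.mem_span_set'.1 hY
  choose d a v ha hsq hz using fun t => (z t).2
  refine ⟨n, d, fun t => r t • v t, a, ha, hsq, Finset.sum_congr rfl fun t _ => ?_⟩
  rw [hz, homog, ← TensorProduct.tmul_smul, Pi.single_smul]

variable [Module.Finite ℝ A]

/-- The extension of a graded symmetric operation is symmetric on even points. -/
theorem hat_perm {φ : Ops V W} (hφ : IsGradedSymmetric φ) {k : ℕ} (σ : Equiv.Perm (Fin k))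
    (y : Fin k → A ⊗[ℝ] (∀ i, V i)) (hy : ∀ c, y c ∈ evenPts S V) :
    hat A (φ k) (fun c => y (σ c)) = hat A (φ k) y := by
  refine eq_of_mem_span (f := (hat A (φ k)).domDomCongr σ) (g := hat A (φ k))
    (s := evenGens S V) (fun y hy => ?_) y hy
  choose d a v ha _ hz using hy
  obtain rfl : y = fun t => a t ⊗ₜ homog d v t := funext hz
  rw [MultilinearMap.domDomCongr_apply, hat_tmul (φ k) (fun c => a (σ c)), hat_tmul]
  have h1 := S.prod_perm σ.symm ha
  have h2 := hφ k σ.symm d v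
  rw [Equiv.symm_symm] at h1 h2
  rw [h1, h2, TensorProduct.smul_tmul_smul, koszulSign_mul_self, one_smul]

theorem hat_eq_zero_of_mul_eq_zero {k : ℕ}
    (φ : MultilinearMap ℝ (fun _ : Fin k => ∀ i, V i) (∀ i, W i)) {a : Fin k → A} {d : Fin k → ℕ}
    (ha : ∀ t, a t ∈ S.gr (d t)) (x : Fin k → ∀ i, V i) {i j : Fin k} (hij : i ≠ j)
    (h : a i * a j = 0) : hat A φ (fun t => a t ⊗ₜ x t) = 0 := by
  rw [hat_tmul, S.prod_eq_zero ha hij h, TensorProduct.zero_tmul]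

/-- The extension of an operation vanishes if two of its arguments are multiples of the same odd
scalar. -/
theorem hat_eq_zero_of_smul {k : ℕ}
    (φ : MultilinearMap ℝ (fun _ : Fin k => ∀ i, V i) (∀ i, W i)) {e : A} (he : e ∈ S.gr 1)
    (y : Fin k → A ⊗[ℝ] (∀ i, V i)) {i j : Fin k} (hij : i ≠ j)
    (hi : y i ∈ Submodule.span ℝ (multGens S V e)) (hj : y j ∈ Submodule.span ℝ (multGens S V e))
    (hy : ∀ c, y c ∈ evenPts S V) : hat A φ y = 0 := by
  have := map_mem_of_mem_span (f := hat A φ) (T := ⊥)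
    (s := fun c => if c = i ∨ c = j then multGens S V e else evenGens S V) (fun y hy => ?_) y ?_
  · simpa using this
  · have hy' : ∀ c, y c ∈ evenGens S V := by
      intro c
      have := hy c
      split_ifs at this
      · exact multGens_subset he this
      · exact this
    have hyi := hy i
    have hyj := hy j
    simp only [true_or, or_true, if_true] at hyi hyj
    have h2 : ∀ c, ∃ (p : ℕ) (a : A) (x : V p), a ∈ S.gr p ∧ y c = a ⊗ₜ Pi.single p x ∧
        (c = i ∨ c = j → ∃ q, ∃ b ∈ S.gr q, a = e * b) := by
      intro c
      by_cases hc : c = i ∨ c = j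
      · have hc' : y c ∈ multGens S V e := by rcases hc with rfl | rfl <;> assumption
        obtain ⟨p, b, x, hb, hz⟩ := hc'
        refine ⟨p, e * b, x, ?_, hz, fun _ => ⟨_, b, hb, rfl⟩⟩
        rw [← S.add_two p]
        have := S.mul_mem he hb
        rwa [show 1 + (p + 1) = p + 2 by ring] at this
      · obtain ⟨p, a, x, ha, _, hz⟩ := hy' c
        exact ⟨p, a, x, ha, hz, fun h => absurd h hc⟩
    choose d a v ha hz hmul using h2
    obtain rfl : y = fun t => a t ⊗ₜ homog d v t := funext hz
    obtain ⟨q, b, hb, hab⟩ := hmul i (Or.inl rfl)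
    obtain ⟨q', b', hb', hab'⟩ := hmul j (Or.inr rfl)
    refine (Submodule.mem_bot ℝ).2 (hat_eq_zero_of_mul_eq_zero φ ha _ hij ?_)
    rw [hab, hab']
    exact S.mul_eq_zero_of_factor he hb hb' (S.mul_self_of_odd he)
  · intro c
    split_ifs with hc
    · rcases hc with rfl | rfl <;> assumption
    · exact hy c

/-! ### Operations as polynomial functions on even points -/

/-- The polynomial function `Y ↦ ∑ₖ φₖ(Y, …, Y) / k!` on points. -/
noncomputable def evalPt (N : ℕ) (φ : Ops V W) (Y : A ⊗[ℝ] (∀ i, V i)) : A ⊗[ℝ] (∀ i, W i) :=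
  ∑ k ∈ Finset.range N, (k.factorial : ℝ)⁻¹ • hat A (φ k) fun _ => Y

/-- The derivative `∑ₖ φₖ₊₁(K, Y, …, Y) / k!` of `evalPt` at `Y` in the direction `K`. -/
noncomputable def derivPt (N : ℕ) (φ : Ops V W) (Y K : A ⊗[ℝ] (∀ i, V i)) :
    A ⊗[ℝ] (∀ i, W i) :=
  ∑ k ∈ Finset.range N, (k.factorial : ℝ)⁻¹ • hat A (φ (k + 1)) (Fin.cons K fun _ => Y)

theorem derivPt_smul (N : ℕ) (φ : Ops V W) (e : A) (Y K : A ⊗[ℝ] (∀ i, V i)) :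
    derivPt N φ Y (e • K) = e • derivPt N φ Y K := by
  simp only [derivPt, Finset.smul_sum, hat_cons_smul]
  exact Finset.sum_congr rfl fun k _ => (smul_comm _ _ _)

theorem hat_add_smul {φ : Ops V W} (hφ : IsGradedSymmetric φ) {e : A} (he : e ∈ S.gr 1) (k : ℕ)
    {Y K : A ⊗[ℝ] (∀ i, V i)} (hY : Y ∈ evenPts S V) (hK : K ∈ oddPts S V) :
    hat A (φ (k + 1)) (fun _ => Y + e • K) = hat A (φ (k + 1)) (fun _ => Y) +
      ((k : ℝ) + 1) • hat A (φ (k + 1)) (Fin.cons (e • K) fun _ => Y) := by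
  classical
  set H := e • K with hH
  have hHm : H ∈ Submodule.span ℝ (multGens S V e) := smul_mem_span_multGens hK
  have hHe : H ∈ evenPts S V := smul_mem_evenPts he hK
  have h0 : (fun _ : Fin (k + 1) => Y + H) = (fun _ => H) + fun _ => Y := by
    funext c; exact add_comm _ _
  have hev : ∀ (s : Finset (Fin (k + 1))) c,
      s.piecewise (fun _ => H) (fun _ => Y) c ∈ evenPts S V := by
    intro s c
    by_cases hc : c ∈ s
    · rw [Finset.piecewise_eq_of_mem _ _ _ hc]; exact hHe
    · rw [Finset.piecewise_eq_of_notMem _ _ _ hc]; exact hY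
  rw [h0, MultilinearMap.map_add_univ]
  have h1 : ∑ s : Finset (Fin (k + 1)), hat A (φ (k + 1)) (s.piecewise (fun _ => H) fun _ => Y) =
      ∑ s ∈ insert ∅ (Finset.univ.image fun c : Fin (k + 1) => ({c} : Finset (Fin (k + 1)))),
        hat A (φ (k + 1)) (s.piecewise (fun _ => H) fun _ => Y) := by
    symm
    refine Finset.sum_subset (Finset.subset_univ _) fun s _ hs => ?_
    have hs2 : 1 < s.card := by
      by_contra hle
      apply hs
      rcases Nat.lt_or_ge s.card 1 with h | h
      · have : s = ∅ := Finset.card_eq_zero.1 (by omega)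
        simp [this]
      · obtain ⟨c, rfl⟩ := Finset.card_eq_one.1 (show s.card = 1 by omega)
        simp
    obtain ⟨i, hi, j, hj, hij⟩ := Finset.one_lt_card.1 hs2
    refine hat_eq_zero_of_smul (φ (k + 1)) he _ hij ?_ ?_ (hev s)
    · rw [Finset.piecewise_eq_of_mem _ _ _ hi]; exact hHm
    · rw [Finset.piecewise_eq_of_mem _ _ _ hj]; exact hHm
  rw [h1, Finset.sum_insert (by simp),
    Finset.sum_image (Finset.singleton_injective (α := Fin (k + 1))).injOn]
  congr 1
  have h2 : ∀ c : Fin (k + 1), hat A (φ (k + 1))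
      (({c} : Finset (Fin (k + 1))).piecewise (fun _ => H) fun _ => Y) =
        hat A (φ (k + 1)) (Fin.cons H fun _ => Y) := by
    intro c
    rw [← hat_perm (S := S) hφ (Equiv.swap 0 c) _ (hev {c})]
    congr 1
    funext x
    by_cases hx : x = 0
    · subst hx
      simp
    · rw [Finset.piecewise_eq_of_notMem]
      · obtain ⟨x, rfl⟩ := Fin.exists_succ_eq.2 hx
        rfl
      · simp only [Finset.mem_singleton]
        intro h
        apply hx
        have := congrArg (Equiv.swap 0 c) h
        simpa using this
  rw [Finset.sum_congr rfl fun c _ => h2 c, Finset.sum_const, Finset.card_univ, Fintype.card_fin,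
    ← Nat.cast_smul_eq_nsmul ℝ]
  push_cast
  rfl

/-- The first order Taylor formula, exact for an increment which is a multiple of an odd
scalar. -/
theorem evalPt_add_smul {N : ℕ} {φ : Ops V W} (hφ : IsGradedSymmetric φ)
    (hN : ∀ k, N ≤ k → φ k = 0) {e : A} (he : e ∈ S.gr 1)
    {Y K : A ⊗[ℝ] (∀ i, V i)} (hY : Y ∈ evenPts S V) (hK : K ∈ oddPts S V) :
    evalPt N φ (Y + e • K) = evalPt N φ Y + e • derivPt N φ Y K := by
  have h1 : ∀ Z : A ⊗[ℝ] (∀ i, V i), evalPt N φ Z =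
      (∑ k ∈ Finset.range N, ((k + 1).factorial : ℝ)⁻¹ • hat A (φ (k + 1)) fun _ => Z) +
        (Nat.factorial 0 : ℝ)⁻¹ • hat A (φ 0) fun _ => Z := by
    intro Z
    rw [← Finset.sum_range_succ' (fun k => (k.factorial : ℝ)⁻¹ • hat A (φ k) fun _ => Z),
      Finset.sum_range_succ, hN N le_rfl, hat_zero]
    simp [evalPt]
  rw [h1, h1, ← derivPt_smul, derivPt, add_right_comm, ← Finset.sum_add_distrib]
  congr 1
  · refine Finset.sum_congr rfl fun k _ => ?_
    rw [hat_add_smul hφ he k hY hK, smul_add, smul_smul]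
    congr 2
    rw [Nat.factorial_succ]
    push_cast
    field_simp
  · congr 2
    exact Subsingleton.elim _ _

theorem hat_pure_mem {φ : Ops V W} {r : ℕ} (hφ : HasDegree φ r) {k : ℕ} {d : Fin k → ℕ}
    (v : ∀ t, V (d t)) {a : Fin k → A} :
    hat A (φ k) (fun t => a t ⊗ₜ homog d v t) =
      (List.ofFn a).prod ⊗ₜ Pi.single ((∑ t, d t) + r) (φ k (homog d v) ((∑ t, d t) + r)) := by
  rw [hat_tmul]
  congr 1
  funext j
  by_cases hj : j = (∑ t, d t) + r
  · subst hj; simp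
  · rw [Pi.single_eq_of_ne hj, hφ k d v j hj]

theorem evalPt_mem_evenPts {N : ℕ} {φ : Ops V W} (h0 : φ 0 = 0) (hφ : HasDegree φ 0)
    {Y : A ⊗[ℝ] (∀ i, V i)} (hY : Y ∈ evenPts S V) : evalPt N φ Y ∈ evenPts S W := by
  refine Submodule.sum_mem _ fun k _ => Submodule.smul_mem _ _ ?_
  cases k with
  | zero => rw [h0, hat_zero]; exact Submodule.zero_mem _
  | succ k =>
    refine map_mem_of_mem_span (s := fun _ => evenGens S V) (fun y hy => ?_) _ fun _ => hY
    choose d a v ha hsq hz using hy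
    obtain rfl : y = fun t => a t ⊗ₜ homog d v t := funext hz
    rw [hat_pure_mem hφ v]
    refine Submodule.subset_span ⟨_, _, _, S.ofFn_prod_mem ha, ?_, rfl⟩
    have h1 : (List.ofFn fun i : Fin k => a i.succ).prod ∈ S.gr (∑ i : Fin k, d i.succ) :=
      S.ofFn_prod_mem fun i => ha i.succ
    simp only [List.ofFn_succ, List.prod_cons]
    exact S.mul_eq_zero_of_factor (ha 0) h1 h1 (hsq 0)

theorem evalPt_mem_oddPts {N : ℕ} {φ : Ops V W} (hφ : HasDegree φ 1)
    {Y : A ⊗[ℝ] (∀ i, V i)} (hY : Y ∈ evenPts S V) : evalPt N φ Y ∈ oddPts S W := by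
  refine Submodule.sum_mem _ fun k _ => Submodule.smul_mem _ _ ?_
  refine map_mem_of_mem_span (s := fun _ => evenGens S V) (fun y hy => ?_) _ fun _ => hY
  choose d a v ha hsq hz using hy
  obtain rfl : y = fun t => a t ⊗ₜ homog d v t := funext hz
  rw [hat_pure_mem hφ v]
  refine Submodule.subset_span ⟨_, _, _, ?_, rfl⟩
  rw [add_assoc, S.add_two]
  exact S.ofFn_prod_mem ha

theorem derivPt_mem_oddPts {N : ℕ} {φ : Ops V W} (hφ : HasDegree φ 0)
    {Y K : A ⊗[ℝ] (∀ i, V i)} (hY : Y ∈ evenPts S V) (hK : K ∈ oddPts S V) :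
    derivPt N φ Y K ∈ oddPts S W := by
  refine Submodule.sum_mem _ fun k _ => Submodule.smul_mem _ _ ?_
  refine map_mem_of_mem_span
    (s := Fin.cons (oddGens S V) fun _ => evenGens S V) (fun y hy => ?_) _ fun c => ?_
  · obtain ⟨d₀, a₀, v₀, ha₀, hz₀⟩ := hy 0
    choose d a v ha hsq hz using fun c : Fin k => (hy c.succ :)
    let d' : Fin (k + 1) → ℕ := Fin.cons d₀ d
    let a' : Fin (k + 1) → A := Fin.cons a₀ a
    let v' : ∀ t, V (d' t) := Fin.cons (α := fun t => V (d' t)) v₀ v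
    have hy' : y = fun t => a' t ⊗ₜ homog d' v' t := by
      funext c
      refine Fin.cases ?_ (fun c => ?_) c
      · exact hz₀
      · exact hz c
    rw [hy', hat_pure_mem hφ v']
    refine Submodule.subset_span ⟨_, _, _, ?_, rfl⟩
    have h1 := S.mul_mem ha₀ (S.ofFn_prod_mem ha)
    simp only [a', d', List.ofFn_succ, List.prod_cons, Fin.sum_univ_succ, Fin.cons_zero,
      Fin.cons_succ]
    rwa [add_zero, add_right_comm]
  · refine Fin.cases ?_ (fun c => ?_) c
    · exact hK
    · exact hY

end Points

end LInfty

namespace LInfty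

open scoped TensorProduct

/-! ### Expansion of compositions at a point -/

theorem sum_pow_eq {N n : ℕ} {P Q : Type*} [AddCommGroup P] [Module ℝ P] [AddCommGroup Q]
    [Module ℝ Q] (F : ∀ k, MultilinearMap ℝ (fun _ : Fin k => P) Q) (y : Fin n → P)
    (hsymm : ∀ k (κ : Fin k → Fin n) (σ : Equiv.Perm (Fin k)),
      F k (fun c => y (κ (σ c))) = F k fun c => y (κ c))
    (hzero : ∀ k (κ : Fin k → Fin n), ¬ Function.Injective κ → F k (fun c => y (κ c)) = 0)
    (hN : ∀ k, N ≤ k → F k = 0) :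
    ∑ k ∈ Finset.range N, (k.factorial : ℝ)⁻¹ • F k (fun _ => ∑ t, y t) =
      ∑ B : Finset (Fin n), F B.card (sub y B) := by
  have h1 : ∀ k, (k.factorial : ℝ)⁻¹ • F k (fun _ => ∑ t, y t) =
      ∑ B : Finset (Fin n) with B.card = k, F B.card (sub y B) := by
    intro k
    rw [MultilinearMap.map_sum, sum_injective_eq (fun κ : Fin k → Fin n => F k fun c => y (κ c))
      (hsymm k) (hzero k)]
    have h2 : (Finset.univ.filter fun B : Finset (Fin n) => B.card = k) =
        Finset.powersetCard k Finset.univ := by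
      ext B; simp [Finset.mem_powersetCard]
    rw [h2, ← Finset.sum_attach (Finset.powersetCard k Finset.univ)]
    refine Finset.sum_congr rfl fun B _ => ?_
    obtain ⟨B, hB⟩ := B
    obtain rfl := (Finset.mem_powersetCard.1 hB).2
    rfl
  have h3 : ∑ B : Finset (Fin n), F B.card (sub y B) =
      ∑ B : Finset (Fin n) with B.card < N, F B.card (sub y B) := by
    symm
    refine Finset.sum_subset (Finset.filter_subset _ _) fun B _ hB => ?_
    rw [hN, zero_apply]
    simpa using hB
  rw [h3, ← Finset.sum_fiberwise_of_maps_to (t := Finset.range N) (g := Finset.card) (by simp)]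
  refine Finset.sum_congr rfl fun k hk => ?_
  rw [h1, Finset.filter_filter]
  refine Finset.sum_congr ?_ fun _ _ => rfl
  ext B
  simp only [Finset.mem_filter, Finset.mem_univ, true_and]
  constructor
  · rintro rfl; exact ⟨Finset.mem_range.1 hk, rfl⟩
  · exact fun h => h.2

section Expansion

variable {A : Type*} [Ring A] [Algebra ℝ A] {S : SuperGrading A}
  {V W X : ℕ → Type*} [∀ i, AddCommGroup (V i)] [∀ i, Module ℝ (V i)]
  [∀ i, AddCommGroup (W i)] [∀ i, Module ℝ (W i)] [∀ i, AddCommGroup (X i)] [∀ i, Module ℝ (X i)]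
  {N n : ℕ} {d : Fin n → ℕ} {a : Fin n → A}

theorem tmul_homog_mem_evenPts (ha : ∀ t, a t ∈ S.gr (d t)) (hsq : ∀ t, a t * a t = 0)
    (v : ∀ t, V (d t)) (t : Fin n) : a t ⊗ₜ homog d v t ∈ evenPts S V :=
  Submodule.subset_span ⟨_, _, _, ha t, hsq t, rfl⟩

theorem sum_mem_evenPts (ha : ∀ t, a t ∈ S.gr (d t)) (hsq : ∀ t, a t * a t = 0)
    (v : ∀ t, V (d t)) : ∑ t, a t ⊗ₜ homog d v t ∈ evenPts S V :=
  Submodule.sum_mem _ fun t _ => tmul_homog_mem_evenPts ha hsq v t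

variable [Module.Finite ℝ A]

/-- The coefficients of the polynomial function of `φ` at a point `∑ a t ⊗ v t` are the values of
`φ` on the subfamilies of `v`. -/
theorem evalPt_sum {φ : Ops V W} (hφ : IsGradedSymmetric φ) (hN : ∀ k, N ≤ k → φ k = 0)
    (ha : ∀ t, a t ∈ S.gr (d t)) (hsq : ∀ t, a t * a t = 0) (v : ∀ t, V (d t)) :
    evalPt N φ (∑ t, a t ⊗ₜ homog d v t) =
      ∑ B : Finset (Fin n), ordProd a B ⊗ₜ opAt φ (homog d v) B := by
  rw [evalPt, sum_pow_eq (fun k => hat A (φ k)) (fun t => a t ⊗ₜ homog d v t)]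
  · refine Finset.sum_congr rfl fun B _ => ?_
    exact hat_tmul (φ B.card) (fun c => a (B.orderEmbOfFin rfl c)) _
  · intro k κ σ
    exact hat_perm (S := S) hφ σ (fun c => a (κ c) ⊗ₜ homog d v (κ c))
      fun c => tmul_homog_mem_evenPts ha hsq v _
  · intro k κ hκ
    obtain ⟨i, j, hij, hne⟩ := Function.not_injective_iff.1 hκ
    refine hat_eq_zero_of_mul_eq_zero (S := S) (φ k) (a := fun c => a (κ c))
      (d := fun c => d (κ c)) (fun c => ha _) _ hne ?_
    simp only [hij]; exact hsq _
  · intro k hk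
    rw [hN k hk, hat_zero]

theorem bullet_eq_sum (ψ : Ops W X) {φ : Ops V W} (h0 : φ 0 = 0) (hN : ∀ k, N ≤ k → ψ k = 0)
    {n : ℕ} (d : Fin n → ℕ) (v : ∀ t, V (d t)) :
    bullet ψ φ d v = ∑ j ∈ Finset.range N, ((j.factorial : ℝ)⁻¹) •
      ∑ p : Fin n → Fin j, koszulSign p d • ψ j (fun c => opAt φ (homog d v) (block p c)) := by
  have h1 : ∀ j, N ≤ j → ((j.factorial : ℝ)⁻¹) • ∑ p : Fin n → Fin j, koszulSign p d •
      ψ j (fun c => opAt φ (homog d v) (block p c)) = 0 := by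
    intro j hj
    simp [hN j hj]
  have h2 : ∀ j, n + 1 ≤ j → ((j.factorial : ℝ)⁻¹) • ∑ p : Fin n → Fin j, koszulSign p d •
      ψ j (fun c => opAt φ (homog d v) (block p c)) = 0 := by
    intro j hj
    rw [Finset.sum_eq_zero, smul_zero]
    intro p _
    obtain ⟨c, hc⟩ : ∃ c, ∀ t, p t ≠ c := by
      by_contra! h
      have := Fintype.card_le_of_surjective p h
      simp only [Fintype.card_fin] at this
      omega
    have hb : (block p c).card = 0 := by
      rw [Finset.card_eq_zero, block, Finset.filter_eq_empty_iff]
      exact fun t _ => hc t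
    rw [(ψ j).map_coord_zero c, smul_zero]
    have h3 : ∀ k, k = 0 → φ k = 0 := by rintro k rfl; exact h0
    rw [opAt, h3 _ hb]; rfl
  have key : ∀ m m', m ≤ m' → (∀ j, m ≤ j → ((j.factorial : ℝ)⁻¹) • ∑ p : Fin n → Fin j,
      koszulSign p d • ψ j (fun c => opAt φ (homog d v) (block p c)) = 0) →
      ∑ j ∈ Finset.range m, ((j.factorial : ℝ)⁻¹) • ∑ p : Fin n → Fin j,
        koszulSign p d • ψ j (fun c => opAt φ (homog d v) (block p c)) =
      ∑ j ∈ Finset.range m', ((j.factorial : ℝ)⁻¹) • ∑ p : Fin n → Fin j,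
        koszulSign p d • ψ j (fun c => opAt φ (homog d v) (block p c)) := by
    intro m m' hm h
    refine Finset.sum_subset (Finset.range_mono hm) fun j _ hj => h j ?_
    simpa using hj
  exact (key _ (max (n + 1) N) (le_max_left _ _) h2).trans
    (key _ (max (n + 1) N) (le_max_right _ _) h1).symm

/-- The polynomial function of `ψ • φ` is the composition of those of `ψ` and `φ`. -/
theorem evalPt_evalPt_sum {ψ : Ops W X} {φ : Ops V W} (hφ : IsGradedSymmetric φ) (h0 : φ 0 = 0)
    (hNφ : ∀ k, N ≤ k → φ k = 0) (hNψ : ∀ k, N ≤ k → ψ k = 0)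
    (ha : ∀ t, a t ∈ S.gr (d t)) (hsq : ∀ t, a t * a t = 0) (v : ∀ t, V (d t)) :
    evalPt N ψ (evalPt N φ (∑ t, a t ⊗ₜ homog d v t)) =
      ∑ U : Finset (Fin n), ordProd a U ⊗ₜ
        bullet ψ φ (fun i => d (U.orderEmbOfFin rfl i)) (fun i => v (U.orderEmbOfFin rfl i)) := by
  rw [evalPt_sum hφ hNφ ha hsq, evalPt]
  have h1 : ∀ j, hat A (ψ j) (fun _ => ∑ B : Finset (Fin n), ordProd a B ⊗ₜ
      opAt φ (homog d v) B) = ∑ U : Finset (Fin n), ordProd a U ⊗ₜ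
        ∑ p : Fin U.card → Fin j, koszulSign p (fun i => d (U.orderEmbOfFin rfl i)) •
          ψ j (fun c => opAt φ (homog (fun i => d (U.orderEmbOfFin rfl i))
            (fun i => v (U.orderEmbOfFin rfl i))) (block p c)) := by
    intro j
    rw [MultilinearMap.map_sum, sum_disjoint_eq]
    · refine Finset.sum_congr rfl fun U _ => ?_
      rw [TensorProduct.tmul_sum]
      refine Finset.sum_congr rfl fun p _ => ?_
      rw [hat_tmul (ψ j) (fun c => ordProd a ((block p c).map (U.orderEmbOfFin rfl).toEmbedding))]
      simp only [ordProd_map, opAt_map]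
      rw [S.prod_blocks p (fun i => ha (U.orderEmbOfFin rfl i)), TensorProduct.tmul_smul,
        TensorProduct.smul_tmul']
      rfl
    · intro B c c' hcc hdis
      exact hat_eq_zero_of_mul_eq_zero (S := S) (ψ j) (fun c => S.ordProd_mem ha (B c)) _ hcc
        (S.ordProd_mul_eq_zero ha hsq hdis)
  simp only [h1, Finset.smul_sum]
  rw [Finset.sum_comm]
  refine Finset.sum_congr rfl fun U _ => ?_
  rw [bullet_eq_sum ψ h0 hNψ, TensorProduct.tmul_sum]
  refine Finset.sum_congr rfl fun j _ => ?_
  rw [TensorProduct.tmul_smul]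

theorem circ_eq_sum (φ : Ops V W) (μ : Ops V V) {n : ℕ} (d : Fin n → ℕ) (v : ∀ t, V (d t)) :
    circ φ μ d v = ∑ p : Fin n → Fin 2, koszulSign p d •
      φ ((block p 1).card + 1) (Fin.cons (opAt μ (homog d v) (block p 0))
        (sub (homog d v) (block p 1))) := rfl

/-- The polynomial function of `φ ∘ μ` is the derivative of that of `φ` along that of `μ`. -/
theorem smul_derivPt_evalPt_sum {φ : Ops V W} {μ : Ops V V} (hφ : IsGradedSymmetric φ)
    (hμ : IsGradedSymmetric μ) (hdμ : HasDegree μ 1)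
    (hNφ : ∀ k, N ≤ k → φ k = 0) (hNμ : ∀ k, N ≤ k → μ k = 0) {e : A} (he : e ∈ S.gr 1)
    (ha : ∀ t, a t ∈ S.gr (d t)) (hsq : ∀ t, a t * a t = 0) (v : ∀ t, V (d t)) :
    e • derivPt N φ (∑ t, a t ⊗ₜ homog d v t) (evalPt N μ (∑ t, a t ⊗ₜ homog d v t)) =
      ∑ U : Finset (Fin n), (e * ordProd a U) ⊗ₜ
        circ φ μ (fun i => d (U.orderEmbOfFin rfl i)) (fun i => v (U.orderEmbOfFin rfl i)) := by
  rw [← derivPt_smul, evalPt_sum hμ hNμ ha hsq, derivPt]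
  let K : Finset (Fin n) → A ⊗[ℝ] (∀ i, V i) := fun B =>
    (e * ordProd a B) ⊗ₜ opAt μ (homog d v) B
  have hK : e • ∑ B : Finset (Fin n), ordProd a B ⊗ₜ[ℝ] opAt μ (homog d v) B = ∑ B, K B := by
    simp [Finset.smul_sum, TensorProduct.smul_tmul', K]
  have hKe : ∀ B, K B ∈ evenPts S V := by
    intro B
    have h1 : ordProd a B ⊗ₜ[ℝ] opAt μ (homog d v) B ∈ oddPts S V := by
      refine Submodule.subset_span ⟨(∑ i, d (B.orderEmbOfFin rfl i)) + 1, ordProd a B,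
        opAt μ (homog d v) B _, ?_, ?_⟩
      · rw [add_assoc, S.add_two]
        exact S.ofFn_prod_mem fun i => ha (B.orderEmbOfFin rfl i)
      · congr 1
        funext j
        by_cases hj : j = (∑ i, d (B.orderEmbOfFin rfl i)) + 1
        · subst hj; simp
        · rw [Pi.single_eq_of_ne hj]
          exact hdμ B.card (fun i => d (B.orderEmbOfFin rfl i))
            (fun i => v (B.orderEmbOfFin rfl i)) j hj
    have := smul_mem_evenPts he h1
    rwa [TensorProduct.smul_tmul'] at this
  have h1 : ∀ k, hat A (φ (k + 1)) (Fin.cons (∑ B, K B) fun _ => ∑ t, a t ⊗ₜ homog d v t) =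
      ∑ B, (hat A (φ (k + 1))).curryLeft (K B) (fun _ => ∑ t, a t ⊗ₜ homog d v t) := by
    intro k
    rw [← sum_apply, ← map_sum, MultilinearMap.curryLeft_apply]
  rw [hK]
  simp only [h1, Finset.smul_sum]
  rw [Finset.sum_comm]
  have h2 : ∀ B, ∑ k ∈ Finset.range N, (k.factorial : ℝ)⁻¹ •
      (hat A (φ (k + 1))).curryLeft (K B) (fun _ => ∑ t, a t ⊗ₜ homog d v t) =
      ∑ C : Finset (Fin n), (e * (ordProd a B * ordProd a C)) ⊗ₜ φ (C.card + 1)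
        (Fin.cons (opAt μ (homog d v) B) (sub (homog d v) C)) := by
    intro B
    rw [sum_pow_eq (fun k => (hat A (φ (k + 1))).curryLeft (K B))
      (fun t => a t ⊗ₜ homog d v t)]
    · refine Finset.sum_congr rfl fun C _ => ?_
      rw [MultilinearMap.curryLeft_apply]
      have h3 : (Fin.cons (K B) (sub (fun t => a t ⊗ₜ[ℝ] homog d v t) C) :
          Fin (C.card + 1) → A ⊗[ℝ] (∀ i, V i)) = fun c =>
          (Fin.cons (e * ordProd a B) (sub a C) : Fin (C.card + 1) → A) c ⊗ₜ
            (Fin.cons (opAt μ (homog d v) B) (sub (homog d v) C) :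
              Fin (C.card + 1) → ∀ i, V i) c := by
        funext c
        refine Fin.cases rfl (fun c => rfl) c
      rw [h3, hat_tmul]
      simp [List.ofFn_succ, ordProd, mul_assoc]
    · intro k κ σ
      rw [MultilinearMap.curryLeft_apply, MultilinearMap.curryLeft_apply]
      rw [← hat_perm (S := S) hφ (Equiv.Perm.decomposeFin.symm (0, σ)) (Fin.cons (K B) fun c =>
        a (κ c) ⊗ₜ homog d v (κ c))]
      · congr 1
        funext c
        refine Fin.cases ?_ (fun c => ?_) c
        · simp
        · simp [Equiv.Perm.decomposeFin_symm_apply_succ]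
      · refine fun c => Fin.cases ?_ (fun c => ?_) c
        · exact hKe B
        · exact tmul_homog_mem_evenPts ha hsq v _
    · intro k κ hκ
      obtain ⟨i, j, hij, hne⟩ := Function.not_injective_iff.1 hκ
      rw [MultilinearMap.curryLeft_apply]
      have h3 : (Fin.cons (K B) (fun c => a (κ c) ⊗ₜ[ℝ] homog d v (κ c)) :
          Fin (k + 1) → A ⊗[ℝ] (∀ i, V i)) = fun c =>
          (Fin.cons (e * ordProd a B) (fun c => a (κ c)) : Fin (k + 1) → A) c ⊗ₜ
            (Fin.cons (opAt μ (homog d v) B) (fun c => homog d v (κ c)) :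
              Fin (k + 1) → ∀ i, V i) c := by
        funext c
        refine Fin.cases rfl (fun c => rfl) c
      rw [h3]
      refine hat_eq_zero_of_mul_eq_zero (S := S) _
        (d := Fin.cons (1 + ∑ t ∈ B, d t) fun c => d (κ c)) ?_ _
        (i := i.succ) (j := j.succ) (by simpa using hne) ?_
      · refine fun c => Fin.cases ?_ (fun c => ?_) c
        · exact S.mul_mem he (S.ordProd_mem ha B)
        · exact ha _
      · simp only [Fin.cons_succ, hij]; exact hsq _
    · intro k hk
      rw [hNφ (k + 1) (by omega), hat_zero]; rfl
  rw [Finset.sum_congr rfl fun B _ => h2 B]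
  let T : (Fin 2 → Finset (Fin n)) → A ⊗[ℝ] (∀ i, W i) := fun 𝓑 =>
    (e * (ordProd a (𝓑 0) * ordProd a (𝓑 1))) ⊗ₜ φ ((𝓑 1).card + 1)
        (Fin.cons (opAt μ (homog d v) (𝓑 0)) (sub (homog d v) (𝓑 1)))
  have h4 : ∑ B : Finset (Fin n), ∑ C : Finset (Fin n), (e * (ordProd a B * ordProd a C)) ⊗ₜ
      φ (C.card + 1) (Fin.cons (opAt μ (homog d v) B) (sub (homog d v) C)) = ∑ 𝓑, T 𝓑 := by
    rw [← Fintype.sum_prod_type', ← (finTwoArrowEquiv (Finset (Fin n))).sum_comp]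
    rfl
  rw [h4, sum_disjoint_eq]
  · refine Finset.sum_congr rfl fun U _ => ?_
    rw [circ_eq_sum, TensorProduct.tmul_sum]
    refine Finset.sum_congr rfl fun p _ => ?_
    simp only [T]
    rw [ordProd_map, ordProd_map, opAt_map, TensorProduct.tmul_smul, TensorProduct.smul_tmul']
    have h5 := S.prod_blocks p (fun i => ha (U.orderEmbOfFin rfl i))
    simp only [List.ofFn_succ, List.ofFn_zero, List.prod_cons, List.prod_nil, mul_one] at h5
    have h6 : ∀ (m : ℕ) (hm : ((block p 1).map (U.orderEmbOfFin rfl).toEmbedding).card = m),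
        φ (((block p 1).map (U.orderEmbOfFin rfl).toEmbedding).card + 1)
        (Fin.cons (opAt μ (fun i => homog d v (U.orderEmbOfFin rfl i)) (block p 0))
          (sub (homog d v) ((block p 1).map (U.orderEmbOfFin rfl).toEmbedding))) =
        φ (m + 1) (Fin.cons (opAt μ (fun i => homog d v (U.orderEmbOfFin rfl i)) (block p 0))
          fun i => sub (homog d v) ((block p 1).map (U.orderEmbOfFin rfl).toEmbedding)
            (i.cast hm.symm)) := by
      rintro m rfl
      rfl
    rw [h6 (block p 1).card (by simp), sub_eq_comp (homog d v) _ (by simp)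
      (e := fun i => U.orderEmbOfFin rfl ((block p 1).orderEmbOfFin rfl i))
      ((U.orderEmbOfFin rfl).strictMono.comp ((block p 1).orderEmbOfFin rfl).strictMono) (by simp)]
    congr 1
    rw [← mul_smul_comm]
    exact congrArg (e * ·) h5
  · intro 𝓑 c c' hcc hdis
    have h5 : ¬ Disjoint (𝓑 0) (𝓑 1) := by
      fin_cases c <;> fin_cases c' <;> first | exact absurd rfl hcc | exact hdis |
        exact fun h => hdis h.symm
    simp only [T]
    rw [S.ordProd_mul_eq_zero ha hsq h5, mul_zero, TensorProduct.zero_tmul]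

/-- The relation `φ ∘ μ = μ' • φ` for a morphism, as an identity of polynomial functions. -/
theorem smul_derivPt_evalPt {φ : Ops V W} {μ : Ops V V} {μ' : Ops W W} (hμ : IsCurvedLInfty μ)
    (hφ : IsLInftyMorphism μ μ' φ)
    (hNφ : ∀ k, N ≤ k → φ k = 0) (hNμ : ∀ k, N ≤ k → μ k = 0) (hNμ' : ∀ k, N ≤ k → μ' k = 0)
    {e : A} (he : e ∈ S.gr 1) {Y : A ⊗[ℝ] (∀ i, V i)} (hY : Y ∈ evenPts S V) :
    e • derivPt N φ Y (evalPt N μ Y) = e • evalPt N μ' (evalPt N φ Y) := by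
  obtain ⟨n, d, v, a, ha, hsq, rfl⟩ := exists_eq_sum_of_mem_evenPts hY
  rw [smul_derivPt_evalPt_sum hφ.symm hμ.symm hμ.degree hNφ hNμ he ha hsq,
    evalPt_evalPt_sum hφ.symm hφ.zero hNφ hNμ' ha hsq, Finset.smul_sum]
  refine Finset.sum_congr rfl fun U _ => ?_
  rw [hφ.compat, TensorProduct.smul_tmul', smul_eq_mul]

/-- The relation `μ ∘ μ = 0` as an identity of polynomial functions. -/
theorem smul_derivPt_evalPt_self {μ : Ops V V} (hμ : IsCurvedLInfty μ)
    (hNμ : ∀ k, N ≤ k → μ k = 0)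
    {e : A} (he : e ∈ S.gr 1) {Y : A ⊗[ℝ] (∀ i, V i)} (hY : Y ∈ evenPts S V) :
    e • derivPt N μ Y (evalPt N μ Y) = 0 := by
  obtain ⟨n, d, v, a, ha, hsq, rfl⟩ := exists_eq_sum_of_mem_evenPts hY
  rw [smul_derivPt_evalPt_sum hμ.symm hμ.symm hμ.degree hNμ hNμ he ha hsq]
  refine Finset.sum_eq_zero fun U _ => ?_
  rw [hμ.jacobi, TensorProduct.tmul_zero]

end Expansion

end LInfty

namespace LInfty

/-! ### Free supercommutative algebras -/

section Generic

variable {n : ℕ} (d : Fin n → ℕ)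

/-- The creation operator of a generator of degree `d t`, acting on functions of sets of
generators.  These operators generate the free supercommutative algebra on square-zero
generators of degrees `d 0, …, d (n-1)`. -/
noncomputable def creation (t : Fin n) : Module.End ℝ (Finset (Fin n) → ℝ) where
  toFun f B := if t ∈ B then
    (∏ b ∈ B.erase t, if b < t then (-1 : ℝ) ^ (d t * d b) else 1) * f (B.erase t) else 0
  map_add' f g := by
    funext B; simp only [Pi.add_apply]; split_ifs <;> ring
  map_smul' r f := by
    funext B; simp only [Pi.smul_apply, smul_eq_mul, RingHom.id_apply]; split_ifs <;> ring

theorem creation_apply (t : Fin n) (f : Finset (Fin n) → ℝ) (B : Finset (Fin n)) :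
    creation d t f B = if t ∈ B then
      (∏ b ∈ B.erase t, if b < t then (-1 : ℝ) ^ (d t * d b) else 1) * f (B.erase t) else 0 :=
  rfl

theorem creation_mul_self (t : Fin n) : creation d t * creation d t = 0 := by
  ext f B
  simp [creation_apply]

theorem creation_mul_comm (s t : Fin n) :
    creation d s * creation d t = (-1 : ℝ) ^ (d s * d t) • (creation d t * creation d s) := by
  wlog hlt : s < t generalizing s t
  · rcases eq_or_lt_of_le (not_lt.1 hlt) with rfl | h
    · simp [creation_mul_self]
    · rw [this t s h, smul_smul, mul_comm (d s), ← mul_pow]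
      norm_num
  refine LinearMap.ext fun f => funext fun B => ?_
  simp only [Module.End.mul_apply, creation_apply, LinearMap.smul_apply, Pi.smul_apply, smul_eq_mul,
    Finset.mem_erase]
  by_cases hs : s ∈ B
  · by_cases ht : t ∈ B
    · have h1 : (B.erase s).erase t = (B.erase t).erase s := Finset.erase_right_comm
      have h2 : ∏ b ∈ B.erase s, (if b < s then (-1 : ℝ) ^ (d s * d b) else 1) =
          ∏ b ∈ (B.erase t).erase s, if b < s then (-1 : ℝ) ^ (d s * d b) else 1 := by
        rw [← h1, ← Finset.mul_prod_erase (B.erase s) _ (Finset.mem_erase.2 ⟨hlt.ne', ht⟩),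
          if_neg hlt.not_gt, one_mul]
      have h3 : ∏ b ∈ B.erase t, (if b < t then (-1 : ℝ) ^ (d t * d b) else 1) =
          (-1 : ℝ) ^ (d t * d s) *
            ∏ b ∈ (B.erase s).erase t, if b < t then (-1 : ℝ) ^ (d t * d b) else 1 := by
        rw [h1, ← Finset.mul_prod_erase (B.erase t) _ (Finset.mem_erase.2 ⟨hlt.ne, hs⟩),
          if_pos hlt]
      have h4 : ((-1 : ℝ) ^ (d s * d t)) * (-1 : ℝ) ^ (d t * d s) = 1 := by
        rw [mul_comm (d t), ← mul_pow]; norm_num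
      rw [if_pos hs, if_pos ⟨hlt.ne', ht⟩, if_pos ht, if_pos ⟨hlt.ne, hs⟩, h2, h3, h1]
      linear_combination (-(∏ b ∈ (B.erase t).erase s, if b < s then (-1 : ℝ) ^ (d s * d b) else 1) *
        (∏ b ∈ (B.erase t).erase s, if b < t then (-1 : ℝ) ^ (d t * d b) else 1) *
          f ((B.erase t).erase s)) * h4
    · simp [ht]
  · simp [hs]

/-- The parity grading of the algebra of polynomials in the creation operators (and zero on
the other endomorphisms). -/
noncomputable def creationGrading : SuperGrading (Module.End ℝ (Finset (Fin n) → ℝ)) where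
  gr i := Submodule.span ℝ
    {T | ∃ l : List (Fin n), (l.map d).sum % 2 = i % 2 ∧ T = (l.map (creation d)).prod}
  one_mem := Submodule.subset_span ⟨[], rfl, rfl⟩
  mul_mem := by
    intro i j a b ha hb
    have := Submodule.mul_mem_mul ha hb
    rw [Submodule.span_mul_span] at this
    refine Submodule.span_mono ?_ this
    rintro _ ⟨_, ⟨l, hl, rfl⟩, _, ⟨l', hl', rfl⟩, rfl⟩
    refine ⟨l ++ l', ?_, by simp⟩
    rw [List.map_append, List.sum_append, Nat.add_mod, hl, hl', ← Nat.add_mod]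
  comm := by
    have h1 : ∀ (t : Fin n) (l : List (Fin n)), creation d t * (l.map (creation d)).prod =
        (-1 : ℝ) ^ (d t * (l.map d).sum) • ((l.map (creation d)).prod * creation d t) := by
      intro t l
      induction l with
      | nil => simp
      | cons x l ih =>
        simp only [List.map_cons, List.prod_cons, List.sum_cons]
        rw [← mul_assoc, creation_mul_comm, smul_mul_assoc, mul_assoc, ih, mul_smul_comm, smul_smul,
          mul_add, pow_add, mul_assoc]
    have h2 : ∀ l l' : List (Fin n), (l.map (creation d)).prod * (l'.map (creation d)).prod =
        (-1 : ℝ) ^ ((l.map d).sum * (l'.map d).sum) •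
          ((l'.map (creation d)).prod * (l.map (creation d)).prod) := by
      intro l l'
      induction l with
      | nil => simp
      | cons x l ih =>
        simp only [List.map_cons, List.prod_cons, List.sum_cons]
        rw [mul_assoc, ih, mul_smul_comm, ← mul_assoc, h1, smul_mul_assoc, smul_smul, add_mul,
          pow_add, mul_assoc, mul_comm ((-1 : ℝ) ^ (d x * _))]
    intro i j a b ha hb
    induction ha using Submodule.span_induction with
    | zero => simp
    | add x y _ _ hx hy => rw [add_mul, mul_add, hx, hy, smul_add]
    | smul r x _ hx => rw [smul_mul_assoc, hx, mul_smul_comm, smul_comm]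
    | mem x hx =>
      induction hb using Submodule.span_induction with
      | zero => simp
      | add y z _ _ hy hz => rw [add_mul, mul_add, hy, hz, smul_add]
      | smul r y _ hy => rw [smul_mul_assoc, mul_smul_comm, hy, smul_comm]
      | mem y hy =>
        obtain ⟨l, hl, rfl⟩ := hx
        obtain ⟨l', hl', rfl⟩ := hy
        rw [h2]
        congr 1
        rw [neg_one_pow_eq_pow_mod_two, neg_one_pow_eq_pow_mod_two (i * j), Nat.mul_mod, hl, hl',
          ← Nat.mul_mod]
  add_two i := by simp

theorem creation_list_apply (l : List (Fin n)) (hl : l.Pairwise (· < ·)) :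
    (l.map (creation d)).prod (Pi.single ∅ 1) = Pi.single l.toFinset 1 := by
  induction l with
  | nil => rfl
  | cons x l ih =>
    rw [List.pairwise_cons] at hl
    rw [List.map_cons, List.prod_cons, Module.End.mul_apply, ih hl.2]
    have hx : x ∉ l.toFinset := by
      rw [List.mem_toFinset]
      exact fun h => lt_irrefl _ (hl.1 x h)
    funext B
    rw [creation_apply]
    by_cases hB : B = (x :: l).toFinset
    · subst hB
      have h1 : ((x :: l).toFinset).erase x = l.toFinset := by
        rw [List.toFinset_cons, Finset.erase_insert hx]
      rw [if_pos (by simp), h1, Pi.single_eq_same, Pi.single_eq_same, mul_one]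
      refine Finset.prod_eq_one fun b hb => if_neg (hl.1 b (List.mem_toFinset.1 hb)).not_gt
    · rw [Pi.single_eq_of_ne hB]
      split_ifs with hxB
      · rw [Pi.single_eq_of_ne, mul_zero]
        intro h
        apply hB
        rw [List.toFinset_cons, ← h, Finset.insert_erase hxB]
      · rfl

theorem ordProd_creation_apply (B : Finset (Fin n)) :
    ordProd (creation d) B (Pi.single ∅ 1) = Pi.single B 1 := by
  rw [ordProd_eq_filter, creation_list_apply d _ ((List.pairwise_lt_finRange n).filter _)]
  congr 1
  ext; simp

end Generic

/-- For prescribed degrees there are a supercommutative algebra with square-zero generators `ε t`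
of these degrees and two more odd elements `η`, `η'`, and a linear form `c` which extracts the
coefficient of the product of all of them. -/
theorem exists_generic (n : ℕ) (d : Fin n → ℕ) :
    ∃ (A : Type) (_ : Ring A) (_ : Algebra ℝ A) (_ : Module.Finite ℝ A) (S : SuperGrading A)
      (ε : Fin n → A) (η η' : A) (c : A →ₗ[ℝ] ℝ),
      (∀ t, ε t ∈ S.gr (d t)) ∧ (∀ t, ε t * ε t = 0) ∧ η ∈ S.gr 1 ∧ η' ∈ S.gr 1 ∧
      ∀ B, c (η * (η' * ordProd ε B)) = if B = Finset.univ then 1 else 0 := by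
  let d' : Fin (n + 2) → ℕ := Fin.cons 1 (Fin.cons 1 d)
  have hmem : ∀ t, creation d' t ∈ (creationGrading d').gr (d' t) := fun t =>
    Submodule.subset_span ⟨[t], by simp, by simp⟩
  refine ⟨Module.End ℝ (Finset (Fin (n + 2)) → ℝ), inferInstance, inferInstance, inferInstance,
    creationGrading d', fun t => creation d' t.succ.succ, creation d' 0, creation d' 1,
    LinearMap.proj Finset.univ ∘ₗ LinearMap.applyₗ (Pi.single ∅ 1), fun t => hmem t.succ.succ,
    fun t => creation_mul_self _ _, hmem 0, hmem 1, fun B => ?_⟩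
  let B' : Finset (Fin (n + 2)) :=
    insert 0 (insert 1 (B.map ((Fin.succEmb n).trans (Fin.succEmb (n + 1)))))
  have h1 : creation d' 0 * (creation d' 1 * ordProd (fun t => creation d' t.succ.succ) B) =
      ordProd (creation d') B' := by
    rw [ordProd_eq_filter (creation d') B', ordProd_eq_filter]
    have h0 : (List.finRange (n + 2)).filter (· ∈ B') =
        0 :: 1 :: ((List.finRange n).filter (· ∈ B)).map fun t => t.succ.succ := by
      rw [List.finRange_succ, List.finRange_succ]
      simp only [List.map_cons, List.map_map]
      rw [List.filter_cons_of_pos (by simp [B']), List.filter_cons_of_pos (by simp [B']),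
        List.filter_map]
      congr 3
      refine List.filter_congr fun t _ => ?_
      simp only [B', Function.comp, Finset.mem_insert, Finset.mem_map, Function.Embedding.trans_apply,
        Fin.coe_succEmb, Fin.succ_inj, exists_eq_right, Fin.succ_ne_zero, false_or, decide_eq_decide]
      constructor
      · rintro (h | h)
        · exact absurd (Fin.succ_injective _ h) (Fin.succ_ne_zero t)
        · exact h
      · exact Or.inr
    rw [h0]
    simp only [List.map_cons, List.prod_cons, List.map_map]
    rfl
  rw [h1]
  simp only [LinearMap.comp_apply, LinearMap.applyₗ_apply_apply, LinearMap.proj_apply]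
  rw [ordProd_creation_apply, Pi.single_apply]
  congr 1
  rw [eq_iff_iff, eq_comm]
  constructor
  · intro h
    ext t
    simp only [Finset.mem_univ, iff_true]
    have := Finset.mem_univ t.succ.succ
    rw [← h] at this
    simp only [B', Finset.mem_insert, Finset.mem_map, Function.Embedding.trans_apply,
        Fin.coe_succEmb, Fin.succ_inj, exists_eq_right, Fin.succ_ne_zero, false_or] at this
    rcases this with h | h
    · exact absurd (Fin.succ_injective _ h) (Fin.succ_ne_zero t)
    · exact h
  · rintro rfl
    ext t
    simp only [Finset.mem_univ, iff_true, B', Finset.mem_insert, Finset.mem_map, true_and]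
    refine Fin.cases (Or.inl rfl) (fun t => ?_) t
    refine Fin.cases (Or.inr (Or.inl rfl)) (fun t => Or.inr (Or.inr ⟨t, rfl⟩)) t

end LInfty

namespace LInfty

open scoped TensorProduct

/-! ### Operations on bounded graded vector spaces -/

section Bounded

variable {V W X : ℕ → Type*} [∀ i, AddCommGroup (V i)] [∀ i, Module ℝ (V i)]
  [∀ i, AddCommGroup (W i)] [∀ i, Module ℝ (W i)] [∀ i, AddCommGroup (X i)] [∀ i, Module ℝ (X i)]

omit [∀ i, Module ℝ (V i)] in
theorem eq_sum_single {r : ℕ} (hV : ∀ i, r < i → Subsingleton (V i)) (x : ∀ i, V i) :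
    x = ∑ i : Fin (r + 1), Pi.single (i : ℕ) (x i) := by
  funext j
  rw [Finset.sum_apply]
  by_cases hj : j < r + 1
  · rw [Finset.sum_eq_single (⟨j, hj⟩ : Fin (r + 1))]
    · simp
    · intro i _ hi
      exact Pi.single_eq_of_ne (fun h => hi (Fin.ext h.symm)) _
    · simp
  · have := hV j (by omega)
    exact Subsingleton.elim _ _

theorem multilinear_ext_homog {r k : ℕ} (hV : ∀ i, r < i → Subsingleton (V i)) {Q : Type*}
    [AddCommGroup Q] [Module ℝ Q] {f g : MultilinearMap ℝ (fun _ : Fin k => ∀ i, V i) Q}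
    (h : ∀ (d : Fin k → ℕ) (v : ∀ a, V (d a)), f (homog d v) = g (homog d v)) : f = g := by
  ext x
  have hx : x = fun a => ∑ i : Fin (r + 1), Pi.single (i : ℕ) (x a i) :=
    funext fun a => eq_sum_single hV (x a)
  rw [hx, MultilinearMap.map_sum, MultilinearMap.map_sum]
  exact Finset.sum_congr rfl fun κ _ => h (fun a => κ a) (fun a => x a (κ a))

/-- Operations of non-negative degree between graded vector spaces of positive bounded amplitude
vanish in high arity. -/
theorem HasDegree.eq_zero {φ : Ops V X} {q : ℕ} (hφ : HasDegree φ q) {r : ℕ}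
    (hV : ∀ i, r < i → Subsingleton (V i)) (hV0 : Subsingleton (V 0))
    (hX : ∀ i, r < i → Subsingleton (X i)) {k : ℕ} (hk : r + 1 ≤ k) : φ k = 0 := by
  refine multilinear_ext_homog hV fun d v => ?_
  rw [zero_apply]
  by_cases h : ∃ a, d a = 0
  · obtain ⟨a, ha⟩ := h
    refine (φ k).map_coord_zero a ?_
    have : v a = 0 := by
      have : Subsingleton (V (d a)) := by rw [ha]; exact hV0
      exact Subsingleton.elim _ _
    simp [homog, this]
  · push Not at h
    funext j
    by_cases hj : j = (∑ a, d a) + q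
    · have h1 : k ≤ ∑ a, d a := by
        calc k = ∑ _a : Fin k, 1 := by simp
          _ ≤ ∑ a, d a := Finset.sum_le_sum fun a _ => Nat.one_le_iff_ne_zero.2 (h a)
      have := hX j (by omega)
      exact Subsingleton.elim _ _
    · exact hφ k d v j hj

theorem HasDegree.apply_homog {φ : Ops V X} {q : ℕ} (hφ : HasDegree φ q) {k : ℕ}
    (d : Fin k → ℕ) (v : ∀ a, V (d a)) :
    φ k (homog d v) = Pi.single ((∑ a, d a) + q) (φ k (homog d v) ((∑ a, d a) + q)) := by
  funext j
  by_cases hj : j = (∑ a, d a) + q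
  · subst hj; simp
  · rw [Pi.single_eq_of_ne hj, hφ k d v j hj]

theorem HasDegree.opAt_homog {φ : Ops V X} {q : ℕ} (hφ : HasDegree φ q) {n : ℕ}
    (d : Fin n → ℕ) (v : ∀ a, V (d a)) (B : Finset (Fin n)) :
    opAt φ (homog d v) B =
      Pi.single ((∑ a ∈ B, d a) + q) (opAt φ (homog d v) B ((∑ a ∈ B, d a) + q)) := by
  have h1 : ∑ a ∈ B, d a = ∑ i, d (B.orderEmbOfFin rfl i) := by
    rw [← Finset.sum_coe_sort B]
    exact ((B.orderIsoOfFin rfl).toEquiv.sum_comp fun a : B => d a).symm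
  rw [h1]
  exact hφ.apply_homog (fun i => d (B.orderEmbOfFin rfl i)) fun i => v (B.orderEmbOfFin rfl i)

theorem opAt_eq_zero (φ : Ops V W) {n : ℕ} {x : Fin n → ∀ i, V i} {B : Finset (Fin n)}
    {t : Fin n} (ht : t ∈ B) (hx : x t = 0) : opAt φ x B = 0 := by
  have h2 : t ∈ Set.range (B.orderEmbOfFin rfl) := by rw [B.range_orderEmbOfFin rfl]; exact ht
  obtain ⟨i, hi⟩ := h2
  refine (φ B.card).map_coord_zero i ?_
  rw [sub, hi, hx]

theorem opAt_update_of_mem (φ : Ops V W) {n : ℕ} (x : Fin n → ∀ i, V i) {B : Finset (Fin n)}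
    {i : Fin B.card} (u : ∀ i, V i) :
    opAt φ (Function.update x (B.orderEmbOfFin rfl i) u) B =
      φ B.card (Function.update (sub x B) i u) := by
  rw [opAt]
  congr 1
  exact Function.update_comp_eq_of_injective x (B.orderEmbOfFin rfl).injective i u

theorem opAt_update_of_notMem (φ : Ops V W) {n : ℕ} (x : Fin n → ∀ i, V i) {B : Finset (Fin n)}
    {t : Fin n} (ht : t ∉ B) (u : ∀ i, V i) : opAt φ (Function.update x t u) B = opAt φ x B := by
  rw [opAt, opAt]
  congr 1
  funext i
  exact Function.update_of_ne (fun h => ht (by rw [← h]; exact B.orderEmbOfFin_mem rfl i)) _ _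

/-- The multilinear map `(x_1, …, x_n) ↦ ψ_j(φ(x_{B_1}), …, φ(x_{B_j}))`, where `B_1, …, B_j` are
the blocks of `p`. -/
noncomputable def blockOp (ψ : Ops W X) (φ : Ops V W) {n j : ℕ} (p : Fin n → Fin j) :
    MultilinearMap ℝ (fun _ : Fin n => ∀ i, V i) (∀ i, X i) :=
  MultilinearMap.mk' (fun x => ψ j fun c => opAt φ x (block p c))
    (by
      intro x t u w
      have hmem : t ∈ block p (p t) := by simp [block]
      have h2 : t ∈ Set.range ((block p (p t)).orderEmbOfFin rfl) := by
        rw [Finset.range_orderEmbOfFin]; exact hmem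
      obtain ⟨i, hi⟩ := h2
      have key : ∀ z : ∀ i, V i, (fun c => opAt φ (Function.update x t z) (block p c)) =
          Function.update (fun c => opAt φ x (block p c)) (p t)
            (φ _ (Function.update (sub x (block p (p t))) i z)) := by
        intro z
        funext c
        by_cases hc : c = p t
        · subst hc
          rw [Function.update_self, ← opAt_update_of_mem, hi]
        · rw [Function.update_of_ne hc, opAt_update_of_notMem]
          simpa [block] using fun h => hc h.symm
      rw [key, key, key, MultilinearMap.map_update_add, MultilinearMap.map_update_add])
    (by
      intro x t r u
      have hmem : t ∈ block p (p t) := by simp [block]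
      have h2 : t ∈ Set.range ((block p (p t)).orderEmbOfFin rfl) := by
        rw [Finset.range_orderEmbOfFin]; exact hmem
      obtain ⟨i, hi⟩ := h2
      have key : ∀ z : ∀ i, V i, (fun c => opAt φ (Function.update x t z) (block p c)) =
          Function.update (fun c => opAt φ x (block p c)) (p t)
            (φ _ (Function.update (sub x (block p (p t))) i z)) := by
        intro z
        funext c
        by_cases hc : c = p t
        · subst hc
          rw [Function.update_self, ← opAt_update_of_mem, hi]
        · rw [Function.update_of_ne hc, opAt_update_of_notMem]
          simpa [block] using fun h => hc h.symm
      rw [key, key, MultilinearMap.map_update_smul, MultilinearMap.map_update_smul])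

theorem blockOp_apply (ψ : Ops W X) (φ : Ops V W) {n j : ℕ} (p : Fin n → Fin j)
    (x : Fin n → ∀ i, V i) : blockOp ψ φ p x = ψ j fun c => opAt φ x (block p c) := rfl

theorem bullet_eq_blockOp (ψ : Ops W X) (φ : Ops V W) {n : ℕ} (d : Fin n → ℕ)
    (v : ∀ a, V (d a)) :
    bullet ψ φ d v = ∑ j ∈ Finset.range (n + 1), ((j.factorial : ℝ)⁻¹) •
      ∑ p : Fin n → Fin j, koszulSign p d • blockOp ψ φ p (homog d v) := rfl

/-- The composition `ψ • φ` as a sequence of multilinear operations, for a graded vector space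
concentrated in degrees `≤ r`. -/
noncomputable def bulletOps (r : ℕ) (ψ : Ops W X) (φ : Ops V W) : Ops V X := fun n =>
  ∑ d : Fin n → Fin (r + 1), ∑ j ∈ Finset.range (n + 1), ((j.factorial : ℝ)⁻¹) •
    ∑ p : Fin n → Fin j, koszulSign p (fun a => (d a : ℕ)) • (blockOp ψ φ p).compLinearMap
      fun a => LinearMap.single ℝ V (d a : ℕ) ∘ₗ LinearMap.proj (d a : ℕ)

theorem bulletOps_apply (r : ℕ) (ψ : Ops W X) (φ : Ops V W) {n : ℕ} (x : Fin n → ∀ i, V i) :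
    bulletOps r ψ φ n x =
      ∑ d : Fin n → Fin (r + 1), bullet ψ φ (fun a => (d a : ℕ)) fun a => x a (d a) := by
  simp only [bulletOps, sum_apply, smul_apply, MultilinearMap.compLinearMap_apply,
    bullet_eq_blockOp]
  rfl

theorem bullet_eq_zero (ψ : Ops W X) (φ : Ops V W) {n : ℕ} {d : Fin n → ℕ}
    {v : ∀ a, V (d a)} {t : Fin n} (ht : v t = 0) : bullet ψ φ d v = 0 := by
  rw [bullet_eq_blockOp]
  refine Finset.sum_eq_zero fun j _ => ?_
  rw [Finset.sum_eq_zero, smul_zero]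
  intro p _
  rw [(blockOp ψ φ p).map_coord_zero t (by simp [homog, ht]), smul_zero]

theorem circ_eq_zero (φ : Ops V W) (μ : Ops V V) {n : ℕ} {d : Fin n → ℕ}
    {v : ∀ a, V (d a)} {t : Fin n} (ht : v t = 0) : circ φ μ d v = 0 := by
  have h0 : homog d v t = 0 := by simp [homog, ht]
  rw [circ_eq_sum]
  refine Finset.sum_eq_zero fun p _ => ?_
  by_cases hp : t ∈ block p 0
  · rw [(φ _).map_coord_zero 0, smul_zero]
    rw [Fin.cons_zero, opAt_eq_zero μ hp h0]
  · have hp1 : t ∈ block p 1 := by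
      simp only [block, Finset.mem_filter, Finset.mem_univ, true_and] at hp ⊢
      omega
    have h2 : t ∈ Set.range ((block p 1).orderEmbOfFin rfl) := by
      rw [Finset.range_orderEmbOfFin]; exact hp1
    obtain ⟨i, hi⟩ := h2
    rw [(φ _).map_coord_zero i.succ, smul_zero]
    rw [Fin.cons_succ, sub, hi, h0]

theorem bulletOps_homog {r : ℕ} (hV : ∀ i, r < i → Subsingleton (V i)) (ψ : Ops W X)
    (φ : Ops V W) {n : ℕ} (d : Fin n → ℕ) (v : ∀ a, V (d a)) :
    bulletOps r ψ φ n (homog d v) = bullet ψ φ d v := by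
  by_cases hd : ∀ a, d a < r + 1
  · obtain ⟨d, rfl⟩ : ∃ d' : Fin n → Fin (r + 1), (fun a => (d' a : ℕ)) = d :=
      ⟨fun a => ⟨d a, hd a⟩, rfl⟩
    rw [bulletOps_apply, Finset.sum_eq_single d]
    · congr 1
      funext a
      simp [homog]
    · intro d' _ hne
      obtain ⟨a, ha⟩ := Function.ne_iff.1 hne
      refine bullet_eq_zero ψ φ (t := a) ?_
      simp only [homog]
      exact Pi.single_eq_of_ne (fun h => ha (Fin.ext h)) _
    · simp
  · push Not at hd
    obtain ⟨a, ha⟩ := hd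
    have hva : v a = 0 := by
      have := hV (d a) (by omega)
      exact Subsingleton.elim _ _
    rw [bullet_eq_zero ψ φ hva]
    exact (bulletOps r ψ φ n).map_coord_zero a (by simp [homog, hva])

theorem blockOp_homog {ψ : Ops W X} {φ : Ops V W} (hφ : HasDegree φ 0)
    {n j : ℕ} (p : Fin n → Fin j) (d : Fin n → ℕ) (v : ∀ a, V (d a)) :
    blockOp ψ φ p (homog d v) = ψ j (homog (fun c => ∑ a ∈ block p c, d a)
      fun c => opAt φ (homog d v) (block p c) (∑ a ∈ block p c, d a)) := by
  rw [blockOp_apply]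
  congr 1
  funext c
  exact hφ.opAt_homog d v (block p c)

theorem sum_block {n j : ℕ} (p : Fin n → Fin j) (d : Fin n → ℕ) :
    ∑ c, ∑ a ∈ block p c, d a = ∑ a, d a :=
  Finset.sum_fiberwise Finset.univ p d

theorem bullet_hasDegree {ψ : Ops W X} {φ : Ops V W} {q : ℕ} (hψ : HasDegree ψ q)
    (hφ : HasDegree φ 0) {n : ℕ} (d : Fin n → ℕ) (v : ∀ a, V (d a)) {j : ℕ}
    (hj : j ≠ (∑ a, d a) + q) : bullet ψ φ d v j = 0 := by
  rw [bullet_eq_blockOp, Finset.sum_apply]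
  refine Finset.sum_eq_zero fun i _ => ?_
  rw [Pi.smul_apply, Finset.sum_apply, Finset.sum_eq_zero, smul_zero]
  intro p _
  rw [Pi.smul_apply, blockOp_homog hφ, hψ _ _ _ _ (by rwa [sum_block]), smul_zero]

theorem circ_hasDegree {φ : Ops V W} {μ : Ops V V} {q : ℕ} (hφ : HasDegree φ q)
    (hμ : HasDegree μ 1) {n : ℕ} (d : Fin n → ℕ) (v : ∀ a, V (d a)) {j : ℕ}
    (hj : j ≠ (∑ a, d a) + 1 + q) : circ φ μ d v j = 0 := by
  rw [circ_eq_sum, Finset.sum_apply]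
  refine Finset.sum_eq_zero fun p _ => ?_
  rw [Pi.smul_apply]
  let d' : Fin ((block p 1).card + 1) → ℕ :=
    Fin.cons ((∑ a ∈ block p 0, d a) + 1) fun i => d ((block p 1).orderEmbOfFin rfl i)
  let v' : ∀ t, V (d' t) := Fin.cons (α := fun t => V (d' t))
    (opAt μ (homog d v) (block p 0) ((∑ a ∈ block p 0, d a) + 1))
    fun i => v ((block p 1).orderEmbOfFin rfl i)
  have h1 : (Fin.cons (opAt μ (homog d v) (block p 0)) (sub (homog d v) (block p 1)) :
      Fin ((block p 1).card + 1) → ∀ i, V i) = homog d' v' := by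
    funext c
    refine Fin.cases ?_ (fun c => ?_) c
    · exact hμ.opAt_homog d v (block p 0)
    · rfl
  rw [h1, hφ _ d' v', smul_zero]
  have h2 : ∑ i, d ((block p 1).orderEmbOfFin rfl i) = ∑ a ∈ block p 1, d a := by
    rw [← Finset.sum_coe_sort (block p 1)]
    exact ((block p 1).orderIsoOfFin rfl).toEquiv.sum_comp fun a : block p 1 => d a
  have h3 := sum_block p d
  rw [Fin.sum_univ_two] at h3
  rw [Fin.sum_univ_succ]
  simp only [d', Fin.cons_zero, Fin.cons_succ]
  omega

theorem bulletOps_hasDegree {r : ℕ} (hV : ∀ i, r < i → Subsingleton (V i)) {ψ : Ops W X}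
    {φ : Ops V W} {q : ℕ} (hψ : HasDegree ψ q) (hφ : HasDegree φ 0) :
    HasDegree (bulletOps r ψ φ) q := by
  intro k d v j hj
  rw [bulletOps_homog hV]
  exact bullet_hasDegree hψ hφ d v hj

/-! ### Extraction of coefficients -/

omit [∀ i, AddCommGroup (V i)] [∀ i, Module ℝ (V i)] in
theorem apply_comp_strictMono {n : ℕ} {Q : Type*}
    (g : ∀ (m : ℕ) (d : Fin m → ℕ), (∀ a, V (d a)) → Q) (d : Fin n → ℕ) (v : ∀ a, V (d a))
    {m : ℕ} (hm : m = n) (e : Fin m → Fin n) (he : StrictMono e) :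
    g m (fun i => d (e i)) (fun i => v (e i)) = g n d v := by
  subst hm
  have := Finset.orderEmbOfFin_unique (s := (Finset.univ : Finset (Fin m))) (by simp)
    (f := e) (by simp) he
  have h2 := Finset.orderEmbOfFin_unique (s := (Finset.univ : Finset (Fin m))) (by simp)
    (f := id) (by simp) strictMono_id
  obtain rfl : e = id := this.trans h2.symm
  rfl

omit [∀ i, AddCommGroup (V i)] [∀ i, Module ℝ (V i)] in
theorem apply_orderEmb_univ {n : ℕ} {Q : Type*}
    (g : ∀ (m : ℕ) (d : Fin m → ℕ), (∀ a, V (d a)) → Q) (d : Fin n → ℕ) (v : ∀ a, V (d a)) :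
    g _ (fun i => d ((Finset.univ : Finset (Fin n)).orderEmbOfFin rfl i))
      (fun i => v ((Finset.univ : Finset (Fin n)).orderEmbOfFin rfl i)) = g n d v :=
  apply_comp_strictMono g d v (by simp) _ (OrderEmbedding.strictMono _)

/-- Contraction of a point with a linear form on the algebra of scalars. -/
noncomputable def coeff {A : Type*} [Ring A] [Algebra ℝ A] {Q : Type*} [AddCommGroup Q]
    [Module ℝ Q] (c : A →ₗ[ℝ] ℝ) : A ⊗[ℝ] Q →ₗ[ℝ] Q :=
  (TensorProduct.lid ℝ Q).toLinearMap ∘ₗ c.rTensor Q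

theorem coeff_tmul {A : Type*} [Ring A] [Algebra ℝ A] {Q : Type*} [AddCommGroup Q]
    [Module ℝ Q] (c : A →ₗ[ℝ] ℝ) (a : A) (x : Q) : coeff c (a ⊗ₜ x) = c a • x := by
  simp [coeff]

theorem SuperGrading.prod_injective {A : Type*} [Ring A] [Algebra ℝ A] (S : SuperGrading A)
    {m n : ℕ} {a : Fin n → A} {d : Fin n → ℕ} (ha : ∀ t, a t ∈ S.gr (d t)) {e : Fin m → Fin n}
    (he : Function.Injective e) :
    ordProd a (Finset.univ.image e) =
      koszulSign e (fun i => d (e i)) • (List.ofFn fun i => a (e i)).prod := by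
  rw [← S.prod_blocks e fun i => ha (e i), ordProd_eq_filter, List.ofFn_eq_map]
  have h1 : ∀ c, ordProd (fun i => a (e i)) (block e c) =
      if c ∈ Finset.univ.image e then a c else 1 := by
    intro c
    split_ifs with hc
    · obtain ⟨i, _, rfl⟩ := Finset.mem_image.1 hc
      have : block e (e i) = {i} := by
        ext i'; simp [block, he.eq_iff]
      rw [ordProd_eq _ _ (k := 1) (e := fun _ => i) (by simp [this])
        (Subsingleton.strictMono _) (by simp [this])]
      simp
    · have : block e c = ∅ := by
        ext i
        simp only [block, Finset.mem_filter, Finset.mem_univ, true_and, Finset.notMem_empty,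
          iff_false]
        exact fun h => hc (Finset.mem_image.2 ⟨i, Finset.mem_univ _, h⟩)
      rw [ordProd_eq _ _ (k := 0) (e := Fin.elim0) (by simp [this])
        (fun i => i.elim0) (fun i => i.elim0)]
      simp
  rw [List.map_congr_left fun c _ => h1 c]
  generalize List.finRange n = l
  induction l with
  | nil => rfl
  | cons x l ih =>
    by_cases hx : x ∈ Finset.univ.image e
    · rw [List.filter_cons_of_pos (by simpa using hx), List.map_cons, List.prod_cons, ih,
        List.map_cons, List.prod_cons, if_pos hx]
    · rw [List.filter_cons_of_neg (by simpa using hx), ih,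
        List.map_cons, List.prod_cons, if_neg hx, one_mul]

theorem bullet_perm {N : ℕ} {ψ : Ops W X} {φ : Ops V W} (hφ : IsGradedSymmetric φ) (h0 : φ 0 = 0)
    (hNφ : ∀ k, N ≤ k → φ k = 0) (hNψ : ∀ k, N ≤ k → ψ k = 0) {n : ℕ} (d : Fin n → ℕ)
    (v : ∀ a, V (d a)) (σ : Equiv.Perm (Fin n)) :
    bullet ψ φ (fun c => d (σ.symm c)) (fun c => v (σ.symm c)) =
      koszulSign σ d • bullet ψ φ d v := by
  obtain ⟨A, _, _, _, S, ε, η, η', c, hε, hsq, _, _, hc⟩ := exists_generic n d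
  have h1 := evalPt_evalPt_sum hφ h0 hNφ hNψ (S := S) hε hsq v
  have h2 := evalPt_evalPt_sum hφ h0 hNφ hNψ (S := S) (a := fun c => ε (σ.symm c))
    (d := fun c => d (σ.symm c)) (fun t => hε _) (fun t => hsq _) (fun c => v (σ.symm c))
  have h3 : ∑ t, ε (σ.symm t) ⊗ₜ[ℝ] homog (fun c => d (σ.symm c)) (fun c => v (σ.symm c)) t =
      ∑ t, ε t ⊗ₜ[ℝ] homog d v t :=
    σ.symm.sum_comp fun t => ε t ⊗ₜ[ℝ] homog d v t
  rw [h3, h1] at h2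
  let c' : A →ₗ[ℝ] ℝ := c ∘ₗ LinearMap.mulLeft ℝ η ∘ₗ LinearMap.mulLeft ℝ η'
  have hc' : ∀ B, c' (ordProd ε B) = if B = Finset.univ then 1 else 0 := hc
  have h4 := congrArg (coeff c') h2
  simp only [map_sum, coeff_tmul, hc'] at h4
  rw [Finset.sum_eq_single Finset.univ (fun B _ hB => by rw [if_neg hB, zero_smul])
    (by simp), if_pos rfl, one_smul, Finset.sum_eq_single Finset.univ _ (by simp)] at h4
  · rw [apply_orderEmb_univ (fun m d v => bullet ψ φ d v),
      apply_orderEmb_univ (fun m d v => bullet ψ φ d v) (fun c => d (σ.symm c))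
        (fun c => v (σ.symm c)), ordProd_univ,
      S.prod_perm σ hε, map_smul, ← ordProd_univ, hc', if_pos rfl] at h4
    rw [h4, smul_smul, smul_eq_mul, mul_one, koszulSign_mul_self, one_smul]
  · intro U _ hU
    have h5 := S.prod_injective hε (e := fun i => σ.symm (U.orderEmbOfFin rfl i))
      (σ.symm.injective.comp (U.orderEmbOfFin rfl).injective)
    have h6 : Finset.univ.image (fun i => σ.symm (U.orderEmbOfFin rfl i)) ≠ Finset.univ := by
      intro h
      apply hU
      rw [Finset.eq_univ_iff_forall]
      intro x
      have := Finset.mem_univ (σ.symm x)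
      rw [← h, Finset.mem_image] at this
      obtain ⟨i, _, hi⟩ := this
      rw [← σ.symm.injective hi]
      exact U.orderEmbOfFin_mem rfl i
    have h7 := congrArg c' h5
    rw [hc', if_neg h6, map_smul] at h7
    have h8 : c' (ordProd (fun c => ε (σ.symm c)) U) = 0 := by
      refine (smul_eq_zero.1 h7.symm).resolve_left fun h => ?_
      have := koszulSign_mul_self (fun i => σ.symm (U.orderEmbOfFin rfl i))
        (fun i => d (σ.symm (U.orderEmbOfFin rfl i)))
      rw [h] at this
      simp at this
    rw [h8, zero_smul]

theorem bulletOps_symm {r N : ℕ} (hV : ∀ i, r < i → Subsingleton (V i)) {ψ : Ops W X}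
    {φ : Ops V W} (hφ : IsGradedSymmetric φ) (h0 : φ 0 = 0)
    (hNφ : ∀ k, N ≤ k → φ k = 0) (hNψ : ∀ k, N ≤ k → ψ k = 0) :
    IsGradedSymmetric (bulletOps r ψ φ) := by
  intro k σ d v
  rw [bulletOps_homog hV, ← bullet_perm hφ h0 hNφ hNψ, ← bulletOps_homog hV]
  rfl

end Bounded

end LInfty

namespace LInfty

open scoped TensorProduct

/-! ### Linear parts, truncation and composition with linear maps -/

section Linear

variable {V W X : ℕ → Type*} [∀ i, AddCommGroup (V i)] [∀ i, Module ℝ (V i)]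
  [∀ i, AddCommGroup (W i)] [∀ i, Module ℝ (W i)] [∀ i, AddCommGroup (X i)] [∀ i, Module ℝ (X i)]

/-- The linear map `φ_1` on total spaces. -/
noncomputable def lin (φ : Ops V W) : (∀ i, V i) →ₗ[ℝ] ∀ i, W i :=
  (MultilinearMap.ofSubsingleton ℝ (∀ i, V i) (∀ i, W i) (0 : Fin 1)).symm (φ 1)

theorem lin_apply (φ : Ops V W) (x : ∀ i, V i) : lin φ x = φ 1 fun _ => x := rfl

/-- A linear map as a sequence of operations concentrated in arity one. -/
noncomputable def linOps (T : (∀ i, V i) →ₗ[ℝ] ∀ i, W i) : Ops V W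
  | 1 => MultilinearMap.ofSubsingleton ℝ (∀ i, V i) (∀ i, W i) (0 : Fin 1) T
  | _ => 0

theorem linOps_of_ne (T : (∀ i, V i) →ₗ[ℝ] ∀ i, W i) {k : ℕ} (hk : k ≠ 1) : linOps T k = 0 := by
  match k, hk with
  | 0, _ => rfl
  | 1, h => exact absurd rfl h
  | _ + 2, _ => rfl

theorem lin_linOps (T : (∀ i, V i) →ₗ[ℝ] ∀ i, W i) : lin (linOps T) = T := rfl

/-- The composition of operations with a linear map. -/
def postOps (T : (∀ i, W i) →ₗ[ℝ] ∀ i, X i) (φ : Ops V W) : Ops V X :=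
  fun k => T.compMultilinearMap (φ k)

/-- The operations of arity at least two. -/
def higherOps (φ : Ops V W) : Ops V W := fun k => if 2 ≤ k then φ k else 0

/-- A linear map of total spaces which raises degrees by `q - p`. -/
def HasShift (T : (∀ i, V i) →ₗ[ℝ] ∀ i, W i) (p q : ℕ) : Prop :=
  ∀ (i : ℕ) (x : V i) (j : ℕ), j + p ≠ i + q → T (Pi.single i x) j = 0

theorem HasShift.comp {T : (∀ i, W i) →ₗ[ℝ] ∀ i, X i} {T' : (∀ i, V i) →ₗ[ℝ] ∀ i, W i}
    {p q p' q' : ℕ} (hT : HasShift T p q) (hT' : HasShift T' p' q') (h0 : p' = 0) :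
    HasShift (T ∘ₗ T') (p + p') (q + q') := by
  intro i x j hj
  rw [LinearMap.comp_apply]
  have h1 : T' (Pi.single i x) = Pi.single (i + q') (T' (Pi.single i x) (i + q')) := by
    funext l
    by_cases hl : l = i + q'
    · subst hl; simp
    · rw [Pi.single_eq_of_ne hl, hT' i x l (by omega)]
  rw [h1, hT _ _ _ (by omega)]

theorem HasDegree.lin {φ : Ops V W} {q : ℕ} (hφ : HasDegree φ q) : HasShift (lin φ) 0 q := by
  intro i x j hj
  exact hφ 1 (fun _ => i) (fun _ => x) j (by simpa using hj)

theorem HasDegree.linOps {T : (∀ i, V i) →ₗ[ℝ] ∀ i, W i} {q : ℕ} (hT : HasShift T 0 q) :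
    HasDegree (linOps T) q := by
  intro k d v j hj
  by_cases hk : k = 1
  · subst hk
    exact hT (d 0) (v 0) j (by simpa using hj)
  · rw [linOps_of_ne T hk]; rfl

theorem IsGradedSymmetric.linOps (T : (∀ i, V i) →ₗ[ℝ] ∀ i, W i) :
    IsGradedSymmetric (linOps T) := by
  intro k σ d v
  by_cases hk : k = 1
  · subst hk
    rw [koszulSign_const _ 0 (fun a => Subsingleton.elim _ _), one_smul,
      Subsingleton.elim σ 1]
    rfl
  · rw [linOps_of_ne T hk]; simp

theorem HasDegree.postOps {T : (∀ i, W i) →ₗ[ℝ] ∀ i, X i} {φ : Ops V W} {p q r : ℕ}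
    (hT : HasShift T p q) (hφ : HasDegree φ (p + r)) : HasDegree (postOps T φ) (q + r) := by
  intro k d v j hj
  change T (φ k (homog d v)) j = 0
  rw [hφ.apply_homog d v, hT _ _ _ (by omega)]

theorem HasDegree.higherOps {φ : Ops V W} {q : ℕ} (hφ : HasDegree φ q) :
    HasDegree (higherOps φ) q := by
  intro k d v j hj
  rw [LInfty.higherOps]
  split_ifs
  · exact hφ k d v j hj
  · rfl

theorem HasDegree.add {φ ψ : Ops V W} {q : ℕ} (hφ : HasDegree φ q) (hψ : HasDegree ψ q) :
    HasDegree (φ + ψ) q := by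
  intro k d v j hj
  change (φ k _ + ψ k _) j = 0
  rw [Pi.add_apply, hφ k d v j hj, hψ k d v j hj, add_zero]

theorem IsGradedSymmetric.add {φ ψ : Ops V W} (hφ : IsGradedSymmetric φ)
    (hψ : IsGradedSymmetric ψ) : IsGradedSymmetric (φ + ψ) := by
  intro k σ d v
  change φ k _ + ψ k _ = _ • (φ k _ + ψ k _)
  rw [hφ k σ d v, hψ k σ d v, smul_add]

theorem circ_fin_zero (φ : Ops V W) (μ : Ops V V) (d : Fin 0 → ℕ) (v : ∀ a, V (d a)) :
    circ φ μ d v = lin φ (μ 0 Fin.elim0) := by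
  rw [circ_eq_sum]
  simp only [Finset.univ_unique, Finset.sum_singleton]
  have h2 : ∀ (m : ℕ) (hm : m = 0) (y : Fin m → ∀ i, V i) (z : ∀ i, V i),
      φ (m + 1) (Fin.cons z y) = φ 1 fun _ => z := by
    rintro m rfl y z
    congr 1
    funext i
    exact Fin.cases rfl (fun j => j.elim0) i
  have h3 : ∀ p : Fin 0 → Fin 2, opAt μ (homog d v) (block p 0) = μ 0 Fin.elim0 := by
    intro p
    rw [opAt_eq μ _ (block p 0) (k := 0)
      (by simp [block]) (e := id) strictMono_id (fun i => i.elim0),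
      Subsingleton.elim (fun i : Fin 0 => homog d v (id i)) Fin.elim0]
  rw [h2 _ (by simp [block]), lin_apply]
  simp [koszulSign, h3]

theorem bullet_fin_zero (ψ : Ops W X) (φ : Ops V W) (d : Fin 0 → ℕ) (v : ∀ a, V (d a)) :
    bullet ψ φ d v = ψ 0 Fin.elim0 := by
  rw [bullet_eq_blockOp]
  simp only [Finset.univ_unique, Finset.sum_singleton, zero_add, Finset.range_one, blockOp_apply]
  rw [Subsingleton.elim (fun c : Fin 0 => opAt φ (homog d v) (block _ c)) Fin.elim0]
  simp [koszulSign]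

theorem HasDegree.curvature {φ : Ops V W} {q : ℕ} (hφ : HasDegree φ q) :
    φ 0 Fin.elim0 = Pi.single q (φ 0 Fin.elim0 q) := by
  have := hφ.apply_homog (k := 0) Fin.elim0 (fun a => a.elim0)
  rw [Subsingleton.elim (homog (V := V) (n := 0) Fin.elim0 (fun a => a.elim0)) Fin.elim0] at this
  have hs : (∑ a : Fin 0, (Fin.elim0 a : ℕ)) = 0 := rfl
  rwa [hs, zero_add] at this

section Points

variable {A : Type*} [Ring A] [Algebra ℝ A]

theorem lTensor_smul' {P Q : Type*} [AddCommGroup P] [Module ℝ P] [AddCommGroup Q] [Module ℝ Q]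
    (T : P →ₗ[ℝ] Q) (e : A) (z : A ⊗[ℝ] P) : T.lTensor A (e • z) = e • T.lTensor A z :=
  (T.baseChange A).map_smul e z

variable [Module.Finite ℝ A]

theorem hat_one (φ : Ops V W) (Y : A ⊗[ℝ] (∀ i, V i)) (y : Fin 1 → A ⊗[ℝ] (∀ i, V i))
    (hy : y 0 = Y) : hat A (φ 1) y = (lin φ).lTensor A Y := by
  obtain rfl : y = fun _ => Y := funext fun i => by rw [Subsingleton.elim i 0, hy]
  have h : (MultilinearMap.ofSubsingleton ℝ (A ⊗[ℝ] (∀ i, V i)) (A ⊗[ℝ] (∀ i, W i))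
      (0 : Fin 1)).symm (hat A (φ 1)) = (lin φ).lTensor A := by
    refine TensorProduct.ext' fun a x => ?_
    rw [LinearMap.lTensor_tmul]
    refine (hat_tmul (φ 1) (fun _ => a) fun _ => x).trans ?_
    simp [lin_apply]
  exact LinearMap.congr_fun h Y

theorem evalPt_linOps {N : ℕ} (hN : 2 ≤ N) (T : (∀ i, V i) →ₗ[ℝ] ∀ i, W i)
    (Y : A ⊗[ℝ] (∀ i, V i)) : evalPt N (linOps T) Y = T.lTensor A Y := by
  rw [evalPt, Finset.sum_eq_single 1]
  · rw [hat_one (linOps T) Y _ rfl, lin_linOps]; simp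
  · intro k _ hk
    rw [linOps_of_ne T hk, hat_zero]; simp
  · intro h; simp only [Finset.mem_range] at h; omega

theorem evalPt_postOps (N : ℕ) (T : (∀ i, W i) →ₗ[ℝ] ∀ i, X i) (φ : Ops V W)
    (Y : A ⊗[ℝ] (∀ i, V i)) : evalPt N (postOps T φ) Y = T.lTensor A (evalPt N φ Y) := by
  simp only [evalPt, map_sum, map_smul]
  exact Finset.sum_congr rfl fun k _ => by rw [postOps, hat_comp]

theorem derivPt_postOps (N : ℕ) (T : (∀ i, W i) →ₗ[ℝ] ∀ i, X i) (φ : Ops V W)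
    (Y K : A ⊗[ℝ] (∀ i, V i)) : derivPt N (postOps T φ) Y K = T.lTensor A (derivPt N φ Y K) := by
  simp only [derivPt, map_sum, map_smul]
  exact Finset.sum_congr rfl fun k _ => by rw [postOps, hat_comp]

theorem evalPt_add (N : ℕ) (φ ψ : Ops V W) (Y : A ⊗[ℝ] (∀ i, V i)) :
    evalPt N (φ + ψ) Y = evalPt N φ Y + evalPt N ψ Y := by
  simp only [evalPt, ← Finset.sum_add_distrib, ← smul_add]
  exact Finset.sum_congr rfl fun k _ => by rw [Pi.add_apply, hat_add]; rfl

theorem evalPt_eq_add_higherOps {N : ℕ} (hN : 2 ≤ N) (φ : Ops V W) (Y : A ⊗[ℝ] (∀ i, V i)) :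
    evalPt N φ Y = 1 ⊗ₜ φ 0 Fin.elim0 + (lin φ).lTensor A Y + evalPt N (higherOps φ) Y := by
  obtain ⟨N, rfl⟩ := Nat.exists_eq_add_of_le' hN
  have h0 : hat A (φ 0) (fun _ => Y) = 1 ⊗ₜ φ 0 Fin.elim0 := by
    have := hat_tmul (A := A) (φ 0) Fin.elim0 Fin.elim0
    rw [List.ofFn_zero, List.prod_nil] at this
    rw [← this]
    congr 1
    exact Subsingleton.elim _ _
  simp only [evalPt, Finset.sum_range_succ']
  rw [hat_one φ Y _ rfl, h0]
  simp only [higherOps]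
  have h1 : ∀ k, 2 ≤ k + 1 + 1 := fun k => by omega
  simp [h1, hat_zero]
  abel

theorem derivPt_sub (N : ℕ) (φ : Ops V W) (Y K K' : A ⊗[ℝ] (∀ i, V i)) :
    derivPt N φ Y (K - K') = derivPt N φ Y K - derivPt N φ Y K' := by
  rw [eq_sub_iff_add_eq]
  simp only [derivPt, ← Finset.sum_add_distrib, ← smul_add]
  refine Finset.sum_congr rfl fun k _ => ?_
  rw [← MultilinearMap.cons_add, sub_add_cancel]

end Points

end Linear

/-! ### Homotopy transfer -/

section Transfer

variable {V W : ℕ → Type*} [∀ i, AddCommGroup (V i)] [∀ i, Module ℝ (V i)]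
  [∀ i, AddCommGroup (W i)] [∀ i, Module ℝ (W i)]

/-- A contraction of the kernel of the linear part of `φ : (W, lam) → V`: a splitting `s` of `φ_1`
and a homotopy `δ` of degree `-1`, which satisfy the usual side conditions. -/
structure IsContraction (lam : Ops W W) (φ : Ops W V) (s : (∀ i, V i) →ₗ[ℝ] ∀ i, W i)
    (δ : (∀ i, W i) →ₗ[ℝ] ∀ i, W i) : Prop where
  shift_s : HasShift s 0 0
  shift_δ : HasShift δ 1 0
  lin_s : ∀ x, lin φ (s x) = x
  lin_δ : ∀ x, lin φ (δ x) = 0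
  δ_δ : ∀ x, δ (δ x) = 0
  δ_s : ∀ x, δ (s x) = 0
  δ_lin_δ : ∀ x, δ (lin lam (δ x)) = δ x
  exact : ∀ i, 2 ≤ i → ∀ x : W i, lin φ (Pi.single i x) = 0 → δ (Pi.single i x) = 0 →
    δ (lin lam (Pi.single i x)) = 0 → x = 0

variable (lam : Ops W W) (φ : Ops W V) (s : (∀ i, V i) →ₗ[ℝ] ∀ i, W i)
  (δ : (∀ i, W i) →ₗ[ℝ] ∀ i, W i)

/-- The linear part `s - δ λ_1 s` of the transferred morphism. -/
noncomputable def transferLin : (∀ i, V i) →ₗ[ℝ] ∀ i, W i := s - δ ∘ₗ lin lam ∘ₗ s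

/-- The operations `θ_k = (δ λ_1 s - s) φ_k - δ λ_k`, `k ≥ 2`, of the fixed point equation
`Ψ = (s - δ λ_1 s) + θ • Ψ` of the transferred morphism. -/
noncomputable def transferOps : Ops W W :=
  postOps (-transferLin lam s δ) (higherOps φ) + postOps (-δ) (higherOps lam)

/-- The iteration solving the fixed point equation of the transferred morphism.  It is
stationary, since the equation in output degree `j` involves lower degrees only. -/
noncomputable def transferIter (r : ℕ) : ℕ → Ops V W
  | 0 => 0
  | j + 1 => linOps (transferLin lam s δ) +
      bulletOps r (transferOps lam φ s δ) (transferIter r j)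

variable {lam φ s δ} {lam' : Ops V V} {r : ℕ}

theorem transferOps_of_lt {k : ℕ} (hk : k < 2) : transferOps lam φ s δ k = 0 := by
  have h : ¬ 2 ≤ k := by omega
  simp only [transferOps, Pi.add_apply, postOps, higherOps, if_neg h]
  ext; simp

theorem transferLin_shift (hlam : HasDegree lam 1) (h : IsContraction lam φ s δ) :
    HasShift (transferLin lam s δ) 0 0 := by
  intro i x j hj
  have h1 := (h.shift_δ.comp (hlam.lin.comp h.shift_s rfl) rfl) i x j (by omega)
  change (s (Pi.single i x) - _) j = 0
  rw [Pi.sub_apply, h.shift_s i x j hj]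
  exact sub_eq_zero.2 h1.symm

theorem HasShift.neg {V W : ℕ → Type*} [∀ i, AddCommGroup (V i)] [∀ i, Module ℝ (V i)]
    [∀ i, AddCommGroup (W i)] [∀ i, Module ℝ (W i)]
    {T : (∀ i, V i) →ₗ[ℝ] ∀ i, W i} {p q : ℕ} (hT : HasShift T p q) : HasShift (-T) p q := by
  intro i x j hj
  rw [LinearMap.neg_apply, Pi.neg_apply, hT i x j hj, neg_zero]

theorem transferOps_hasDegree (hlam : HasDegree lam 1) (hφ : HasDegree φ 0)
    (h : IsContraction lam φ s δ) : HasDegree (transferOps lam φ s δ) 0 :=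
  HasDegree.add (HasDegree.postOps (r := 0) (transferLin_shift hlam h).neg hφ.higherOps)
    (HasDegree.postOps (r := 0) h.shift_δ.neg hlam.higherOps)

/-- Bounded positive amplitude. -/
structure IsBounded (V : ℕ → Type*) (r : ℕ) : Prop where
  zero : Subsingleton (V 0)
  high : ∀ i, r < i → Subsingleton (V i)

variable (hV : IsBounded V r) (hW : IsBounded W r) (hlam : IsCurvedLInfty lam)
  (hφ : IsLInftyMorphism lam lam' φ) (h : IsContraction lam φ s δ)

include hV hlam hφ h

theorem transferIter_hasDegree (j : ℕ) : HasDegree (transferIter lam φ s δ r j) 0 := by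
  induction j with
  | zero => intro k d v j _; rfl
  | succ j ih =>
    exact (HasDegree.linOps (transferLin_shift hlam.degree h)).add
      (bulletOps_hasDegree hV.high (transferOps_hasDegree hlam.degree hφ.degree h) ih)

omit hlam hφ h in
theorem transferIter_zero (j : ℕ) : transferIter lam φ s δ r j 0 = 0 := by
  cases j with
  | zero => rfl
  | succ j =>
    refine multilinear_ext_homog hV.high fun d v => ?_
    change linOps (transferLin lam s δ) 0 (homog d v) + bulletOps r (transferOps lam φ s δ)
      (transferIter lam φ s δ r j) 0 (homog d v) = 0
    rw [bulletOps_homog hV.high, linOps_of_ne _ (by norm_num), bullet]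
    simp [transferOps_of_lt]

include hW

theorem transferIter_symm (j : ℕ) : IsGradedSymmetric (transferIter lam φ s δ r j) := by
  induction j with
  | zero => intro k σ d v; simp [transferIter]
  | succ j ih =>
    exact (IsGradedSymmetric.linOps _).add (bulletOps_symm (N := r + 1) hV.high ih
      (transferIter_zero hV j)
      (fun k hk => (transferIter_hasDegree hV hlam hφ h j).eq_zero hV.high hV.zero hW.high hk)
      (fun k hk => (transferOps_hasDegree hlam.degree hφ.degree h).eq_zero hW.high hW.zero
        hW.high hk))

omit hW in
/-- After `j` steps the iteration is stationary in output degrees below `j`. -/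
theorem transferIter_agree (j : ℕ) : ∀ (k : ℕ) (d : Fin k → ℕ) (v : ∀ a, V (d a)) (i : ℕ), i < j →
    transferIter lam φ s δ r (j + 1) k (homog d v) i =
      transferIter lam φ s δ r j k (homog d v) i := by
  induction j with
  | zero => intro k d v i hi; omega
  | succ j ih =>
    intro k d v i hi
    rw [transferIter, transferIter]
    change (linOps (transferLin lam s δ) k (homog d v) + bulletOps r (transferOps lam φ s δ)
      (transferIter lam φ s δ r (j + 1)) k (homog d v)) i =
      (linOps (transferLin lam s δ) k (homog d v) + bulletOps r (transferOps lam φ s δ)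
      (transferIter lam φ s δ r j) k (homog d v)) i
    rw [Pi.add_apply, Pi.add_apply, bulletOps_homog hV.high, bulletOps_homog hV.high]
    congr 1
    have hθ := transferOps_hasDegree hlam.degree hφ.degree h
    have hD := transferIter_hasDegree hV hlam hφ h
    by_cases hi' : i = (∑ a, d a) + 0
    swap
    · rw [bullet_hasDegree hθ (hD _) d v hi', bullet_hasDegree hθ (hD _) d v hi']
    by_cases hd : ∃ a, d a = 0
    · obtain ⟨a, ha⟩ := hd
      have hva : v a = 0 := by
        have : Subsingleton (V (d a)) := by rw [ha]; exact hV.zero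
        exact Subsingleton.elim _ _
      rw [bullet_eq_zero _ _ hva, bullet_eq_zero _ _ hva]
    push Not at hd
    rw [bullet_eq_blockOp, bullet_eq_blockOp]
    simp only [Finset.sum_apply, Pi.smul_apply]
    refine Finset.sum_congr rfl fun q _ => ?_
    congr 1
    refine Finset.sum_congr rfl fun p _ => ?_
    congr 1
    by_cases hq : q < 2
    · rw [blockOp_apply, blockOp_apply, transferOps_of_lt hq]; rfl
    by_cases hp : ∃ c, block p c = ∅
    · obtain ⟨c, hc⟩ := hp
      have h0 : ∀ j', opAt (transferIter lam φ s δ r j') (homog d v) (block p c) = 0 := by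
        intro j'
        have h1 : ∀ m, m = 0 → transferIter lam φ s δ r j' m = 0 := by
          rintro m rfl; exact transferIter_zero hV j'
        rw [opAt, h1 _ (by rw [hc]; rfl)]; rfl
      rw [blockOp_apply, blockOp_apply, MultilinearMap.map_coord_zero _ c (h0 _),
        MultilinearMap.map_coord_zero _ c (h0 _)]
    push Not at hp
    rw [blockOp_homog (hD _), blockOp_homog (hD _)]
    refine congrFun (congrArg _ (congrArg (homog _) (funext fun c => ?_))) i
    -- every block has smaller total degree than all inputs together, as there is another block
    have hpos : ∀ c, 1 ≤ ∑ a ∈ block p c, d a := by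
      intro c
      obtain ⟨a, ha⟩ := hp c
      exact (Nat.one_le_iff_ne_zero.2 (hd a)).trans
        (Finset.single_le_sum (f := d) (fun _ _ => Nat.zero_le _) ha)
    obtain ⟨c', hc'⟩ : ∃ c' : Fin q, c' ≠ c := by
      have : Nontrivial (Fin q) := Fin.nontrivial_iff_two_le.2 (by omega)
      exact exists_ne c
    have hlt : ∑ a ∈ block p c, d a < j := by
      have h1 := sum_block p d
      have h2 : ∑ x ∈ {c, c'}, ∑ a ∈ block p x, d a ≤ ∑ x, ∑ a ∈ block p x, d a :=
        Finset.sum_le_sum_of_subset (Finset.subset_univ _)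
      rw [Finset.sum_pair hc'.symm] at h2
      have := hpos c'
      omega
    exact ih _ (fun i => d ((block p c).orderEmbOfFin rfl i))
      (fun i => v ((block p c).orderEmbOfFin rfl i)) _ hlt

/-- The fixed point equation of the transferred morphism. -/
theorem transferIter_fixed (k : ℕ) (d : Fin k → ℕ) (v : ∀ a, V (d a)) :
    transferIter lam φ s δ r (r + 1) k (homog d v) =
      linOps (transferLin lam s δ) k (homog d v) +
        bullet (transferOps lam φ s δ) (transferIter lam φ s δ r (r + 1)) d v := by
  rw [← bulletOps_homog hV.high]
  change _ = transferIter lam φ s δ r (r + 1 + 1) k (homog d v)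
  funext i
  by_cases hi : i < r + 1
  · exact (transferIter_agree hV hlam hφ h (r + 1) k d v i hi).symm
  · have := hW.high i (by omega)
    exact Subsingleton.elim _ _

omit hlam hφ hW hV in
theorem δ_transferIter (j k : ℕ) (x : Fin k → ∀ i, V i) :
    δ (transferIter lam φ s δ r j k x) = 0 := by
  have h1 : ∀ x, δ (transferLin lam s δ x) = 0 := by
    intro x
    change δ (s x - δ (lin lam (s x))) = 0
    rw [map_sub, h.δ_s, h.δ_δ, sub_zero]
  have h2 : ∀ (q : ℕ) y, δ (transferOps lam φ s δ q y) = 0 := by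
    intro q y
    change δ ((-transferLin lam s δ) _ + (-δ) _) = 0
    rw [map_add, LinearMap.neg_apply, LinearMap.neg_apply, map_neg, map_neg, h1, h.δ_δ]
    simp
  cases j with
  | zero => exact map_zero δ
  | succ j =>
    change δ (linOps _ k x + bulletOps r _ _ k x) = 0
    rw [map_add, bulletOps_apply]
    have h3 : δ (linOps (transferLin lam s δ) k x) = 0 := by
      by_cases hk : k = 1
      · subst hk; exact h1 _
      · rw [linOps_of_ne _ hk]; exact map_zero δ
    rw [h3, zero_add, map_sum]
    refine Finset.sum_eq_zero fun d _ => ?_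
    rw [bullet_eq_blockOp, map_sum]
    refine Finset.sum_eq_zero fun q _ => ?_
    rw [map_smul, map_sum, Finset.sum_eq_zero, smul_zero]
    intro p _
    rw [map_smul, blockOp_apply, h2, smul_zero]

end Transfer

end LInfty

namespace LInfty

open scoped TensorProduct

/-! ### The transferred morphism -/

theorem eq_zero_of_tmul_eq_zero {A : Type*} [Ring A] [Algebra ℝ A] {U : ℕ → Type*}
    [∀ i, AddCommGroup (U i)] [∀ i, Module ℝ (U i)] (c : A →ₗ[ℝ] ℝ) {a : A} (hc : c a = 1)
    {x : ∀ i, U i} (hx : a ⊗ₜ[ℝ] x = 0) : x = 0 := by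
  have := congrArg (coeff c) hx
  rwa [coeff_tmul, hc, one_smul, map_zero] at this

theorem lTensor_eq_of_comp_eq {A : Type*} [Ring A] [Algebra ℝ A] {P Q R : Type*}
    [AddCommGroup P] [Module ℝ P] [AddCommGroup Q] [Module ℝ Q] [AddCommGroup R] [Module ℝ R] {T : Q →ₗ[ℝ] R} {T' : P →ₗ[ℝ] Q}
    {T'' : P →ₗ[ℝ] R} (hT : ∀ x, T (T' x) = T'' x) (z : A ⊗[ℝ] P) :
    T.lTensor A (T'.lTensor A z) = T''.lTensor A z := by
  rw [← LinearMap.comp_apply, ← LinearMap.lTensor_comp]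
  congr 1
  exact congrArg _ (LinearMap.ext hT)

/-- In a direction whose coefficient is annihilated by the coefficients of the base point, the
derivative reduces to the linear part. -/
theorem derivPt_eq_of_nilpotent {A : Type*} [Ring A] [Algebra ℝ A] [Module.Finite ℝ A]
    {V W : ℕ → Type*} [∀ i, AddCommGroup (V i)] [∀ i, Module ℝ (V i)]
    [∀ i, AddCommGroup (W i)] [∀ i, Module ℝ (W i)] {N : ℕ} (φ : Ops V W)
    (hN : ∀ k, N ≤ k → φ k = 0) {ι : Type*} [Fintype ι] (a : A) (x : ∀ i, V i) (b : ι → A)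
    (y : ι → ∀ i, V i) (hab : ∀ t, y t = 0 ∨ a * b t = 0) :
    derivPt N φ (∑ t, b t ⊗ₜ y t) (a ⊗ₜ x) = (lin φ).lTensor A (a ⊗ₜ x) := by
  have h1 : ∀ k, hat A (φ (k + 2)) (Fin.cons (a ⊗ₜ x) fun _ => ∑ t, b t ⊗ₜ y t) = 0 := by
    intro k
    rw [← MultilinearMap.curryLeft_apply, MultilinearMap.map_sum]
    refine Finset.sum_eq_zero fun κ _ => ?_
    rw [MultilinearMap.curryLeft_apply]
    rcases hab (κ 0) with h0 | h0
    · refine (hat A (φ (k + 2))).map_coord_zero 1 ?_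
      change b (κ 0) ⊗ₜ y (κ 0) = 0
      rw [h0, TensorProduct.tmul_zero]
    · have h2 : (Fin.cons (a ⊗ₜ[ℝ] x) (fun c => b (κ c) ⊗ₜ[ℝ] y (κ c)) :
          Fin (k + 2) → A ⊗[ℝ] (∀ i, V i)) = fun c =>
          (Fin.cons a (fun c => b (κ c)) : Fin (k + 2) → A) c ⊗ₜ
            (Fin.cons x (fun c => y (κ c)) : Fin (k + 2) → ∀ i, V i) c := by
        funext c
        refine Fin.cases rfl (fun c => rfl) c
      rw [h2, hat_tmul]
      simp only [List.ofFn_succ, Fin.cons_zero, Fin.cons_succ, List.prod_cons]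
      rw [← mul_assoc, h0, zero_mul, TensorProduct.zero_tmul]
  cases N with
  | zero =>
    rw [derivPt, Finset.range_zero, Finset.sum_empty]
    have : lin φ = 0 := LinearMap.ext fun z => by rw [lin_apply, hN 1 (by omega)]; rfl
    rw [this]; simp
  | succ N =>
    rw [derivPt, Finset.sum_range_succ', Finset.sum_eq_zero fun k _ => by rw [h1, smul_zero],
      zero_add, hat_one φ (a ⊗ₜ x) _ rfl]
    simp

section Transferred

variable {V W : ℕ → Type*} [∀ i, AddCommGroup (V i)] [∀ i, Module ℝ (V i)]
  [∀ i, AddCommGroup (W i)] [∀ i, Module ℝ (W i)]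
  {lam : Ops W W} {φ : Ops W V} {s : (∀ i, V i) →ₗ[ℝ] ∀ i, W i}
  {δ : (∀ i, W i) →ₗ[ℝ] ∀ i, W i} {lam' : Ops V V} {r : ℕ}

variable (lam φ s δ r) in
/-- The morphism `V → W` obtained by homotopy transfer, a section of `φ`. -/
noncomputable def transfer : Ops V W := transferIter lam φ s δ r (r + 1)

variable (hV : IsBounded V r) (hW : IsBounded W r) (hlam : IsCurvedLInfty lam)
  (hφ : IsLInftyMorphism lam lam' φ) (h : IsContraction lam φ s δ)

include hV hlam hφ h

theorem transfer_hasDegree : HasDegree (transfer lam φ s δ r) 0 :=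
  transferIter_hasDegree hV hlam hφ h _

omit hlam hφ h in
theorem transfer_zero : transfer lam φ s δ r 0 = 0 := transferIter_zero hV _

include hW

theorem transfer_symm : IsGradedSymmetric (transfer lam φ s δ r) :=
  transferIter_symm hV hW hlam hφ h _

theorem transfer_eq_zero {k : ℕ} (hk : r + 2 ≤ k) : transfer lam φ s δ r k = 0 :=
  (transfer_hasDegree hV hlam hφ h).eq_zero hV.high hV.zero hW.high (by omega)

section Points

variable {A : Type*} [Ring A] [Algebra ℝ A] [Module.Finite ℝ A] {S : SuperGrading A}

/-- The fixed point equation as an identity of polynomial functions. -/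
theorem evalPt_transfer {X : A ⊗[ℝ] (∀ i, V i)} (hX : X ∈ evenPts S V) :
    evalPt (r + 2) (transfer lam φ s δ r) X = (transferLin lam s δ).lTensor A X +
      evalPt (r + 2) (transferOps lam φ s δ) (evalPt (r + 2) (transfer lam φ s δ r) X) := by
  obtain ⟨n, d, v, a, ha, hsq, rfl⟩ := exists_eq_sum_of_mem_evenPts hX
  have hsymm := transfer_symm hV hW hlam hφ h
  have hzero := fun k (hk : r + 2 ≤ k) => transfer_eq_zero hV hW hlam hφ h hk
  rw [evalPt_evalPt_sum hsymm (transfer_zero hV) hzero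
    (fun k hk => (transferOps_hasDegree hlam.degree hφ.degree h).eq_zero hW.high hW.zero
        hW.high (by omega)) ha hsq, evalPt_sum hsymm hzero ha hsq,
    ← evalPt_linOps (N := r + 2) (by omega), evalPt_sum (IsGradedSymmetric.linOps _)
      (fun k hk => linOps_of_ne _ (by omega)) ha hsq, ← Finset.sum_add_distrib]
  refine Finset.sum_congr rfl fun U _ => ?_
  rw [← TensorProduct.tmul_add]
  congr 1
  exact transferIter_fixed hV hW hlam hφ h _ (fun i => d (U.orderEmbOfFin rfl i))
    fun i => v (U.orderEmbOfFin rfl i)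

omit hV hW hlam hφ h in
theorem evalPt_transferOps (Y : A ⊗[ℝ] (∀ i, W i)) :
    evalPt (r + 2) (transferOps lam φ s δ) Y =
      -(transferLin lam s δ).lTensor A (evalPt (r + 2) (higherOps φ) Y) -
        δ.lTensor A (evalPt (r + 2) (higherOps lam) Y) := by
  rw [transferOps, evalPt_add, evalPt_postOps, evalPt_postOps, LinearMap.lTensor_neg,
    LinearMap.lTensor_neg, LinearMap.neg_apply, LinearMap.neg_apply, sub_eq_add_neg]

/-- The transferred morphism is a section of `φ`. -/
theorem evalPt_evalPt_transfer {X : A ⊗[ℝ] (∀ i, V i)} (hX : X ∈ evenPts S V) :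
    evalPt (r + 2) φ (evalPt (r + 2) (transfer lam φ s δ r) X) = X := by
  have h1 := evalPt_transfer hV hW hlam hφ h hX
  set Y := evalPt (r + 2) (transfer lam φ s δ r) X
  have h0 : φ 0 Fin.elim0 = 0 := by rw [hφ.zero]; rfl
  rw [evalPt_eq_add_higherOps (by omega) φ Y, h0, TensorProduct.tmul_zero,
    zero_add]
  have h2 : ∀ x, lin φ (transferLin lam s δ x) = (LinearMap.id : (∀ i, V i) →ₗ[ℝ] _) x := by
    intro x
    change lin φ (s x - δ (lin lam (s x))) = x
    rw [map_sub, h.lin_s, h.lin_δ, sub_zero]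
  have h3 : ∀ x : ∀ i, W i, lin φ (δ x) = (0 : (∀ i, W i) →ₗ[ℝ] ∀ i, V i) x := h.lin_δ
  nth_rewrite 1 [h1]
  rw [map_add, evalPt_transferOps, map_sub, map_neg, lTensor_eq_of_comp_eq h2,
    lTensor_eq_of_comp_eq h2, lTensor_eq_of_comp_eq h3]
  simp

omit hW hV hlam hφ in
theorem δ_curvature (hlam : HasDegree lam 1) (hW : IsBounded W r) :
    δ (lam 0 Fin.elim0) = 0 := by
  rw [hlam.curvature]
  funext j
  cases j with
  | zero => have := hW.zero; exact Subsingleton.elim _ _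
  | succ j => exact h.shift_δ 1 _ _ (by omega)

/-- `δ λ(Ψ) = 0`: apply `δ λ_1` to the fixed point equation. -/
theorem δ_evalPt_evalPt_transfer {X : A ⊗[ℝ] (∀ i, V i)} (hX : X ∈ evenPts S V) :
    δ.lTensor A (evalPt (r + 2) lam (evalPt (r + 2) (transfer lam φ s δ r) X)) = 0 := by
  have h1 := evalPt_transfer hV hW hlam hφ h hX
  set Y := evalPt (r + 2) (transfer lam φ s δ r) X
  rw [evalPt_eq_add_higherOps (by omega) lam Y, map_add, map_add, LinearMap.lTensor_tmul,
    δ_curvature h hlam.degree hW, TensorProduct.tmul_zero, zero_add]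
  nth_rewrite 1 [h1]
  have h2 : ∀ x, (δ ∘ₗ lin lam) (transferLin lam s δ x) = (0 : (∀ i, V i) →ₗ[ℝ] ∀ i, W i) x := by
    intro x
    change δ (lin lam (s x - δ (lin lam (s x)))) = 0
    rw [map_sub, map_sub, h.δ_lin_δ, sub_self]
  have h3 : ∀ x, (δ ∘ₗ lin lam) (δ x) = δ x := h.δ_lin_δ
  rw [lTensor_eq_of_comp_eq (T'' := δ ∘ₗ lin lam) (fun _ => rfl), map_add,
    evalPt_transferOps, map_sub, map_neg, lTensor_eq_of_comp_eq h2,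
    lTensor_eq_of_comp_eq h2, lTensor_eq_of_comp_eq h3]
  simp

variable (lam φ s δ r lam') in
/-- The failure `λ • Ψ - Ψ ∘ λ'` of the transferred `Ψ` to be a morphism. -/
noncomputable def defect (X : A ⊗[ℝ] (∀ i, V i)) : A ⊗[ℝ] (∀ i, W i) :=
  evalPt (r + 2) lam (evalPt (r + 2) (transfer lam φ s δ r) X) -
    derivPt (r + 2) (transfer lam φ s δ r) X (evalPt (r + 2) lam' X)

omit hW in
theorem evalPt_transfer_mem {X : A ⊗[ℝ] (∀ i, V i)} (hX : X ∈ evenPts S V) :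
    evalPt (r + 2) (transfer lam φ s δ r) X ∈ evenPts S W :=
  evalPt_mem_evenPts (transfer_zero hV) (transfer_hasDegree hV hlam hφ h) hX

omit hW in
theorem defect_mem (hlam' : IsCurvedLInfty lam') {X : A ⊗[ℝ] (∀ i, V i)}
    (hX : X ∈ evenPts S V) : defect lam φ s δ lam' r X ∈ oddPts S W :=
  Submodule.sub_mem _ (evalPt_mem_oddPts hlam.degree (evalPt_transfer_mem hV hlam hφ h hX))
    (derivPt_mem_oddPts (transfer_hasDegree hV hlam hφ h) hX
      (evalPt_mem_oddPts hlam'.degree hX))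

theorem δ_defect {X : A ⊗[ℝ] (∀ i, V i)} (hX : X ∈ evenPts S V) :
    δ.lTensor A (defect lam φ s δ lam' r X) = 0 := by
  rw [defect, map_sub, δ_evalPt_evalPt_transfer hV hW hlam hφ h hX, zero_sub, neg_eq_zero,
    ← derivPt_postOps]
  have h1 : postOps δ (transfer lam φ s δ r) = 0 := by
    funext k
    ext1 x
    exact δ_transferIter h (r + 1) k x
  rw [h1]
  simp [derivPt, hat_zero]

/-- The flow of `λ'` is mapped to the flow of `λ` by the transferred morphism, up to the defect. -/
theorem evalPt_transfer_add (hlam' : IsCurvedLInfty lam') {e : A} (he : e ∈ S.gr 1)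
    {X : A ⊗[ℝ] (∀ i, V i)} (hX : X ∈ evenPts S V) :
    evalPt (r + 2) (transfer lam φ s δ r) (X + e • evalPt (r + 2) lam' X) =
      evalPt (r + 2) (transfer lam φ s δ r) X +
        e • (evalPt (r + 2) lam (evalPt (r + 2) (transfer lam φ s δ r) X) -
          defect lam φ s δ lam' r X) := by
  rw [evalPt_add_smul (transfer_symm hV hW hlam hφ h)
    (fun k hk => transfer_eq_zero hV hW hlam hφ h hk) he hX (evalPt_mem_oddPts hlam'.degree hX),
    defect, sub_sub_cancel]

omit h hφ hV in
theorem ops_eq_zero {k : ℕ} (hk : r + 2 ≤ k) : lam k = 0 :=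
  hlam.degree.eq_zero hW.high hW.zero hW.high (by omega)

/-- The defect is killed by the derivative of `φ`, since `φ` is a morphism and `φ • Ψ = id`. -/
theorem derivPt_defect_eq_zero (hlam' : IsCurvedLInfty lam') {e : A} (he : e ∈ S.gr 1)
    {X : A ⊗[ℝ] (∀ i, V i)} (hX : X ∈ evenPts S V) :
    e • derivPt (r + 2) φ (evalPt (r + 2) (transfer lam φ s δ r) X)
      (defect lam φ s δ lam' r X) = 0 := by
  have h1 := evalPt_transfer_add hV hW hlam hφ h hlam' he hX
  have hX1 : X + e • evalPt (r + 2) lam' X ∈ evenPts S V :=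
    Submodule.add_mem _ hX (smul_mem_evenPts he (evalPt_mem_oddPts hlam'.degree hX))
  have h2 := evalPt_evalPt_transfer hV hW hlam hφ h hX1
  have hY := evalPt_transfer_mem hV hlam hφ h hX
  have hNφ : ∀ k, r + 2 ≤ k → φ k = 0 := fun k hk =>
    hφ.degree.eq_zero hW.high hW.zero hV.high (by omega)
  have h3 := smul_derivPt_evalPt hlam hφ hNφ (fun k hk => ops_eq_zero hW hlam hk)
    (fun k hk => ops_eq_zero hV hlam' hk) he hY
  rw [evalPt_evalPt_transfer hV hW hlam hφ h hX] at h3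
  rw [h1, evalPt_add_smul hφ.symm hNφ he hY (Submodule.sub_mem _
    (evalPt_mem_oddPts hlam.degree hY) (defect_mem hV hlam hφ h hlam' hX)),
    evalPt_evalPt_transfer hV hW hlam hφ h hX, derivPt_sub, smul_sub, h3] at h2
  have h4 := add_left_cancel h2
  exact sub_eq_self.1 h4

/-- The Bianchi identity for the defect: comparing the flows of `λ` and `λ'` expresses the
derivative of `λ` along the defect by values of the defect. -/
theorem smul_smul_derivPt_defect (hlam' : IsCurvedLInfty lam') {e e' : A} (he : e ∈ S.gr 1)
    (he' : e' ∈ S.gr 1) {X : A ⊗[ℝ] (∀ i, V i)} (hX : X ∈ evenPts S V) :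
    e • e' • derivPt (r + 2) lam (evalPt (r + 2) (transfer lam φ s δ r) X)
      (defect lam φ s δ lam' r X) =
    e • (defect lam φ s δ lam' r X -
      defect lam φ s δ lam' r (X + e' • evalPt (r + 2) lam' X)) := by
  have hN' : ∀ k, r + 2 ≤ k → lam' k = 0 := fun k hk => ops_eq_zero hV hlam' hk
  have hN : ∀ k, r + 2 ≤ k → lam k = 0 := fun k hk => ops_eq_zero hW hlam hk
  have hlX := evalPt_mem_oddPts (N := r + 2) hlam'.degree hX
  have hX1 : X + e' • evalPt (r + 2) lam' X ∈ evenPts S V :=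
    Submodule.add_mem _ hX (smul_mem_evenPts he' hlX)
  have hY := evalPt_transfer_mem hV hlam hφ h hX
  have hD := defect_mem hV hlam hφ h hlam' hX
  -- the vector field `λ'` is invariant under its own flow
  have h1 : evalPt (r + 2) lam' (X + e' • evalPt (r + 2) lam' X) = evalPt (r + 2) lam' X := by
    rw [evalPt_add_smul hlam'.symm hN' he' hX hlX, smul_derivPt_evalPt_self hlam' hN' he' hX,
      add_zero]
  have h2 := evalPt_transfer_add hV hW hlam hφ h hlam' he hX1
  have h3 := evalPt_transfer_add hV hW hlam hφ h hlam' (Submodule.add_mem _ he' he) hX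
  have h4 := evalPt_transfer_add hV hW hlam hφ h hlam' he' hX
  have h5 : evalPt (r + 2) lam (evalPt (r + 2) (transfer lam φ s δ r) X +
      e' • (evalPt (r + 2) lam (evalPt (r + 2) (transfer lam φ s δ r) X) -
          defect lam φ s δ lam' r X)) =
      evalPt (r + 2) lam (evalPt (r + 2) (transfer lam φ s δ r) X) -
        e' • derivPt (r + 2) lam (evalPt (r + 2) (transfer lam φ s δ r) X)
          (defect lam φ s δ lam' r X) := by
    rw [evalPt_add_smul hlam.symm hN he' hY (Submodule.sub_mem _
      (evalPt_mem_oddPts hlam.degree hY) hD), derivPt_sub, smul_sub,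
      smul_derivPt_evalPt_self hlam hN he' hY, zero_sub, sub_eq_add_neg]
  rw [h1, add_assoc, ← add_smul, h3, h4, h5, add_smul, add_assoc] at h2
  have h6 := add_left_cancel (add_left_cancel h2)
  generalize derivPt (r + 2) lam (evalPt (r + 2) (transfer lam φ s δ r) X)
      (defect lam φ s δ lam' r X) = a at *
  generalize defect lam φ s δ lam' r (X + e' • evalPt (r + 2) lam' X) = b at *
  generalize defect lam φ s δ lam' r X = c at *
  generalize evalPt (r + 2) lam (evalPt (r + 2) (transfer lam φ s δ r) X) = l at *
  rw [smul_sub, smul_sub, smul_sub] at h6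
  rw [smul_sub]
  have h7 : e • l - e • c - (e • l - e • e' • a - e • b) = 0 := sub_eq_zero.2 h6
  rw [← sub_eq_zero, ← h7]
  abel

end Points

/-- In arity `0` the compatibility of the transferred morphism with the curved structures is the
condition on the curvature. -/
theorem transfer_curvature (hlam' : IsCurvedLInfty lam')
    (hcurv : ∃ c, lam 0 Fin.elim0 - s (lin φ (lam 0 Fin.elim0)) = δ c) :
    lam 0 Fin.elim0 = lin (transfer lam φ s δ r) (lam' 0 Fin.elim0) := by
  have h1 : lam' 0 Fin.elim0 = lin φ (lam 0 Fin.elim0) := by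
    rw [← circ_fin_zero φ lam Fin.elim0 (fun a => a.elim0), hφ.compat, bullet_fin_zero]
  have hφlam : lin φ (lam 0 Fin.elim0) = Pi.single 1 (lin φ (lam 0 Fin.elim0) 1) := by
    rw [← h1]
    exact hlam'.degree.curvature
  have h2 : ∀ x : V 1, lin (transfer lam φ s δ r) (Pi.single 1 x) =
      transferLin lam s δ (Pi.single 1 x) := by
    intro x
    have h3 := transferIter_fixed hV hW hlam hφ h 1 (fun _ => 1) fun _ => x
    have h4 : bullet (transferOps lam φ s δ) (transferIter lam φ s δ r (r + 1))
        (fun _ : Fin 1 => 1) (fun _ => x) = 0 := by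
      rw [bullet]
      refine Finset.sum_eq_zero fun j hj => ?_
      rw [transferOps_of_lt (Finset.mem_range.1 hj)]
      simp
    rw [h4, add_zero] at h3
    exact h3
  obtain ⟨c, hc⟩ := hcurv
  rw [h1, hφlam, h2, ← hφlam]
  set l := lam 0 Fin.elim0
  change l = s (lin φ l) - δ (lin lam (s (lin φ l)))
  have h3 : l = s (lin φ l) + δ c := by rw [← hc]; abel
  have h5 : δ (lin lam l) = 0 := by
    rw [← circ_fin_zero lam lam Fin.elim0 (fun a => a.elim0), hlam.jacobi, map_zero]
  have h6 : δ (lin lam (s (lin φ l))) = - δ c := by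
    have h7 : s (lin φ l) = l - δ c := by rw [eq_sub_iff_add_eq]; exact h3.symm
    rw [h7, map_sub, map_sub, h5, h.δ_lin_δ, zero_sub]
  rw [h6, sub_neg_eq_add]
  exact h3

include hφ in
/-- The transferred morphism is a section of `φ` for the composition `•`. -/
theorem transfer_bullet (hlam' : IsCurvedLInfty lam') {n : ℕ} (d : Fin n → ℕ)
    (v : ∀ a, V (d a)) :
    bullet φ (transfer lam φ s δ r) d v = idOps V n (homog d v) := by
  obtain ⟨A, _, _, _, S, ε, η, η', c, hε, hsq, _, _, hc⟩ := exists_generic n d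
  have h1 := evalPt_evalPt_transfer hV hW hlam hφ h (sum_mem_evenPts hε hsq v)
  have hid : ∀ k, r + 2 ≤ k → idOps V k = 0 := fun k hk => idOps_of_ne (by omega)
  have h2 : evalPt (r + 2) (idOps V) (∑ t, ε t ⊗ₜ[ℝ] homog d v t) =
      ∑ t, ε t ⊗ₜ[ℝ] homog d v t := by
    have : idOps V = linOps LinearMap.id := by
      funext k
      by_cases hk : k = 1
      · subst hk; rfl
      · rw [idOps_of_ne hk, linOps_of_ne _ hk]
    rw [this, evalPt_linOps (by omega), LinearMap.lTensor_id, LinearMap.id_apply]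
  have h3 := evalPt_sum (idOps_isLInftyMorphism hlam').symm hid hε hsq v
  rw [h2] at h3
  rw [evalPt_evalPt_sum (transfer_symm hV hW hlam hφ h) (transfer_zero hV)
      (fun k hk => transfer_eq_zero hV hW hlam hφ h hk)
      (fun k hk => hφ.degree.eq_zero hW.high hW.zero hV.high (by omega)) hε hsq] at h1
  replace h1 := h1.trans h3
  let c' : A →ₗ[ℝ] ℝ := c ∘ₗ LinearMap.mulLeft ℝ η ∘ₗ LinearMap.mulLeft ℝ η'
  have hc' : ∀ B, c' (ordProd ε B) = if B = Finset.univ then 1 else 0 := hc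
  have h4 := congrArg (coeff c') h1
  simp only [map_sum, coeff_tmul, hc', ite_smul, one_smul, zero_smul, Finset.sum_ite_eq',
    Finset.mem_univ, if_true] at h4
  rwa [apply_orderEmb_univ (fun m d v => bullet φ (transfer lam φ s δ r) d v), opAt_univ] at h4

/-- The transferred operations are a morphism of curved `L∞[1]`-algebras, provided that the
component of the curvature in the kernel of `φ_1` lies in the image of `δ`.  By induction on the
arity, the defect `e` in arity `n` is killed by `φ_1`, `δ` and `δ λ_1`, and it has degree `≥ 2`. -/
theorem transfer_compat (hlam' : IsCurvedLInfty lam')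
    (hcurv : ∃ c, lam 0 Fin.elim0 - s (lin φ (lam 0 Fin.elim0)) = δ c) (n : ℕ) :
    ∀ (d : Fin n → ℕ) (v : ∀ a, V (d a)),
      circ (transfer lam φ s δ r) lam' d v = bullet lam (transfer lam φ s δ r) d v := by
  induction n using Nat.strong_induction_on with
  | _ n ih =>
  intro d v
  -- inputs of degree zero vanish, as `V 0` is trivial
  by_cases hd : ∃ a, d a = 0
  · obtain ⟨a, ha⟩ := hd
    have hva : v a = 0 := by
      have : Subsingleton (V (d a)) := by rw [ha]; exact hV.zero
      exact Subsingleton.elim _ _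
    rw [bullet_eq_zero _ _ hva, circ_eq_zero _ _ hva]
  push Not at hd
  rcases Nat.eq_zero_or_pos n with rfl | hn
  · rw [circ_fin_zero, bullet_fin_zero]
    exact (transfer_curvature hV hW hlam hφ h hlam' hcurv).symm
  obtain ⟨A, _, _, _, S, ε, η, η', c, hε, hsq, hη, hη', hc⟩ := exists_generic n d
  set X := ∑ t, ε t ⊗ₜ[ℝ] homog d v t with hX
  have hXe : X ∈ evenPts S V := sum_mem_evenPts hε hsq v
  have hsymm := transfer_symm hV hW hlam hφ h
  have hN : ∀ k, r + 2 ≤ k → transfer lam φ s δ r k = 0 := fun k hk =>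
    transfer_eq_zero hV hW hlam hφ h hk
  have hNlam : ∀ k, r + 2 ≤ k → lam k = 0 := fun k hk => ops_eq_zero hW hlam hk
  have hNlam' : ∀ k, r + 2 ≤ k → lam' k = 0 := fun k hk => ops_eq_zero hV hlam' hk
  set e : ∀ i, W i := bullet lam (transfer lam φ s δ r) d v -
    circ (transfer lam φ s δ r) lam' d v with he
  -- by induction, the defect at the generic point is concentrated in the top coefficient
  have hE : ∀ η ∈ S.gr 1, η • defect lam φ s δ lam' r X =
      (η * ordProd ε Finset.univ) ⊗ₜ e := by
    intro η hη
    rw [defect, smul_sub, smul_derivPt_evalPt_sum hsymm hlam'.symm hlam'.degree hN hNlam' hη hε hsq,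
      evalPt_evalPt_sum hsymm (transfer_zero hV) hN hNlam hε hsq, Finset.smul_sum,
      ← Finset.sum_sub_distrib, Finset.sum_eq_single Finset.univ]
    · rw [TensorProduct.smul_tmul', smul_eq_mul, ← TensorProduct.tmul_sub,
        apply_orderEmb_univ (fun m d v => bullet lam (transfer lam φ s δ r) d v),
        apply_orderEmb_univ (fun m d v => circ (transfer lam φ s δ r) lam' d v)]
    · intro B _ hB
      have hcard : B.card < n := by
        have := Finset.card_lt_univ_of_notMem (s := B) (x := ?_) ?_
        · simpa using this
        · exact (not_forall.1 fun hall => hB (Finset.eq_univ_iff_forall.2 hall)).choose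
        · exact (not_forall.1 fun hall => hB (Finset.eq_univ_iff_forall.2 hall)).choose_spec
      rw [ih _ hcard, TensorProduct.smul_tmul', smul_eq_mul, sub_self]
    · simp
  have hY : evalPt (r + 2) (transfer lam φ s δ r) X =
      ∑ B : Finset (Fin n), ordProd ε B ⊗ₜ opAt (transfer lam φ s δ r) (homog d v) B :=
    evalPt_sum hsymm hN hε hsq v
  have hab : ∀ B : Finset (Fin n), opAt (transfer lam φ s δ r) (homog d v) B = 0 ∨
      η' * ordProd ε Finset.univ * ordProd ε B = 0 := by
    intro B
    rcases B.eq_empty_or_nonempty with rfl | hB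
    · left
      rw [opAt_eq _ _ _ (k := 0) rfl (e := Fin.elim0) (fun i => i.elim0) (fun i => i.elim0),
        transfer_zero hV]
      rfl
    · right
      rw [mul_assoc, S.ordProd_mul_eq_zero hε hsq, mul_zero]
      rw [Finset.not_disjoint_iff]
      obtain ⟨t, ht⟩ := hB
      exact ⟨t, Finset.mem_univ _, ht⟩
  have hc1 : c (η * (η' * ordProd ε Finset.univ)) = 1 := by rw [hc, if_pos rfl]
  have hφe : lin φ e = 0 := by
    have h1 := derivPt_defect_eq_zero hV hW hlam hφ h hlam' hη' hXe
    rw [← derivPt_smul, hE η' hη', hY, derivPt_eq_of_nilpotent φ (fun k hk =>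
      hφ.degree.eq_zero hW.high hW.zero hV.high (by omega)) _ _ _ _ hab,
      LinearMap.lTensor_tmul] at h1
    refine eq_zero_of_tmul_eq_zero c hc1 ?_
    rw [← smul_eq_mul, ← TensorProduct.smul_tmul', h1, smul_zero]
  have hδe : δ e = 0 := by
    have h1 := congrArg (fun z => η • η' • z) (δ_defect (lam' := lam') hV hW hlam hφ h hXe)
    simp only [smul_zero] at h1
    rw [← lTensor_smul', ← lTensor_smul', hE η' hη', TensorProduct.smul_tmul', smul_eq_mul,
      LinearMap.lTensor_tmul] at h1
    exact eq_zero_of_tmul_eq_zero c hc1 h1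
  have hδlam : δ (lin lam e) = 0 := by
    have h1 := smul_smul_derivPt_defect hV hW hlam hφ h hlam' hη hη' hXe
    have h2 := congrArg (δ.lTensor A) h1
    have hX1 : X + η' • evalPt (r + 2) lam' X ∈ evenPts S V :=
      Submodule.add_mem _ hXe (smul_mem_evenPts hη' (evalPt_mem_oddPts hlam'.degree hXe))
    rw [lTensor_smul' δ, lTensor_smul' δ, lTensor_smul' δ, map_sub, δ_defect hV hW hlam hφ h hXe,
      δ_defect hV hW hlam hφ h hX1, sub_zero, smul_zero, ← lTensor_smul', ← derivPt_smul,
      hE η' hη', hY, derivPt_eq_of_nilpotent lam hNlam _ _ _ _ hab, LinearMap.lTensor_tmul,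
      LinearMap.lTensor_tmul, TensorProduct.smul_tmul', smul_eq_mul] at h2
    exact eq_zero_of_tmul_eq_zero c hc1 h2
  have hdeg : e = Pi.single ((∑ a, d a) + 1) (e ((∑ a, d a) + 1)) := by
    funext j
    by_cases hj : j = (∑ a, d a) + 1
    · subst hj; simp
    · rw [Pi.single_eq_of_ne hj, he, Pi.sub_apply, bullet_hasDegree hlam.degree
        (transfer_hasDegree hV hlam hφ h) d v hj, circ_hasDegree
        (transfer_hasDegree hV hlam hφ h) hlam'.degree d v (by omega), sub_zero]
  have hsum : 1 ≤ ∑ a, d a :=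
    (Nat.one_le_iff_ne_zero.2 (hd ⟨0, hn⟩)).trans
      (Finset.single_le_sum (f := d) (fun _ _ => Nat.zero_le _) (Finset.mem_univ _))
  have h0 := h.exact ((∑ a, d a) + 1) (by omega) (e ((∑ a, d a) + 1))
    (by rw [← hdeg]; exact hφe) (by rw [← hdeg]; exact hδe) (by rw [← hdeg]; exact hδlam)
  have : e = 0 := by rw [hdeg, h0, Pi.single_zero]
  exact (sub_eq_zero.1 this).symm

theorem transfer_isMorphism (hlam' : IsCurvedLInfty lam')
    (hcurv : ∃ c, lam 0 Fin.elim0 - s (lin φ (lam 0 Fin.elim0)) = δ c) :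
    IsLInftyMorphism lam' lam (transfer lam φ s δ r) where
  zero := transfer_zero hV
  degree := transfer_hasDegree hV hlam hφ h
  symm := transfer_symm hV hW hlam hφ h
  compat n d v := transfer_compat hV hW hlam hφ h hlam' hcurv n d v

end Transferred

end LInfty

namespace LInfty

/-! ### Local frames of graded bundles -/

section Frames

variable {l m : ℕ}
  {M : Type*} [TopologicalSpace M] [ChartedSpace (EuclideanSpace ℝ (Fin m)) M]
  {Y : Type*} [TopologicalSpace Y] [ChartedSpace (EuclideanSpace ℝ (Fin l)) Y]

namespace GradedBundle

variable (E : GradedBundle m M)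

/-- An upper bound for the degrees in which the graded bundle is nonzero. -/
noncomputable def top : ℕ := E.bounded.choose

theorem rank_eq_zero {i : ℕ} (hi : E.top < i) : E.rank i = 0 := E.bounded.choose_spec i hi

theorem subsingleton_fiber {i : ℕ} (hi : E.rank i = 0) (P : M) : Subsingleton (E.L i P) := by
  have : Subsingleton (E.Model i) := by
    unfold GradedBundle.Model; rw [hi]; infer_instance
  exact ((trivializationAt (E.Model i) (E.L i) P).continuousLinearEquivAt ℝ P
    (FiberBundle.mem_baseSet_trivializationAt _ _ _)).toEquiv.subsingleton

theorem isBounded {r : ℕ} (hr : E.top ≤ r) (P : M) : IsBounded (fun i => E.L i P) r :=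
  ⟨E.subsingleton_fiber E.rank_zero P,
    fun _ hi => E.subsingleton_fiber (E.rank_eq_zero (by omega)) P⟩

/-- The index set of the local frames: a degree and an index of a basis vector of the model
fibre. -/
abbrev FrameIndex : Type := Σ i : Fin (E.top + 1), Fin (E.rank i)

/-- The preferred trivialization of `L i` at `P₀`. -/
noncomputable abbrev triv (P₀ : M) (i : ℕ) := trivializationAt (E.Model i) (E.L i) P₀

/-- The local frame given by the preferred trivializations at `P₀`. -/
noncomputable def frame (P₀ : M) (r : E.FrameIndex) (Q : M) : ∀ i, E.L i Q :=
  Pi.single (r.1 : ℕ) ((E.triv P₀ r.1).symmₗ ℝ Q (EuclideanSpace.single r.2 (1 : ℝ)))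

/-- The coordinates with respect to `frame`. -/
noncomputable def coord (P₀ : M) (r : E.FrameIndex) (Q : M) : (∀ i, E.L i Q) →ₗ[ℝ] ℝ :=
  (EuclideanSpace.proj r.2 : E.Model r.1 →L[ℝ] ℝ).toLinearMap ∘ₗ
    (E.triv P₀ r.1).linearMapAt ℝ Q ∘ₗ LinearMap.proj (r.1 : ℕ)

/-- The domain of the local frame at `P₀`. -/
def frameDomain (P₀ : M) : Set M := ⋂ i : Fin (E.top + 1), (E.triv P₀ i).baseSet

theorem isOpen_frameDomain (P₀ : M) : IsOpen (E.frameDomain P₀) :=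
  isOpen_iInter_of_finite fun i => (E.triv P₀ i).open_baseSet

theorem mem_frameDomain_self (P₀ : M) : P₀ ∈ E.frameDomain P₀ :=
  Set.mem_iInter.2 fun i => FiberBundle.mem_baseSet_trivializationAt (E.Model i) (E.L i) P₀

theorem frameDomain_mem_nhds (P₀ : M) : E.frameDomain P₀ ∈ nhds P₀ :=
  (E.isOpen_frameDomain P₀).mem_nhds (E.mem_frameDomain_self P₀)

variable {E} {P₀ : M}

theorem mem_baseSet_of_mem_frameDomain {Q : M} (hQ : Q ∈ E.frameDomain P₀)
    (i : Fin (E.top + 1)) : Q ∈ (E.triv P₀ i).baseSet := Set.mem_iInter.1 hQ i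

theorem coord_apply {Q : M} (hQ : Q ∈ E.frameDomain P₀) (r : E.FrameIndex)
    (v : ∀ i, E.L i Q) : E.coord P₀ r Q v =
      (E.triv P₀ r.1 (Bundle.TotalSpace.mk' (E.Model r.1) Q (v r.1))).2 r.2 := by
  change ((E.triv P₀ r.1).linearMapAt ℝ Q (v r.1)) r.2 = _
  rw [Bundle.Trivialization.coe_linearMapAt_of_mem _ (mem_baseSet_of_mem_frameDomain hQ r.1)]

theorem sum_coord_frame {Q : M} (hQ : Q ∈ E.frameDomain P₀) (v : ∀ i, E.L i Q) :
    ∑ r, E.coord P₀ r Q v • E.frame P₀ r Q = v := by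
  funext i
  by_cases hi : i < E.top + 1
  · obtain ⟨i, rfl⟩ : ∃ i' : Fin (E.top + 1), (i' : ℕ) = i := ⟨⟨i, hi⟩, rfl⟩
    rw [Finset.sum_apply, Fintype.sum_sigma, Finset.sum_eq_single i]
    · simp only [Pi.smul_apply, frame, Pi.single_eq_same]
      have h0 : ∀ x : Fin (E.rank i), E.coord P₀ ⟨i, x⟩ Q v =
          ((E.triv P₀ i).linearMapAt ℝ Q (v i)) x := fun x => rfl
      simp only [h0]
      rw [Finset.sum_congr rfl fun x _ => (map_smul _ _ _).symm]
      refine ((map_sum ((E.triv P₀ i).symmₗ ℝ Q) _ _).symm).trans ?_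
      have h2 : ∑ x : Fin (E.rank i), ((E.triv P₀ i).linearMapAt ℝ Q (v i)) x •
            (EuclideanSpace.single x (1 : ℝ) : E.Model i) =
          (E.triv P₀ i).linearMapAt ℝ Q (v i) := by
        ext x
        simp [Pi.single_apply]
      rw [h2]
      exact (E.triv P₀ i).symmₗ_linearMapAt (mem_baseSet_of_mem_frameDomain hQ i) (v i)
    · intro i' _ hne
      refine Finset.sum_eq_zero fun x _ => ?_
      simp only [Pi.smul_apply, frame]
      rw [Pi.single_eq_of_ne (fun h => hne (Fin.ext h).symm), smul_zero]
    · simp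
  · have := E.subsingleton_fiber (E.rank_eq_zero (by omega : E.top < i)) Q
    exact Subsingleton.elim _ _

theorem ext_coord {Q : M} (hQ : Q ∈ E.frameDomain P₀) {v v' : ∀ i, E.L i Q}
    (h : ∀ r, E.coord P₀ r Q v = E.coord P₀ r Q v') : v = v' := by
  rw [← sum_coord_frame hQ v, ← sum_coord_frame hQ v']
  exact Finset.sum_congr rfl fun r _ => by rw [h r]

theorem coord_frame [DecidableEq E.FrameIndex] {Q : M} (hQ : Q ∈ E.frameDomain P₀)
    (r q : E.FrameIndex) : E.coord P₀ r Q (E.frame P₀ q Q) = if r = q then 1 else 0 := by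
  obtain ⟨i, a⟩ := r
  obtain ⟨j, b⟩ := q
  change ((E.triv P₀ i).linearMapAt ℝ Q (E.frame P₀ ⟨j, b⟩ Q i)) a = _
  by_cases h : i = j
  · subst h
    simp only [frame, Pi.single_eq_same]
    rw [(E.triv P₀ i).linearMapAt_symmₗ (mem_baseSet_of_mem_frameDomain hQ i)]
    simp
  · have h' : (i : ℕ) ≠ j := fun h' => h (Fin.ext h')
    simp only [frame]
    rw [Pi.single_eq_of_ne h', map_zero, if_neg (by rintro ⟨⟩; exact h rfl)]
    rfl

/-- Smoothness of sections is smoothness of their coordinates. -/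
theorem smoothAlongAt_iff {a : Y → M} {y₀ : Y} (ha : ContMDiffAt (𝓡 l) (𝓡 m) ∞ a y₀)
    (hy : a y₀ ∈ E.frameDomain P₀) (s : ∀ y, ∀ i, E.L i (a y)) :
    E.SmoothAlongAt (m := l) a s y₀ ↔
      ∀ r, ContMDiffAt (𝓡 l) 𝓘(ℝ, ℝ) ∞ (fun y => E.coord P₀ r (a y) (s y)) y₀ := by
  have hev : ∀ᶠ y in nhds y₀, a y ∈ E.frameDomain P₀ :=
    ha.continuousAt ((E.isOpen_frameDomain P₀).mem_nhds hy)
  have key : ∀ i : Fin (E.top + 1), ContMDiffAt (𝓡 l) ((𝓡 m).prod 𝓘(ℝ, E.Model i)) ∞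
      (fun Q => Bundle.TotalSpace.mk' (E.Model i) (a Q) (s Q i)) y₀ ↔
      ∀ x, ContMDiffAt (𝓡 l) 𝓘(ℝ, ℝ) ∞ (fun y => E.coord P₀ ⟨i, x⟩ (a y) (s y)) y₀ := by
    intro i
    rw [(E.triv P₀ i).contMDiffAt_iff
      ((E.triv P₀ i).mem_source.2 (mem_baseSet_of_mem_frameDomain hy i))]
    have h1 : ContMDiffAt (𝓡 l) 𝓘(ℝ, E.Model i) ∞
        (fun y => (E.triv P₀ i (Bundle.TotalSpace.mk' (E.Model i) (a y) (s y i))).2) y₀ ↔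
        ∀ x, ContMDiffAt (𝓡 l) 𝓘(ℝ, ℝ) ∞ (fun y =>
          (E.triv P₀ i (Bundle.TotalSpace.mk' (E.Model i) (a y) (s y i))).2 x) y₀ := by
      constructor
      · intro h x
        exact ((EuclideanSpace.proj x : E.Model i →L[ℝ] ℝ).contDiff.contMDiff.contMDiffAt).comp
          y₀ h
      · intro h
        have h2 : ContMDiffAt (𝓡 l) 𝓘(ℝ, Fin (E.rank i) → ℝ) ∞ (fun y => fun x =>
          (E.triv P₀ i (Bundle.TotalSpace.mk' (E.Model i) (a y) (s y i))).2 x) y₀ :=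
          contMDiffAt_pi_space.2 h
        exact ((EuclideanSpace.equiv (Fin (E.rank i)) ℝ).symm.contDiff.contMDiff.contMDiffAt).comp
          y₀ h2
    refine (and_iff_right ha).trans (h1.trans (forall_congr' fun x => ?_))
    refine Filter.EventuallyEq.contMDiffAt_iff ?_
    filter_upwards [hev] with y hy
    exact (coord_apply hy ⟨i, x⟩ (s y)).symm
  constructor
  · rintro h ⟨i, x⟩
    exact (key i).1 (h i) x
  · intro h i
    by_cases hi : i < E.top + 1
    · exact (key ⟨i, hi⟩).2 fun x => h ⟨⟨i, hi⟩, x⟩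
    · have h0 : ContMDiffAt (𝓡 l) ((𝓡 m).prod 𝓘(ℝ, E.Model i)) ∞
          (fun Q => Bundle.TotalSpace.mk' (E.Model i) (a Q) (0 : E.L i (a Q))) y₀ :=
        (Bundle.contMDiff_zeroSection ℝ (E.L i)).contMDiffAt.comp y₀ ha
      refine h0.congr_of_eventuallyEq (Filter.Eventually.of_forall fun Q => ?_)
      have := E.subsingleton_fiber (E.rank_eq_zero (by omega : E.top < i)) (a Q)
      exact congrArg _ (Subsingleton.elim _ _)

theorem SmoothAlongAt.congr {a : Y → M} {y₀ : Y} {s s' : ∀ y, ∀ i, E.L i (a y)}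
    (h : E.SmoothAlongAt (m := l) a s y₀) (hs : ∀ᶠ y in nhds y₀, s' y = s y) :
    E.SmoothAlongAt (m := l) a s' y₀ := fun i =>
  (h i).congr_of_eventuallyEq (hs.mono fun y hy => by simp only [hy])

section Along

variable {a : Y → M} {y₀ : Y} (ha : ContMDiffAt (𝓡 l) (𝓡 m) ∞ a y₀)
include ha

theorem smoothAlongAt_zero : E.SmoothAlongAt (m := l) a (fun _ => 0) y₀ := by
  rw [smoothAlongAt_iff ha (E.mem_frameDomain_self (a y₀))]
  intro r
  simpa only [map_zero] using contMDiffAt_const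

theorem SmoothAlongAt.add {s t : ∀ y, ∀ i, E.L i (a y)} (hs : E.SmoothAlongAt (m := l) a s y₀)
    (ht : E.SmoothAlongAt (m := l) a t y₀) :
    E.SmoothAlongAt (m := l) a (fun y => s y + t y) y₀ := by
  rw [smoothAlongAt_iff ha (E.mem_frameDomain_self (a y₀))] at *
  intro r
  simp only [map_add]
  exact (hs r).add (ht r)

theorem SmoothAlongAt.smul {s : ∀ y, ∀ i, E.L i (a y)} (hs : E.SmoothAlongAt (m := l) a s y₀)
    {c : Y → ℝ} (hc : ContMDiffAt (𝓡 l) 𝓘(ℝ, ℝ) ∞ c y₀) :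
    E.SmoothAlongAt (m := l) a (fun y => c y • s y) y₀ := by
  rw [smoothAlongAt_iff ha (E.mem_frameDomain_self (a y₀))] at *
  intro r
  simp only [map_smul]
  exact hc.smul (hs r)

theorem SmoothAlongAt.const_smul {s : ∀ y, ∀ i, E.L i (a y)}
    (hs : E.SmoothAlongAt (m := l) a s y₀) (c : ℝ) :
    E.SmoothAlongAt (m := l) a (fun y => c • s y) y₀ :=
  hs.smul ha (c := fun _ => c) contMDiffAt_const

theorem smoothAlongAt_sum {ι : Type*} (A : Finset ι) {s : ι → ∀ y, ∀ i, E.L i (a y)}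
    (hs : ∀ t ∈ A, E.SmoothAlongAt (m := l) a (s t) y₀) :
    E.SmoothAlongAt (m := l) a (fun y => ∑ t ∈ A, s t y) y₀ := by
  rw [smoothAlongAt_iff ha (E.mem_frameDomain_self (a y₀))]
  intro r
  simp only [map_sum]
  exact contMDiffAt_finsetSum fun t ht =>
    (smoothAlongAt_iff ha (E.mem_frameDomain_self (a y₀)) _).1 (hs t ht) r

theorem SmoothAlongAt.single {s : ∀ y, ∀ i, E.L i (a y)}
    (hs : E.SmoothAlongAt (m := l) a s y₀) (j : ℕ) :
    E.SmoothAlongAt (m := l) a (fun y => Pi.single j (s y j)) y₀ := by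
  intro i
  by_cases hi : i = j
  · subst hi
    simpa only [Pi.single_eq_same] using hs i
  · simp only [Pi.single_eq_of_ne hi]
    exact smoothAlongAt_zero ha i

end Along

theorem SmoothAt.along {s : ∀ P, ∀ i, E.L i P} {a : Y → M} {y₀ : Y} (hs : E.SmoothAt s (a y₀))
    (ha : ContMDiffAt (𝓡 l) (𝓡 m) ∞ a y₀) :
    E.SmoothAlongAt (m := l) a (fun y => s (a y)) y₀ :=
  fun i => (hs i).comp y₀ ha

theorem smoothAt_iff {Q : M} (hQ : Q ∈ E.frameDomain P₀) (s : ∀ P, ∀ i, E.L i P) :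
    E.SmoothAt s Q ↔ ∀ r, ContMDiffAt (𝓡 m) 𝓘(ℝ, ℝ) ∞ (fun P => E.coord P₀ r P (s P)) Q :=
  smoothAlongAt_iff (a := id) contMDiffAt_id hQ s

theorem smoothAt_frame {Q : M} (hQ : Q ∈ E.frameDomain P₀) (r : E.FrameIndex) :
    E.SmoothAt (E.frame P₀ r) Q := by
  classical
  rw [smoothAt_iff hQ]
  intro q
  refine (contMDiffAt_const (c := if q = r then (1 : ℝ) else 0)).congr_of_eventuallyEq ?_
  filter_upwards [(E.isOpen_frameDomain P₀).mem_nhds hQ] with P hP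
  exact coord_frame hP q r

end GradedBundle

end Frames

/-! ### Smooth families of linear maps -/

section SmoothLin

variable {l m : ℕ}
  {M : Type*} [TopologicalSpace M] [ChartedSpace (EuclideanSpace ℝ (Fin m)) M]
  {Y : Type*} [TopologicalSpace Y] [ChartedSpace (EuclideanSpace ℝ (Fin l)) Y]

/-- Families of linear maps between the total fibres of two graded bundles. -/
abbrev LinFamily (E E' : GradedBundle m M) :=
  ∀ P, (∀ i, E.L i P) →ₗ[ℝ] ∀ i, E'.L i P

/-- A family of linear maps is smooth at `P` if it takes sections which are smooth at `P` to
sections which are smooth at `P`. -/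
def SmoothLinAt (E E' : GradedBundle m M) (T : LinFamily E E') (P : M) : Prop :=
  ∀ s : ∀ P, ∀ i, E.L i P, E.SmoothAt s P → E'.SmoothAt (fun Q => T Q (s Q)) P

variable {E E' E'' : GradedBundle m M} {T T' : LinFamily E E'} {P : M}

theorem SmoothLinAt.congr (hT : SmoothLinAt E E' T P) (h : ∀ᶠ Q in nhds P, T' Q = T Q) :
    SmoothLinAt E E' T' P := fun s hs =>
  (hT s hs).congr (h.mono fun Q hQ => by simp only [hQ])

theorem SmoothLinAt.comp {S : LinFamily E' E''} (hS : SmoothLinAt E' E'' S P)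
    (hT : SmoothLinAt E E' T P) : SmoothLinAt E E'' (fun Q => S Q ∘ₗ T Q) P :=
  fun s hs => hS _ (hT s hs)

theorem SmoothLinAt.add (hT : SmoothLinAt E E' T P) (hT' : SmoothLinAt E E' T' P) :
    SmoothLinAt E E' (fun Q => T Q + T' Q) P :=
  fun s hs => GradedBundle.SmoothAlongAt.add contMDiffAt_id (hT s hs) (hT' s hs)

theorem SmoothLinAt.smul (hT : SmoothLinAt E E' T P) {c : M → ℝ}
    (hc : ContMDiffAt (𝓡 m) 𝓘(ℝ, ℝ) ∞ c P) : SmoothLinAt E E' (fun Q => c Q • T Q) P :=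
  fun s hs => GradedBundle.SmoothAlongAt.smul contMDiffAt_id (hT s hs) hc

theorem SmoothLinAt.sub (hT : SmoothLinAt E E' T P) (hT' : SmoothLinAt E E' T' P) :
    SmoothLinAt E E' (fun Q => T Q - T' Q) P := by
  have := hT.add (hT'.smul (c := fun _ => (-1 : ℝ)) contMDiffAt_const)
  refine this.congr (Filter.Eventually.of_forall fun Q => ?_)
  refine LinearMap.ext fun x => ?_
  change T Q x - T' Q x = T Q x + (-1 : ℝ) • T' Q x
  rw [sub_eq_add_neg, neg_one_smul]

theorem smoothLinAt_zero : SmoothLinAt E E' (fun _ => 0) P :=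
  fun _ _ => GradedBundle.smoothAlongAt_zero contMDiffAt_id

theorem smoothLinAt_sum {ι : Type*} (A : Finset ι) {T : ι → LinFamily E E'}
    (hT : ∀ t ∈ A, SmoothLinAt E E' (T t) P) : SmoothLinAt E E' (fun Q => ∑ t ∈ A, T t Q) P := by
  intro s hs
  simp only [LinearMap.sum_apply]
  exact GradedBundle.smoothAlongAt_sum contMDiffAt_id A fun t ht => hT t ht s hs

theorem smoothLinAt_id : SmoothLinAt E E (fun _ => LinearMap.id) P := fun _ hs => hs

/-- The projection of a total space to its component of degree `j`. -/
def projDeg {V : ℕ → Type*} [∀ i, AddCommGroup (V i)] [∀ i, Module ℝ (V i)] (j : ℕ) :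
    (∀ i, V i) →ₗ[ℝ] ∀ i, V i := LinearMap.single ℝ V j ∘ₗ LinearMap.proj j

theorem smoothLinAt_projDeg (j : ℕ) : SmoothLinAt E E (fun _ => projDeg j) P :=
  fun _ hs => GradedBundle.SmoothAlongAt.single contMDiffAt_id hs j

theorem SmoothOps.smoothLinAt_lin {φ : ∀ P, Ops (fun i => E.L i P) (fun i => E'.L i P)}
    (hφ : SmoothOps E E' id φ) (P : M) : SmoothLinAt E E' (fun Q => lin (φ Q)) P :=
  fun s hs => hφ 1 (fun _ => s) P fun _ => hs

/-- Smooth families of linear maps can be pulled back along smooth maps. -/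
theorem SmoothLinAt.along {a : Y → M} {y₀ : Y} (hT : SmoothLinAt E E' T (a y₀))
    (ha : ContMDiffAt (𝓡 l) (𝓡 m) ∞ a y₀) {s : ∀ y, ∀ i, E.L i (a y)}
    (hs : E.SmoothAlongAt (m := l) a s y₀) :
    E'.SmoothAlongAt (m := l) a (fun y => T (a y) (s y)) y₀ := by
  have h0 := E.mem_frameDomain_self (a y₀)
  have h1 : E'.SmoothAlongAt (m := l) a (fun y => ∑ r, E.coord (a y₀) r (a y) (s y) •
      T (a y) (E.frame (a y₀) r (a y))) y₀ :=
    GradedBundle.smoothAlongAt_sum ha _ fun r _ => GradedBundle.SmoothAlongAt.smul ha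
      ((hT _ (GradedBundle.smoothAt_frame h0 r)).along ha)
      ((GradedBundle.smoothAlongAt_iff ha h0 s).1 hs r)
  refine h1.congr ?_
  filter_upwards [ha.continuousAt (E.frameDomain_mem_nhds (a y₀))] with y hy
  nth_rewrite 1 [← GradedBundle.sum_coord_frame hy (s y)]
  simp only [map_sum, map_smul]

/-- The matrix entries of a family of linear maps with respect to local frames. -/
theorem smoothLinAt_iff {P₀ : M} (h : P ∈ E.frameDomain P₀) (h' : P ∈ E'.frameDomain P₀) :
    SmoothLinAt E E' T P ↔ ∀ r q, ContMDiffAt (𝓡 m) 𝓘(ℝ, ℝ) ∞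
      (fun Q => E'.coord P₀ r Q (T Q (E.frame P₀ q Q))) P := by
  constructor
  · intro hT r q
    exact (GradedBundle.smoothAt_iff h' _).1 (hT _ (GradedBundle.smoothAt_frame h q)) r
  · intro hT s hs
    rw [GradedBundle.smoothAt_iff h']
    intro r
    have h1 : ContMDiffAt (𝓡 m) 𝓘(ℝ, ℝ) ∞ (fun Q => ∑ q, E.coord P₀ q Q (s Q) *
        E'.coord P₀ r Q (T Q (E.frame P₀ q Q))) P :=
      contMDiffAt_finsetSum fun q _ => ((GradedBundle.smoothAt_iff h s).1 hs q).mul (hT r q)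
    refine h1.congr_of_eventuallyEq ?_
    filter_upwards [(E.isOpen_frameDomain P₀).mem_nhds h] with Q hQ
    nth_rewrite 1 [← GradedBundle.sum_coord_frame hQ (s Q)]
    simp only [map_sum, map_smul, smul_eq_mul]

end SmoothLin

end LInfty

namespace LInfty

/-! ### Smooth right inverses -/

section RightInverse

variable {m : ℕ} {M : Type*} [TopologicalSpace M] [ChartedSpace (EuclideanSpace ℝ (Fin m)) M]
  {E E' : GradedBundle m M} {P₀ P : M}

/-- The family of linear maps with prescribed matrices with respect to the local frames. -/
noncomputable def matFamily (E E' : GradedBundle m M) (P₀ : M)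
    (B : M → Matrix E'.FrameIndex E.FrameIndex ℝ) : LinFamily E E' := fun Q =>
  ∑ r, ∑ q, B Q r q • (E.coord P₀ q Q).smulRight (E'.frame P₀ r Q)

theorem coord_matFamily (B : M → Matrix E'.FrameIndex E.FrameIndex ℝ) {Q : M}
    (h' : Q ∈ E'.frameDomain P₀) (r : E'.FrameIndex) (v : ∀ i, E.L i Q) :
    E'.coord P₀ r Q (matFamily E E' P₀ B Q v) = ∑ q, B Q r q * E.coord P₀ q Q v := by
  classical
  simp only [matFamily, LinearMap.sum_apply, LinearMap.smul_apply, LinearMap.smulRight_apply,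
    map_sum, map_smul, GradedBundle.coord_frame h', smul_eq_mul, mul_ite, mul_one, mul_zero]
  rw [Finset.sum_eq_single r]
  · simp
  · intro r' _ hr
    simp [hr.symm]
  · simp

theorem smoothLinAt_matFamily {B : M → Matrix E'.FrameIndex E.FrameIndex ℝ}
    (h : P ∈ E.frameDomain P₀) (h' : P ∈ E'.frameDomain P₀)
    (hB : ∀ r q, ContMDiffAt (𝓡 m) 𝓘(ℝ, ℝ) ∞ (fun Q => B Q r q) P) :
    SmoothLinAt E E' (matFamily E E' P₀ B) P := by
  classical
  rw [smoothLinAt_iff h h']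
  intro r q
  refine (hB r q).congr_of_eventuallyEq ?_
  filter_upwards [(E.isOpen_frameDomain P₀).mem_nhds h, (E'.isOpen_frameDomain P₀).mem_nhds h']
    with Q hQ hQ'
  rw [coord_matFamily B hQ', Finset.sum_eq_single q]
  · simp [GradedBundle.coord_frame hQ]
  · intro q' _ hq
    simp [GradedBundle.coord_frame hQ, hq]
  · simp

/-- The matrix of a family of linear maps with respect to the local frames. -/
noncomputable def matOf (P₀ : M) (T : LinFamily E E') (Q : M) :
    Matrix E'.FrameIndex E.FrameIndex ℝ :=
  Matrix.of fun r q => E'.coord P₀ r Q (T Q (E.frame P₀ q Q))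

theorem coord_eq_matOf (T : LinFamily E E') {Q : M} (hQ : Q ∈ E.frameDomain P₀)
    (r : E'.FrameIndex) (v : ∀ i, E.L i Q) :
    E'.coord P₀ r Q (T Q v) = ∑ q, matOf P₀ T Q r q * E.coord P₀ q Q v := by
  nth_rewrite 1 [← GradedBundle.sum_coord_frame hQ v]
  simp only [map_sum, map_smul, smul_eq_mul, matOf, Matrix.of_apply, mul_comm]

/-- A linear map between fibres extends to a smooth family near the point. -/
theorem exists_smooth_extension (T₀ : (∀ i, E.L i P₀) →ₗ[ℝ] ∀ i, E'.L i P₀) :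
    ∃ T : LinFamily E E', T P₀ = T₀ ∧ ∀ᶠ Q in nhds P₀, SmoothLinAt E E' T Q := by
  refine ⟨matFamily E E' P₀ fun _ => Matrix.of fun r q => E'.coord P₀ r P₀
    (T₀ (E.frame P₀ q P₀)), ?_, ?_⟩
  · refine LinearMap.ext fun v => GradedBundle.ext_coord (E'.mem_frameDomain_self P₀) fun r => ?_
    rw [coord_matFamily _ (E'.mem_frameDomain_self P₀)]
    nth_rewrite 2 [← GradedBundle.sum_coord_frame (E.mem_frameDomain_self P₀) v]
    simp only [map_sum, map_smul, smul_eq_mul, Matrix.of_apply, mul_comm]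
  · filter_upwards [E.frameDomain_mem_nhds P₀, E'.frameDomain_mem_nhds P₀] with Q hQ hQ'
    exact smoothLinAt_matFamily hQ hQ' fun r q => contMDiffAt_const

theorem contMDiffAt_det {ι : Type*} [Fintype ι] [DecidableEq ι] {B : M → Matrix ι ι ℝ}
    (hB : ∀ r q, ContMDiffAt (𝓡 m) 𝓘(ℝ, ℝ) ∞ (fun Q => B Q r q) P) :
    ContMDiffAt (𝓡 m) 𝓘(ℝ, ℝ) ∞ (fun Q => (B Q).det) P := by
  simp only [Matrix.det_apply']
  exact contMDiffAt_finsetSum fun σ _ => contMDiffAt_const.mul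
    (contMDiffAt_finsetProd fun i _ => hB (σ i) i)

theorem contMDiffAt_matrix_inv {ι : Type*} [Fintype ι] [DecidableEq ι] {B : M → Matrix ι ι ℝ}
    (hB : ∀ r q, ContMDiffAt (𝓡 m) 𝓘(ℝ, ℝ) ∞ (fun Q => B Q r q) P) (hdet : (B P).det ≠ 0)
    (r q : ι) : ContMDiffAt (𝓡 m) 𝓘(ℝ, ℝ) ∞ (fun Q => (B Q)⁻¹ r q) P := by
  simp only [Matrix.inv_def, Ring.inverse_eq_inv', Matrix.smul_apply, Matrix.adjugate_apply,
    smul_eq_mul]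
  refine ContMDiffAt.mul ((contDiffAt_inv ℝ hdet).contMDiffAt.comp P (contMDiffAt_det hB))
    (contMDiffAt_det fun a b => ?_)
  simp only [Matrix.updateRow_apply]
  split_ifs
  · exact contMDiffAt_const
  · exact hB a b

/-- A smooth family of endomorphisms that is invertible at a point has a smooth inverse near that
point. -/
theorem exists_smooth_inverse {T : LinFamily E E} (hT : ∀ᶠ Q in nhds P₀, SmoothLinAt E E T Q)
    (h0 : T P₀ = LinearMap.id) :
    ∃ T' : LinFamily E E, ∀ᶠ Q in nhds P₀, SmoothLinAt E E T' Q ∧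
      T Q ∘ₗ T' Q = LinearMap.id ∧ T' Q ∘ₗ T Q = LinearMap.id := by
  classical
  have hentry : ∀ Q ∈ E.frameDomain P₀, SmoothLinAt E E T Q → ∀ r q,
      ContMDiffAt (𝓡 m) 𝓘(ℝ, ℝ) ∞ (fun Q => matOf P₀ T Q r q) Q :=
    fun Q hQ h => (smoothLinAt_iff hQ hQ).1 h
  have hdet : ∀ᶠ Q in nhds P₀, (matOf P₀ T Q).det ≠ 0 := by
    have hc := (contMDiffAt_det (hentry P₀ (E.mem_frameDomain_self P₀) hT.self_of_nhds)).continuousAt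
    refine hc.eventually_ne ?_
    have : matOf P₀ T P₀ = 1 := by
      ext r q
      rw [matOf, h0, Matrix.of_apply, LinearMap.id_apply,
        GradedBundle.coord_frame (E.mem_frameDomain_self P₀), Matrix.one_apply]
    rw [this, Matrix.det_one]
    exact one_ne_zero
  refine ⟨matFamily E E P₀ fun Q => (matOf P₀ T Q)⁻¹, ?_⟩
  filter_upwards [hT, hdet, E.frameDomain_mem_nhds P₀] with Q hQ hQdet hQd
  have hu : IsUnit (matOf P₀ T Q).det := isUnit_iff_ne_zero.2 hQdet
  have hvec : ∀ (B : Matrix E.FrameIndex E.FrameIndex ℝ) (x : E.FrameIndex → ℝ) (r),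
      ∑ q, B r q * x q = B.mulVec x r := fun B x r => rfl
  refine ⟨smoothLinAt_matFamily hQd hQd (contMDiffAt_matrix_inv (hentry Q hQd hQ) hQdet), ?_, ?_⟩
  · refine LinearMap.ext fun v => GradedBundle.ext_coord hQd fun r => ?_
    rw [LinearMap.comp_apply, coord_eq_matOf T hQd]
    simp only [coord_matFamily _ hQd, hvec]
    rw [Matrix.mulVec_mulVec, Matrix.mul_nonsing_inv _ hu, Matrix.one_mulVec, LinearMap.id_apply]
  · refine LinearMap.ext fun v => GradedBundle.ext_coord hQd fun r => ?_
    rw [LinearMap.comp_apply, coord_matFamily _ hQd]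
    simp only [coord_eq_matOf T hQd, hvec]
    rw [Matrix.mulVec_mulVec, Matrix.nonsing_inv_mul _ hu, Matrix.one_mulVec, LinearMap.id_apply]

/-- If `p` is a smooth family of projections and `A` maps onto the image of `p` at the point `P₀`,
then `A` has a smooth right inverse modulo the kernel of `p` near `P₀`. -/
theorem exists_rightInverse_nhds {A : LinFamily E E'} {p : LinFamily E' E'}
    (hA : ∀ᶠ Q in nhds P₀, SmoothLinAt E E' A Q) (hp : ∀ᶠ Q in nhds P₀, SmoothLinAt E' E' p Q)
    (hpp : ∀ᶠ Q in nhds P₀, ∀ x, p Q (p Q x) = p Q x)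
    (h0 : ∀ y, ∃ x, p P₀ (A P₀ x) = p P₀ y) :
    ∃ S : LinFamily E' E, ∀ᶠ Q in nhds P₀, SmoothLinAt E' E S Q ∧
      ∀ y, p Q (A Q (S Q y)) = p Q y := by
  obtain ⟨g, hg⟩ := LinearMap.exists_rightInverse_of_surjective (p P₀ ∘ₗ A P₀).rangeRestrict
    (LinearMap.range_rangeRestrict _)
  have hS₀ : ∃ S₀ : (∀ i, E'.L i P₀) →ₗ[ℝ] ∀ i, E.L i P₀, ∀ y, p P₀ (A P₀ (S₀ y)) = p P₀ y := by
    refine ⟨g ∘ₗ (p P₀).codRestrict (LinearMap.range (p P₀ ∘ₗ A P₀)) fun y => h0 y, fun y => ?_⟩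
    exact congrArg Subtype.val (LinearMap.congr_fun hg
      ((p P₀).codRestrict (LinearMap.range (p P₀ ∘ₗ A P₀)) (fun y => h0 y) y))
  obtain ⟨S₀, hS₀⟩ := hS₀
  obtain ⟨S, rfl, hS⟩ := exists_smooth_extension S₀
  -- `T = p A S p + (1 - p)` is invertible near `P₀` and commutes with `p`
  let T : LinFamily E' E' := fun Q =>
    (p Q ∘ₗ A Q ∘ₗ S Q ∘ₗ p Q) + (LinearMap.id - p Q)
  have hT : ∀ᶠ Q in nhds P₀, SmoothLinAt E' E' T Q := by
    filter_upwards [hA, hp, hS] with Q h1 h2 h3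
    exact (h2.comp (h1.comp (h3.comp h2))).add (smoothLinAt_id.sub h2)
  have hT0 : T P₀ = LinearMap.id := by
    refine LinearMap.ext fun y => ?_
    change p P₀ (A P₀ (S P₀ (p P₀ y))) + (y - p P₀ y) = y
    rw [hS₀, hpp.self_of_nhds]
    abel
  obtain ⟨T', hT'⟩ := exists_smooth_inverse hT hT0
  refine ⟨fun Q => S Q ∘ₗ p Q ∘ₗ T' Q, ?_⟩
  filter_upwards [hS, hp, hT', hpp] with Q h1 h2 h3 h4
  refine ⟨h1.comp (h2.comp h3.1), fun y => ?_⟩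
  have h5 : p Q (T Q (T' Q y)) = p Q y := congrArg (p Q) (LinearMap.congr_fun h3.2.1 y)
  rw [← h5]
  change _ = p Q (p Q (A Q (S Q (p Q (T' Q y)))) + (T' Q y - p Q (T' Q y)))
  rw [map_add, map_sub, h4, h4, sub_self, add_zero]
  rfl

end RightInverse

/-! ### Gluing of smooth families of linear maps -/

section Gluing

variable {m : ℕ} {M : Type*} [TopologicalSpace M] [T2Space M] [SecondCountableTopology M]
  [ChartedSpace (EuclideanSpace ℝ (Fin m)) M] [IsManifold (𝓡 m) ∞ M]
  {E E' : GradedBundle m M}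

/-- Smooth families of linear maps subject to a convex condition can be glued by a partition of
unity. -/
theorem exists_smoothLin_of_local (C : ∀ P, Set ((∀ i, E.L i P) →ₗ[ℝ] ∀ i, E'.L i P))
    (hC : ∀ P, Convex ℝ (C P)) (Z : Set M)
    (hloc : ∀ P ∈ Z, ∃ T : LinFamily E E', ∀ᶠ Q in nhds P, SmoothLinAt E E' T Q ∧ T Q ∈ C Q) :
    ∃ (W : Set M) (T : LinFamily E E'), IsOpen W ∧ Z ⊆ W ∧
      ∀ Q ∈ W, SmoothLinAt E E' T Q ∧ T Q ∈ C Q := by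
  classical
  choose! T hT using hloc
  have hU : ∀ P : Z, ∃ U : Set M, IsOpen U ∧ (P : M) ∈ U ∧
      ∀ Q ∈ U, SmoothLinAt E E' (T P) Q ∧ T P Q ∈ C Q := by
    intro P
    obtain ⟨U, hU, hUo, hP⟩ := eventually_nhds_iff.1 (hT P P.2)
    exact ⟨U, hUo, hP, hU⟩
  choose U hUo hPU hU using hU
  let W : TopologicalSpace.Opens M := ⟨⋃ P, U P, isOpen_iUnion hUo⟩
  have : LocallyCompactSpace M := ChartedSpace.locallyCompactSpace (EuclideanSpace ℝ (Fin m)) M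
  have : LocallyCompactSpace W := W.isOpen.locallyCompactSpace
  obtain ⟨ρ, hρ⟩ := SmoothPartitionOfUnity.exists_isSubordinate (𝓡 m) (s := (Set.univ : Set W))
    isClosed_univ (fun P => Subtype.val ⁻¹' U P) (fun P => (hUo P).preimage continuous_subtype_val)
    (fun Q _ => by
      obtain ⟨P, hP⟩ := Set.mem_iUnion.1 Q.2
      exact Set.mem_iUnion.2 ⟨P, hP⟩)
  -- extend the partition of unity by zero
  let f : Z → M → ℝ := fun P Q => if h : Q ∈ W then ρ P ⟨Q, h⟩ else 0
  have hf : ∀ P (Q : W), f P Q = ρ P Q := fun P Q => dif_pos Q.2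
  have hfs : ∀ P (Q : W), ContMDiffAt (𝓡 m) 𝓘(ℝ, ℝ) ∞ (f P) Q := by
    intro P Q
    rw [← contMDiffAt_subtype_iff]
    simp only [hf]
    exact (ρ P).contMDiff.contMDiffAt
  have hmem : ∀ (Q : W), ∀ P ∈ ρ.fintsupport Q, (Q : M) ∈ U P := fun Q P hP =>
    hρ P ((ρ.mem_fintsupport_iff Q P).1 hP)
  have hsum : ∀ Q : W, ∀ᶠ R in nhds (Q : M),
      (∑ᶠ P, f P R • T P R) = ∑ P ∈ ρ.fintsupport Q, f P R • T P R := by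
    intro Q
    rw [← W.isOpenEmbedding'.map_nhds_eq Q, Filter.eventually_map]
    filter_upwards [ρ.eventually_fintsupport_subset Q] with R hR
    refine finsum_eq_sum_of_support_subset _ fun P hP => hR ?_
    refine (ρ.mem_fintsupport_iff R P).2 (subset_tsupport _ ?_)
    intro h0
    refine hP ?_
    simp only [hf, h0, zero_smul]
  refine ⟨W, fun Q => ∑ᶠ P, f P Q • T P Q, W.isOpen, fun P hP =>
    Set.mem_iUnion.2 ⟨⟨P, hP⟩, hPU ⟨P, hP⟩⟩, fun Q hQ => ?_⟩
  lift Q to W using hQ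
  constructor
  · exact (smoothLinAt_sum _ fun P hP => (hU P Q (hmem Q P hP)).1.smul (hfs P Q)).congr (hsum Q)
  · refine Set.mem_of_eq_of_mem (hsum Q).self_of_nhds ?_
    refine (hC Q).sum_mem (fun P _ => ?_) ?_ fun P hP => (hU P Q (hmem Q P hP)).2
    · rw [hf]; exact ρ.nonneg P Q
    · simp only [hf]
      refine (ρ.toPartitionOfUnity.sum_finsupport' (Set.mem_univ Q) ?_)
      exact ρ.finsupport_subset_fintsupport Q

/-- Smooth right inverses near a set `Z`. -/
theorem exists_rightInverse {A : LinFamily E E'} {p : LinFamily E' E'} {W Z : Set M}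
    (hW : IsOpen W) (hZW : Z ⊆ W)
    (hA : ∀ Q ∈ W, SmoothLinAt E E' A Q) (hp : ∀ Q ∈ W, SmoothLinAt E' E' p Q)
    (hpp : ∀ Q ∈ W, ∀ x, p Q (p Q x) = p Q x)
    (h0 : ∀ P ∈ Z, ∀ y, ∃ x, p P (A P x) = p P y) :
    ∃ (W' : Set M) (S : LinFamily E' E), IsOpen W' ∧ Z ⊆ W' ∧ W' ⊆ W ∧
      ∀ Q ∈ W', SmoothLinAt E' E S Q ∧ ∀ y, p Q (A Q (S Q y)) = p Q y := by
  obtain ⟨W', S, h1, h2, h3⟩ := exists_smoothLin_of_local (E := E') (E' := E)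
    (fun Q => {S | ∀ y, p Q (A Q (S y)) = p Q y}) (fun Q S hS S' hS' a b _ _ hab y => by
      simp only [LinearMap.add_apply, LinearMap.smul_apply, map_add, map_smul, hS y, hS' y]
      rw [← add_smul, hab, one_smul]) Z
    (fun P hP => exists_rightInverse_nhds
      (Filter.eventually_of_mem (hW.mem_nhds (hZW hP)) hA)
      (Filter.eventually_of_mem (hW.mem_nhds (hZW hP)) hp)
      (Filter.eventually_of_mem (hW.mem_nhds (hZW hP)) hpp) (h0 P hP))
  exact ⟨W' ∩ W, S, h1.inter hW, fun P hP => ⟨h2 hP, hZW hP⟩, Set.inter_subset_right,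
    fun Q hQ => h3 Q hQ.1⟩

end Gluing

end LInfty

namespace LInfty

/-! ### Contractions built degree by degree -/

section Shifts

variable {V W : ℕ → Type*} [∀ i, AddCommGroup (V i)] [∀ i, Module ℝ (V i)]
  [∀ i, AddCommGroup (W i)] [∀ i, Module ℝ (W i)]

theorem projDeg_apply (j : ℕ) (x : ∀ i, V i) : projDeg j x = Pi.single j (x j) := rfl

theorem projDeg_projDeg (j : ℕ) (x : ∀ i, V i) : projDeg j (projDeg j x) = projDeg j x := by
  simp [projDeg_apply]

theorem projDeg_projDeg_of_ne {i j : ℕ} (h : i ≠ j) (x : ∀ i, V i) :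
    projDeg i (projDeg j x) = 0 := by
  simp [projDeg_apply, Pi.single_eq_of_ne h]

theorem projDeg_single (j : ℕ) (x : V j) : projDeg j (Pi.single j x) = Pi.single j x := by
  simp [projDeg_apply]

theorem projDeg_single_of_ne {i j : ℕ} (h : i ≠ j) (x : V j) :
    projDeg i (Pi.single j x) = (0 : ∀ i, V i) := by
  simp [projDeg_apply, Pi.single_eq_of_ne h]

theorem sum_projDeg {r : ℕ} (hV : ∀ i, r < i → Subsingleton (V i)) (x : ∀ i, V i) :
    ∑ i ∈ Finset.range (r + 1), projDeg i x = x := by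
  rw [Finset.sum_range]
  exact (eq_sum_single hV x).symm

/-- A map that shifts degrees intertwines the projections to the components. -/
theorem HasShift.projDeg_apply {r : ℕ} (hV : ∀ i, r < i → Subsingleton (V i))
    {T : (∀ i, V i) →ₗ[ℝ] ∀ i, W i} {p q i j : ℕ} (hT : HasShift T p q) (hij : j + p = i + q)
    (x : ∀ i, V i) : projDeg j (T x) = T (projDeg i x) := by
  have h1 : T (projDeg i x) = projDeg j (T (projDeg i x)) := by
    funext l
    rw [LInfty.projDeg_apply j]
    by_cases hl : l = j
    · subst hl; simp
    · rw [Pi.single_eq_of_ne hl]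
      exact hT i _ l (by omega)
  rw [h1]
  nth_rewrite 1 [← sum_projDeg hV x]
  rw [map_sum, map_sum, Finset.sum_eq_single i]
  · intro i' _ hi'
    rw [LInfty.projDeg_apply j, LInfty.projDeg_apply i', hT i' _ j (by omega), Pi.single_zero]
  · intro hi
    have := hV i (by simpa using hi)
    rw [LInfty.projDeg_apply i, Subsingleton.elim (x i) 0]
    simp

end Shifts

section PartialContraction

variable {V W : ℕ → Type*} [∀ i, AddCommGroup (V i)] [∀ i, Module ℝ (V i)]
  [∀ i, AddCommGroup (W i)] [∀ i, Module ℝ (W i)]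

/-- A homotopy `δ` which contracts the kernel of `φ_1` in degrees above `j` only. -/
structure IsContractionAbove (lam : Ops W W) (φ : Ops W V) (s : (∀ i, V i) →ₗ[ℝ] ∀ i, W i)
    (δ : (∀ i, W i) →ₗ[ℝ] ∀ i, W i) (j : ℕ) : Prop where
  shift_δ : HasShift δ 1 0
  low : ∀ i ≤ j, ∀ x : W i, δ (Pi.single i x) = 0
  lin_δ : ∀ x, lin φ (δ x) = 0
  δ_δ : ∀ x, δ (δ x) = 0
  δ_s : ∀ x, δ (s x) = 0
  δ_lin_δ : ∀ x, δ (lin lam (δ x)) = δ x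
  exact : ∀ i, j + 1 ≤ i → ∀ x : W i, lin φ (Pi.single i x) = 0 → δ (Pi.single i x) = 0 →
    δ (lin lam (Pi.single i x)) = 0 → x = 0

/-- The projection to the kernel of `φ_1` along the image of `s`. -/
noncomputable def kerProj (φ : Ops W V) (s : (∀ i, V i) →ₗ[ℝ] ∀ i, W i) :
    (∀ i, W i) →ₗ[ℝ] ∀ i, W i := LinearMap.id - s ∘ₗ lin φ

/-- The projection to the part of the kernel of `φ_1` on which the homotopy `δ λ_1` vanishes. -/
noncomputable def harmProj (lam : Ops W W) (φ : Ops W V) (s : (∀ i, V i) →ₗ[ℝ] ∀ i, W i)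
    (δ : (∀ i, W i) →ₗ[ℝ] ∀ i, W i) : (∀ i, W i) →ₗ[ℝ] ∀ i, W i :=
  kerProj φ s - δ ∘ₗ lin lam ∘ₗ kerProj φ s

variable {lam : Ops W W} {φ : Ops W V} {s : (∀ i, V i) →ₗ[ℝ] ∀ i, W i}
  {δ : (∀ i, W i) →ₗ[ℝ] ∀ i, W i} {r j : ℕ}

theorem kerProj_apply (x : ∀ i, W i) : kerProj φ s x = x - s (lin φ x) := rfl

theorem harmProj_apply (x : ∀ i, W i) :
    harmProj lam φ s δ x = kerProj φ s x - δ (lin lam (kerProj φ s x)) := rfl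

theorem kerProj_of_lin_eq_zero {x : ∀ i, W i} (hx : lin φ x = 0) : kerProj φ s x = x := by
  rw [kerProj_apply, hx, map_zero, sub_zero]

theorem lin_kerProj (hs : ∀ x, lin φ (s x) = x) (x : ∀ i, W i) : lin φ (kerProj φ s x) = 0 := by
  rw [kerProj_apply, map_sub, hs, sub_self]

theorem HasShift.sub {T T' : (∀ i, V i) →ₗ[ℝ] ∀ i, W i} {p q : ℕ} (hT : HasShift T p q)
    (hT' : HasShift T' p q) : HasShift (T - T') p q := fun i x j hj => by
  rw [LinearMap.sub_apply, Pi.sub_apply, hT i x j hj, hT' i x j hj, sub_zero]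

theorem hasShift_id : HasShift (LinearMap.id : (∀ i, V i) →ₗ[ℝ] ∀ i, V i) 0 0 :=
  fun _ _ _ hj => Pi.single_eq_of_ne (by simpa using hj) _

variable (hW : ∀ i, r < i → Subsingleton (W i)) (hlam : HasDegree lam 1) (hφ : HasDegree φ 0)
  (hss : HasShift s 0 0) (hs : ∀ x, lin φ (s x) = x)

include hφ hss in
theorem hasShift_kerProj : HasShift (kerProj φ s) 0 0 :=
  hasShift_id.sub (hss.comp hφ.lin rfl)

include hlam hφ hss in
theorem hasShift_harmProj (hδ : HasShift δ 1 0) : HasShift (harmProj lam φ s δ) 0 0 := by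
  refine (hasShift_kerProj hφ hss).sub fun i x j hj => ?_
  exact (hδ.comp (hlam.lin.comp (hasShift_kerProj hφ hss) rfl) rfl) i x j (by omega)

include hs in
theorem lin_harmProj (hδ : ∀ x, lin φ (δ x) = 0) (x : ∀ i, W i) :
    lin φ (harmProj lam φ s δ x) = 0 := by
  rw [harmProj_apply, map_sub, hδ, lin_kerProj hs, sub_zero]

namespace IsContractionAbove

variable (h : IsContractionAbove lam φ s δ j)
include h

theorem δ_projDeg {i : ℕ} (hi : i ≤ j) (x : ∀ i, W i) : δ (projDeg i x) = 0 := h.low i hi _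

theorem δ_lin_harmProj (x : ∀ i, W i) : δ (lin lam (harmProj lam φ s δ x)) = 0 := by
  rw [harmProj_apply, map_sub, map_sub, h.δ_lin_δ, sub_self]

theorem harmProj_δ (x : ∀ i, W i) : harmProj lam φ s δ (δ x) = 0 := by
  rw [harmProj_apply, kerProj_of_lin_eq_zero (h.lin_δ x), h.δ_lin_δ, sub_self]

include hs in
theorem harmProj_harmProj (x : ∀ i, W i) :
    harmProj lam φ s δ (harmProj lam φ s δ x) = harmProj lam φ s δ x := by
  nth_rewrite 1 [harmProj_apply]
  rw [kerProj_of_lin_eq_zero (lin_harmProj hs h.lin_δ x), h.δ_lin_harmProj, sub_zero]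

omit h in
include hs in
theorem harmProj_s (x : ∀ i, V i) : harmProj lam φ s δ (s x) = 0 := by
  rw [harmProj_apply, kerProj_apply, hs, sub_self, map_zero, map_zero, sub_zero]

include hW hlam hφ hss in
theorem projDeg_harmProj (i : ℕ) (x : ∀ i, W i) :
    projDeg i (harmProj lam φ s δ x) = harmProj lam φ s δ (projDeg i x) :=
  (hasShift_harmProj hlam hφ hss h.shift_δ).projDeg_apply hW rfl x

include hW hlam hφ hss hs in
theorem projDeg_harmProj_idem (i : ℕ) (x : ∀ i, W i) :
    projDeg i (harmProj lam φ s δ (projDeg i (harmProj lam φ s δ x))) =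
      projDeg i (harmProj lam φ s δ x) := by
  rw [h.projDeg_harmProj hW hlam hφ hss i (projDeg i (harmProj lam φ s δ x)),
    projDeg_projDeg, ← h.projDeg_harmProj hW hlam hφ hss, h.harmProj_harmProj hs]

omit h in
include hW hlam hφ hss hs in
/-- Where the differential squares to zero, the harmonic part in degree `j + 1` consists of
cocycles. -/
theorem lin_projDeg_harmProj {j : ℕ} (h : IsContractionAbove lam φ s δ (j + 1))
    (hlam2 : ∀ x, lin lam (lin lam x) = 0)
    (hφlam : ∀ x, lin φ x = 0 → lin φ (lin lam x) = 0) (x : ∀ i, W i) :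
    lin lam (projDeg (j + 1) (harmProj lam φ s δ x)) = 0 := by
  have hl : projDeg (j + 2) (lin lam (harmProj lam φ s δ x)) =
      lin lam (projDeg (j + 1) (harmProj lam φ s δ x)) :=
    hlam.lin.projDeg_apply hW (by omega) _
  have h1 := h.exact (j + 2) (by omega) (lin lam (harmProj lam φ s δ x) (j + 2)) ?_ ?_ ?_
  · rw [← hl, projDeg_apply, h1, Pi.single_zero]
  · rw [← projDeg_apply, ← hφ.lin.projDeg_apply hW rfl,
      hφlam _ (lin_harmProj hs h.lin_δ x), map_zero]
  · rw [← projDeg_apply, hl, h.projDeg_harmProj hW hlam hφ hss, h.δ_lin_harmProj]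
  · rw [← projDeg_apply, hl, hlam2, map_zero]

omit h in
include hW hlam hφ hss hs in
/-- Where the differential squares to zero and the kernel of `φ_1` is exact in degree `j + 1`, the
differential maps onto the harmonic part of that degree. -/
theorem exists_projDeg_harmProj_eq {j : ℕ} (h : IsContractionAbove lam φ s δ (j + 1))
    (hlam2 : ∀ x, lin lam (lin lam x) = 0)
    (hφlam : ∀ x, lin φ x = 0 → lin φ (lin lam x) = 0)
    (hex : ∀ x : W (j + 1), lin φ (Pi.single (j + 1) x) = 0 →
      lin lam (Pi.single (j + 1) x) = 0 → ∃ k : W j, lin φ (Pi.single j k) = 0 ∧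
        lin lam (Pi.single j k) = Pi.single (j + 1) x) (y : ∀ i, W i) :
    ∃ x, projDeg (j + 1) (harmProj lam φ s δ (lin lam (kerProj φ s (projDeg j x)))) =
      projDeg (j + 1) (harmProj lam φ s δ y) := by
  obtain ⟨k, hk1, hk2⟩ := hex (harmProj lam φ s δ y (j + 1))
    (by rw [← projDeg_apply, ← hφ.lin.projDeg_apply hW rfl, lin_harmProj hs h.lin_δ,
      map_zero])
    (h.lin_projDeg_harmProj hW hlam hφ hss hs hlam2 hφlam y)
  refine ⟨Pi.single j k, ?_⟩
  rw [projDeg_single, kerProj_of_lin_eq_zero hk1, hk2, ← projDeg_apply,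
    h.projDeg_harmProj_idem hW hlam hφ hss hs]

omit h in
include hW hlam hφ hss hs in
/-- The inductive step: extending a contraction downwards by one degree. -/
theorem extend {j : ℕ} (h : IsContractionAbove lam φ s δ (j + 1))
    {S : (∀ i, W i) →ₗ[ℝ] ∀ i, W i}
    (hS : ∀ y, projDeg (j + 1) (harmProj lam φ s δ (lin lam (kerProj φ s (projDeg j (S y))))) =
      projDeg (j + 1) (harmProj lam φ s δ y)) :
    IsContractionAbove lam φ s (δ + kerProj φ s ∘ₗ projDeg j ∘ₗ S ∘ₗ projDeg (j + 1) ∘ₗ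
      harmProj lam φ s δ) j := by
  set R := harmProj lam φ s δ with hR
  set q := kerProj φ s with hq
  set d := q ∘ₗ projDeg j ∘ₗ S ∘ₗ projDeg (j + 1) ∘ₗ R with hd
  have hda : ∀ x, d x = q (projDeg j (S (projDeg (j + 1) (R x)))) := fun x => rfl
  have hRp := h.projDeg_harmProj hW hlam hφ hss
  have hqp : ∀ i x, projDeg i (q x) = q (projDeg i x) := fun i x =>
    (hasShift_kerProj hφ hss).projDeg_apply hW rfl x
  have hd0 : ∀ x, R (projDeg (j + 1) x) = 0 → d x = 0 := fun x hx => by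
    rw [hda, hRp, hx, map_zero, map_zero, map_zero]
  have hdne : ∀ i, i ≠ j + 1 → ∀ x, d (projDeg i x) = 0 := fun i hi x => hd0 _ (by
    rw [projDeg_projDeg_of_ne hi.symm, map_zero])
  have hdj : ∀ x, d x = projDeg j (d x) := fun x => by
    rw [hda, hqp, projDeg_projDeg]
  have hlp : ∀ i x, projDeg (i + 1) (lin lam x) = lin lam (projDeg i x) := fun i x =>
    hlam.lin.projDeg_apply hW (by omega) x
  have hδp : ∀ i x, projDeg i (δ x) = δ (projDeg (i + 1) x) := fun i x =>
    h.shift_δ.projDeg_apply hW (by omega) x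
  have hδd : ∀ x, δ (d x) = 0 := fun x => by rw [hdj, h.δ_projDeg (by omega)]
  have hdδ : ∀ x, d (δ x) = 0 := fun x => by rw [hda, h.harmProj_δ]; simp only [map_zero]
  have hdd : ∀ x, d (d x) = 0 := fun x => by rw [hdj x, hdne j (by omega)]
  have hpld : ∀ x, projDeg (j + 1) (R (lin lam (d x))) = projDeg (j + 1) (R x) := fun x => by
    rw [hda, hS, h.projDeg_harmProj_idem hW hlam hφ hss hs]
  have hdld : ∀ x, d (lin lam (d x)) = d x := fun x => by
    rw [hda (lin lam (d x)), hpld, ← hda]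
  have hδld : ∀ x, δ (lin lam (d x)) = 0 := fun x => by
    rw [hdj, ← hlp, h.δ_projDeg le_rfl]
  have hdlδ : ∀ x, d (lin lam (δ x)) = 0 := fun x => hd0 _ (by
    rw [hlp, hδp, h.δ_projDeg le_rfl, map_zero, map_zero])
  exact
  { shift_δ := by
      intro i x l hl
      rw [LinearMap.add_apply, Pi.add_apply, h.shift_δ i x l hl, zero_add]
      by_cases hi : i = j + 1
      · rw [hdj, projDeg_apply]
        exact Pi.single_eq_of_ne (by omega) _
      · rw [← projDeg_single, hdne i hi]; rfl
    low := by
      intro i hi x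
      rw [LinearMap.add_apply, h.low i (by omega), zero_add, ← projDeg_single,
        hdne i (by omega)]
    lin_δ := by
      intro x
      rw [LinearMap.add_apply, map_add, h.lin_δ, zero_add, hda, lin_kerProj hs]
    δ_δ := by
      intro x
      simp only [LinearMap.add_apply, map_add, h.δ_δ, hδd, hdδ, hdd, add_zero]
    δ_s := by
      intro x
      rw [LinearMap.add_apply, h.δ_s, zero_add, hda, harmProj_s hs]
      simp only [map_zero]
    δ_lin_δ := by
      intro x
      simp only [LinearMap.add_apply, map_add, h.δ_lin_δ, hδld, hdlδ, hdld, add_zero, zero_add]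
    exact := by
      intro i hi x h1 h2 h3
      have hdl : d (lin lam (Pi.single i x)) = 0 := by
        rw [← projDeg_single, ← hlp, hdne _ (by omega)]
      rw [LinearMap.add_apply, hdl, add_zero] at h3
      by_cases hij : i = j + 1
      · subst hij
        rw [LinearMap.add_apply, h.low _ le_rfl, zero_add] at h2
        have h4 := hpld (Pi.single (j + 1) x)
        rw [h2, map_zero, map_zero, map_zero, hR, harmProj_apply, kerProj_of_lin_eq_zero h1, h3,
          sub_zero, projDeg_single] at h4
        exact Pi.single_eq_zero_iff.1 h4.symm
      · have h4 : d (Pi.single i x) = 0 := by rw [← projDeg_single, hdne i hij]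
        rw [LinearMap.add_apply, h4, add_zero] at h2
        exact h.exact i (by omega) x h1 h2 h3 }

end IsContractionAbove

end PartialContraction

/-! ### Smooth families of contractions -/

section Families

variable {m : ℕ} {M : Type*} [TopologicalSpace M] [T2Space M] [SecondCountableTopology M]
  [ChartedSpace (EuclideanSpace ℝ (Fin m)) M] [IsManifold (𝓡 m) ∞ M]
  {E E' : GradedBundle m M}
  {lam : ∀ P, Ops (fun i => E.L i P) (fun i => E.L i P)}
  {φ : ∀ P, Ops (fun i => E.L i P) (fun i => E'.L i P)}

omit [T2Space M] [SecondCountableTopology M] [IsManifold (𝓡 m) ∞ M] in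
theorem SmoothLinAt.kerProj {P : M} {s : LinFamily E' E} (hφ : SmoothOps E E' id φ)
    (hs : SmoothLinAt E' E s P) : SmoothLinAt E E (fun Q => LInfty.kerProj (φ Q) (s Q)) P :=
  smoothLinAt_id.sub (hs.comp (hφ.smoothLinAt_lin P))

omit [T2Space M] [SecondCountableTopology M] [IsManifold (𝓡 m) ∞ M] in
theorem SmoothLinAt.harmProj {P : M} {s : LinFamily E' E} {δ : LinFamily E E}
    (hlam : SmoothOps E E id lam) (hφ : SmoothOps E E' id φ)
    (hs : SmoothLinAt E' E s P) (hδ : SmoothLinAt E E δ P) :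
    SmoothLinAt E E (fun Q => LInfty.harmProj (lam Q) (φ Q) (s Q) (δ Q)) P :=
  (hs.kerProj hφ).sub (hδ.comp ((hlam.smoothLinAt_lin P).comp (hs.kerProj hφ)))

/-- A smooth family of surjective operations has a smooth linear splitting. -/
theorem exists_smooth_splitting (hφ : SmoothOps E E' id φ) (hφd : ∀ P, HasDegree (φ P) 0)
    (hsurj : ∀ P y, ∃ x, lin (φ P) x = y) :
    ∃ s : LinFamily E' E, ∀ P, SmoothLinAt E' E s P ∧ HasShift (s P) 0 0 ∧
      ∀ x, lin (φ P) (s P x) = x := by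
  obtain ⟨W, s, -, hW, -, hs⟩ := exists_rightInverse (E := E) (E' := E') (A := fun P => lin (φ P))
    (p := fun _ => LinearMap.id) (Z := Set.univ) isOpen_univ subset_rfl
    (fun Q _ => hφ.smoothLinAt_lin Q) (fun Q _ => smoothLinAt_id) (fun _ _ _ => rfl)
    (fun P _ y => hsurj P y)
  let r := max E.top E'.top
  refine ⟨fun P => ∑ i ∈ Finset.range (r + 1), projDeg i ∘ₗ s P ∘ₗ projDeg i, fun P => ?_⟩
  obtain ⟨h1, h2⟩ := hs P (hW (Set.mem_univ P))
  refine ⟨smoothLinAt_sum _ fun i _ => (smoothLinAt_projDeg i).comp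
    (h1.comp (smoothLinAt_projDeg i)), fun i x j hj => ?_, fun x => ?_⟩
  · rw [LinearMap.sum_apply, Finset.sum_apply]
    refine Finset.sum_eq_zero fun l _ => ?_
    rw [LinearMap.comp_apply, LinearMap.comp_apply]
    by_cases hl : l = i
    · rw [projDeg_apply l (s P _)]
      exact Pi.single_eq_of_ne (by omega) _
    · rw [projDeg_single_of_ne hl, map_zero, map_zero]; rfl
  · rw [LinearMap.sum_apply, map_sum]
    refine Eq.trans (Finset.sum_congr rfl fun i _ => ?_)
      (sum_projDeg (E'.isBounded (le_max_right E.top E'.top) P).high x)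
    change lin (φ P) (projDeg i (s P (projDeg i x))) = projDeg i x
    rw [← (hφd P).lin.projDeg_apply (E.isBounded le_rfl P).high rfl]
    refine (congrArg (projDeg i) (h2 _)).trans (projDeg_projDeg i x)

/-- If the kernel of `φ_1` is exact in degrees above `j` at the points of `Z`, then it has a smooth
contraction in these degrees near `Z`.  The induction on `t` descends from the top degree. -/
theorem exists_contractionAbove (hlam : SmoothOps E E id lam) (hφ : SmoothOps E E' id φ)
    (hlamd : ∀ P, HasDegree (lam P) 1) (hφd : ∀ P, HasDegree (φ P) 0)
    {s : LinFamily E' E} (hs : ∀ P, SmoothLinAt E' E s P) (hss : ∀ P, HasShift (s P) 0 0)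
    (hsφ : ∀ P x, lin (φ P) (s P x) = x) {Z : Set M}
    (hlam2 : ∀ P ∈ Z, ∀ x, lin (lam P) (lin (lam P) x) = 0)
    (hφlam : ∀ P ∈ Z, ∀ x, lin (φ P) x = 0 → lin (φ P) (lin (lam P) x) = 0)
    (hex : ∀ P ∈ Z, ∀ j, 1 ≤ j → ∀ x : E.L (j + 1) P, lin (φ P) (Pi.single (j + 1) x) = 0 →
      lin (lam P) (Pi.single (j + 1) x) = 0 → ∃ k : E.L j P, lin (φ P) (Pi.single j k) = 0 ∧
        lin (lam P) (Pi.single j k) = Pi.single (j + 1) x) (t : ℕ) :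
    ∀ j, 1 ≤ j → E.top ≤ j + t → ∃ (W : Set M) (δ : LinFamily E E), IsOpen W ∧ Z ⊆ W ∧
      ∀ Q ∈ W, SmoothLinAt E E δ Q ∧ IsContractionAbove (lam Q) (φ Q) (s Q) (δ Q) j := by
  induction t with
  | zero =>
    intro j _ hj
    refine ⟨Set.univ, fun _ => 0, isOpen_univ, Set.subset_univ Z, fun Q _ =>
      ⟨smoothLinAt_zero, ⟨fun _ _ _ _ => rfl, fun _ _ _ => rfl, fun _ => map_zero _, fun _ => rfl,
        fun _ => rfl, fun _ => rfl, fun i hi x _ _ _ => ?_⟩⟩⟩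
    have := (E.isBounded le_rfl Q).high i (by omega)
    exact Subsingleton.elim _ _
  | succ t ih =>
    intro j hj1 hj
    obtain ⟨W, δ, hWo, hZW, hδ⟩ := ih (j + 1) (by omega) (by omega)
    have hb := fun P => (E.isBounded le_rfl P).high
    obtain ⟨W', S, hWo', hZW', hWW, hS⟩ := exists_rightInverse (E := E) (E' := E)
      (A := fun P => lin (lam P) ∘ₗ LInfty.kerProj (φ P) (s P) ∘ₗ projDeg j)
      (p := fun P => projDeg (j + 1) ∘ₗ LInfty.harmProj (lam P) (φ P) (s P) (δ P)) hWo hZW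
      (fun Q _ => (hlam.smoothLinAt_lin Q).comp (((hs Q).kerProj hφ).comp
        (smoothLinAt_projDeg j)))
      (fun Q hQ => (smoothLinAt_projDeg (j + 1)).comp ((hs Q).harmProj hlam hφ (hδ Q hQ).1))
      (fun Q hQ x => (hδ Q hQ).2.projDeg_harmProj_idem (hb Q) (hlamd Q) (hφd Q) (hss Q) (hsφ Q)
        (j + 1) x)
      (fun P hP y => (hδ P (hZW hP)).2.exists_projDeg_harmProj_eq (hb P) (hlamd P) (hφd P)
        (hss P) (hsφ P) (hlam2 P hP) (hφlam P hP) (hex P hP j hj1) y)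
    refine ⟨W', fun Q => δ Q + LInfty.kerProj (φ Q) (s Q) ∘ₗ projDeg j ∘ₗ S Q ∘ₗ projDeg (j + 1) ∘ₗ
      LInfty.harmProj (lam Q) (φ Q) (s Q) (δ Q), hWo', hZW', fun Q hQ => ⟨?_, ?_⟩⟩
    · have h1 := hδ Q (hWW hQ)
      exact h1.1.add (((hs Q).kerProj hφ).comp ((smoothLinAt_projDeg j).comp ((hS Q hQ).1.comp
        ((smoothLinAt_projDeg (j + 1)).comp ((hs Q).harmProj hlam hφ h1.1)))))
    · exact (hδ Q (hWW hQ)).2.extend (hb Q) (hlamd Q) (hφd Q) (hss Q) (hsφ Q) (hS Q hQ).2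

end Families

end LInfty

namespace LInfty

/-! ### The tangent complex at a classical point -/

section LowArity

variable {V W X : ℕ → Type*} [∀ i, AddCommGroup (V i)] [∀ i, Module ℝ (V i)]
  [∀ i, AddCommGroup (W i)] [∀ i, Module ℝ (W i)] [∀ i, AddCommGroup (X i)] [∀ i, Module ℝ (X i)]

theorem circ_fin_one (φ : Ops V W) (μ : Ops V V) (hμ : μ 0 Fin.elim0 = 0) (d : Fin 1 → ℕ)
    (v : ∀ a, V (d a)) : circ φ μ d v = lin φ (lin μ (homog d v 0)) := by
  rw [circ_eq_sum, Finset.sum_eq_single (fun _ => 0)]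
  · have h2 : ∀ (n : ℕ) (hn : n = 0) (y : Fin n → ∀ i, V i) (z : ∀ i, V i),
        φ (n + 1) (Fin.cons z y) = lin φ z := by
      rintro n rfl y z
      rw [lin_apply]
      congr 1
      funext i
      exact Fin.cases rfl (fun j => j.elim0) i
    have h3 : block (fun _ : Fin 1 => (0 : Fin 2)) 0 = Finset.univ := by simp [block]
    rw [h2 _ (by simp [block]), koszulSign_const _ 0 (fun _ => rfl), one_smul, h3, opAt_univ]
    rw [lin_apply μ]
    congr 2
    funext i
    rw [Subsingleton.elim i 0]
  · intro p _ hp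
    have hp0 : p 0 = 1 := by
      by_contra h
      refine hp (funext fun a => ?_)
      rw [Subsingleton.elim a 0]
      have := (p 0).isLt
      have h1 : (p 0 : ℕ) ≠ 1 := fun h' => h (Fin.ext h')
      exact Fin.ext (by simp; omega)
    have h0 : block p 0 = ∅ := by
      refine Finset.filter_eq_empty_iff.2 fun a _ => ?_
      rw [Subsingleton.elim a 0, hp0]
      exact one_ne_zero
    have h3 : opAt μ (homog d v) (block p 0) = 0 := by
      rw [h0, opAt_eq μ _ ∅ (k := 0) rfl (e := Fin.elim0) (fun i => i.elim0) (fun i => i.elim0),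
        Subsingleton.elim (fun i : Fin 0 => homog d v (Fin.elim0 i)) Fin.elim0, hμ]
    rw [(φ _).map_coord_zero 0 (by rw [Fin.cons_zero, h3]), smul_zero]
  · simp

theorem bullet_fin_one (ψ : Ops W X) (φ : Ops V W) (d : Fin 1 → ℕ) (v : ∀ a, V (d a)) :
    bullet ψ φ d v = lin ψ (lin φ (homog d v 0)) := by
  rw [bullet_eq_blockOp, Finset.sum_range_succ, Finset.sum_range_succ, Finset.sum_range_zero,
    zero_add]
  have h0 : IsEmpty (Fin 1 → Fin 0) := ⟨fun p => (p 0).elim0⟩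
  rw [Finset.univ_eq_empty (α := Fin 1 → Fin 0), Finset.sum_empty, smul_zero, zero_add,
    Finset.sum_eq_single (fun _ => 0)]
  · have h3 : block (fun _ : Fin 1 => (0 : Fin 1)) 0 = Finset.univ := by simp [block]
    rw [koszulSign_const _ 0 (fun _ => rfl), one_smul, blockOp_apply, Nat.factorial_one,
      Nat.cast_one, inv_one, one_smul, lin_apply]
    congr 1
    funext c
    rw [Subsingleton.elim c 0, h3, opAt_univ, lin_apply φ]
    congr 1
    funext i
    rw [Subsingleton.elim i 0]
  · intro p _ hp
    exact absurd (Subsingleton.elim _ _) hp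
  · simp

/-- Linear maps of total spaces agree if they agree on homogeneous elements. -/
theorem lin_ext {r : ℕ} (hV : ∀ i, r < i → Subsingleton (V i))
    {T T' : (∀ i, V i) →ₗ[ℝ] ∀ i, W i} (h : ∀ i x, T (Pi.single i x) = T' (Pi.single i x))
    (x : ∀ i, V i) : T x = T' x := by
  rw [← sum_projDeg hV x, map_sum, map_sum]
  exact Finset.sum_congr rfl fun i _ => h i (x i)

theorem IsCurvedLInfty.lin_lin {lam : Ops V V} {r : ℕ} (hV : ∀ i, r < i → Subsingleton (V i))
    (hlam : IsCurvedLInfty lam) (h0 : lam 0 Fin.elim0 = 0) (x : ∀ i, V i) :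
    lin lam (lin lam x) = 0 :=
  lin_ext hV (T := lin lam ∘ₗ lin lam) (T' := 0) (fun i x =>
    (circ_fin_one lam lam h0 (fun _ => i) fun _ => x).symm.trans (hlam.jacobi 1 _ _)) x

theorem IsCurvedLInfty.lin_curvature {lam : Ops V V} (hlam : IsCurvedLInfty lam) :
    lin lam (lam 0 Fin.elim0) = 0 := by
  rw [← circ_fin_zero lam lam Fin.elim0 (fun a => a.elim0), hlam.jacobi]

theorem IsLInftyMorphism.lin_curvature {lam : Ops V V} {lam' : Ops W W} {φ : Ops V W}
    (hφ : IsLInftyMorphism lam lam' φ) : lin φ (lam 0 Fin.elim0) = lam' 0 Fin.elim0 := by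
  rw [← circ_fin_zero φ lam Fin.elim0 (fun a => a.elim0), hφ.compat, bullet_fin_zero]

theorem IsLInftyMorphism.lin_lin {lam : Ops V V} {lam' : Ops W W} {φ : Ops V W} {r : ℕ}
    (hV : ∀ i, r < i → Subsingleton (V i)) (hφ : IsLInftyMorphism lam lam' φ)
    (h0 : lam 0 Fin.elim0 = 0) (x : ∀ i, V i) : lin φ (lin lam x) = lin lam' (lin φ x) :=
  lin_ext hV (T := lin φ ∘ₗ lin lam) (T' := lin lam' ∘ₗ lin φ) (fun i x =>
    (circ_fin_one φ lam h0 (fun _ => i) fun _ => x).symm.trans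
      ((hφ.compat 1 _ _).trans (bullet_fin_one lam' φ _ _))) x

theorem lin_single {φ : Ops V W} {q : ℕ} (hφ : HasDegree φ q) (i : ℕ) (x : V i) :
    lin φ (Pi.single i x) = Pi.single (i + q) (linearPart φ i (i + q) x) := by
  funext j
  by_cases hj : j = i + q
  · subst hj; rw [Pi.single_eq_same]; rfl
  · rw [Pi.single_eq_of_ne hj, hφ.lin i x j (by omega)]

end LowArity

/-- For a surjective quasi-isomorphism of complexes, the kernel is exact. -/
theorem exists_of_bijectiveOnCohomology {A B C A' B' C' F : Type*}
    [AddCommGroup A] [Module ℝ A] [AddCommGroup B] [Module ℝ B] [AddCommGroup C] [Module ℝ C]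
    [AddCommGroup A'] [Module ℝ A'] [AddCommGroup B'] [Module ℝ B']
    [AddCommGroup C'] [Module ℝ C'] [AddCommGroup F] [Module ℝ F]
    {dA : A →ₗ[ℝ] B} {dB : B →ₗ[ℝ] C} {dA' : A' →ₗ[ℝ] B'} {dB' : B' →ₗ[ℝ] C'}
    {dC : C →ₗ[ℝ] F} {fA : A →ₗ[ℝ] A'} {fB : B →ₗ[ℝ] B'} {fC : C →ₗ[ℝ] C'}
    (hA : ∀ x, fB (dA x) = dA' (fA x)) (hB : ∀ x, fC (dB x) = dB' (fB x))
    (hd : ∀ x, dB (dA x) = 0) (hfA : Function.Surjective fA)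
    (hcB : ∀ y, dB' y = 0 → ∃ x, dB x = 0 ∧ y - fB x ∈ LinearMap.range dA')
    (hcC : ∀ z, dC z = 0 → fC z ∈ LinearMap.range dB' → z ∈ LinearMap.range dB)
    {z : C} (hz : dC z = 0) (hfz : fC z = 0) : ∃ k, fB k = 0 ∧ dB k = z := by
  obtain ⟨w, rfl⟩ := hcC z hz (hfz ▸ Submodule.zero_mem _)
  obtain ⟨w', hw', u', hu'⟩ := hcB (fB w) (by rw [← hB, hfz])
  obtain ⟨u, rfl⟩ := hfA u'
  refine ⟨w - w' - dA u, ?_, ?_⟩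
  · rw [map_sub, map_sub, hA, hu', sub_self]
  · rw [map_sub, map_sub, hw', hd, sub_zero, sub_zero]

section Derivative

variable {m n : ℕ} {M : Type*} [TopologicalSpace M] [ChartedSpace (EuclideanSpace ℝ (Fin m)) M]
  {N : Type*} [TopologicalSpace N] [ChartedSpace (EuclideanSpace ℝ (Fin n)) N]
  {E E' : GradedBundle m M} {P : M}

/-- The derivative of a real function as a linear form with values in `ℝ`. -/
noncomputable def realDeriv (g : M → ℝ) (P : M) : TangentSpace (𝓡 m) P →ₗ[ℝ] ℝ :=
  (mfderiv (𝓡 m) 𝓘(ℝ, ℝ) g P).toLinearMap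

theorem HasMFDerivAt.realDeriv_eq {g : M → ℝ} {g' : TangentSpace (𝓡 m) P →L[ℝ] ℝ}
    (h : HasMFDerivAt (𝓡 m) 𝓘(ℝ, ℝ) g P g') (v : TangentSpace (𝓡 m) P) :
    realDeriv g P v = g' v := by
  rw [realDeriv, h.mfderiv]; rfl

theorem realDeriv_congr {g g' : M → ℝ} (h : g =ᶠ[nhds P] g') :
    realDeriv (m := m) g P = realDeriv g' P := by
  rw [realDeriv, h.mfderiv_eq]
  rfl

theorem realDeriv_sum_mul {ι : Type} [Fintype ι] {a b : ι → M → ℝ}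
    (ha : ∀ t, MDifferentiableAt (𝓡 m) 𝓘(ℝ, ℝ) (a t) P)
    (hb : ∀ t, MDifferentiableAt (𝓡 m) 𝓘(ℝ, ℝ) (b t) P) (h0 : ∀ t, b t P = 0)
    (v : TangentSpace (𝓡 m) P) :
    realDeriv (fun Q => ∑ t, a t Q * b t Q) P v = ∑ t, a t P * realDeriv (b t) P v := by
  let da : ι → TangentSpace (𝓡 m) P →L[ℝ] ℝ := fun t => mfderiv (𝓡 m) 𝓘(ℝ, ℝ) (a t) P
  let db : ι → TangentSpace (𝓡 m) P →L[ℝ] ℝ := fun t => mfderiv (𝓡 m) 𝓘(ℝ, ℝ) (b t) P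
  have h2 : ∀ t, HasMFDerivAt (𝓡 m) 𝓘(ℝ, ℝ) (a t * b t) P (a t P • db t + b t P • da t) :=
    fun t => (ha t).hasMFDerivAt.mul (hb t).hasMFDerivAt
  have h3 := HasMFDerivAt.sum (t := Finset.univ) fun t _ => h2 t
  have h4 : (fun Q => ∑ t, a t Q * b t Q) = ∑ t, a t * b t := by
    funext Q; simp
  rw [h4, HasMFDerivAt.realDeriv_eq h3, sum_apply]
  refine Finset.sum_congr rfl fun t _ => ?_
  rw [h0 t, zero_smul, add_zero]
  rfl

/-- The derivative at `P` of a section of a graded bundle with `s P = 0`, computed in the local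
frame at `P`. -/
noncomputable def GradedBundle.derivAt (E : GradedBundle m M) (P : M) (s : ∀ Q, ∀ i, E.L i Q) :
    TangentSpace (𝓡 m) P →ₗ[ℝ] ∀ i, E.L i P :=
  ∑ r, (realDeriv (fun Q => E.coord P r Q (s Q)) P).smulRight (E.frame P r P)

theorem GradedBundle.coord_derivAt (s : ∀ Q, ∀ i, E.L i Q) (r : E.FrameIndex)
    (v : TangentSpace (𝓡 m) P) : E.coord P r P (E.derivAt P s v) =
      realDeriv (fun Q => E.coord P r Q (s Q)) P v := by
  classical
  rw [derivAt, LinearMap.sum_apply, map_sum, Finset.sum_eq_single r]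
  · rw [LinearMap.smulRight_apply, map_smul, coord_frame (E.mem_frameDomain_self P), if_pos rfl,
      smul_eq_mul, mul_one]
  · intro q _ hq
    rw [LinearMap.smulRight_apply, map_smul, coord_frame (E.mem_frameDomain_self P),
      if_neg hq.symm, smul_zero]
  · simp

theorem GradedBundle.SmoothAt.mdifferentiableAt_coord {s : ∀ Q, ∀ i, E.L i Q}
    (hs : E.SmoothAt s P) (r : E.FrameIndex) :
    MDifferentiableAt (𝓡 m) 𝓘(ℝ, ℝ) (fun Q => E.coord P r Q (s Q)) P :=
  ((smoothAt_iff (E.mem_frameDomain_self P) s).1 hs r).mdifferentiableAt (by simp)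

/-- At a zero of the section, the derivative commutes with smooth families of linear maps. -/
theorem SmoothLinAt.derivAt {T : LinFamily E E'} (hT : SmoothLinAt E E' T P)
    {s : ∀ Q, ∀ i, E.L i Q} (hs : E.SmoothAt s P) (h0 : s P = 0) (v : TangentSpace (𝓡 m) P) :
    E'.derivAt P (fun Q => T Q (s Q)) v = T P (E.derivAt P s v) := by
  have hE := E.mem_frameDomain_self P
  have hE' := E'.mem_frameDomain_self P
  refine GradedBundle.ext_coord hE' fun r => ?_
  rw [GradedBundle.coord_derivAt, coord_eq_matOf T hE]
  have h1 : (fun Q => E'.coord P r Q (T Q (s Q))) =ᶠ[nhds P]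
      fun Q => ∑ q, matOf P T Q r q * E.coord P q Q (s Q) := by
    filter_upwards [E.frameDomain_mem_nhds P] with Q hQ
    exact coord_eq_matOf T hQ r (s Q)
  rw [realDeriv_congr h1]
  simp only [GradedBundle.coord_derivAt]
  exact realDeriv_sum_mul
    (fun q => ((smoothLinAt_iff hE hE').1 hT r q).mdifferentiableAt (n := ∞) (by simp))
    (fun q => hs.mdifferentiableAt_coord q) (fun q => by rw [h0, map_zero]) v

/-- The components of the derivative in terms of the preferred trivializations. -/
theorem GradedBundle.derivAt_apply {s : ∀ Q, ∀ i, E.L i Q} (hs : E.SmoothAt s P)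
    (v : TangentSpace (𝓡 m) P) (i : ℕ) :
    E.derivAt P s v i = (E.triv P i).symmₗ ℝ P (mfderiv (𝓡 m) 𝓘(ℝ, E.Model i)
      (fun Q => (E.triv P i (Bundle.TotalSpace.mk' (E.Model i) Q (s Q i))).2) P v) := by
  by_cases hi : i < E.top + 1
  · obtain ⟨i, rfl⟩ : ∃ i' : Fin (E.top + 1), (i' : ℕ) = i := ⟨⟨i, hi⟩, rfl⟩
    have hP := mem_baseSet_of_mem_frameDomain (E.mem_frameDomain_self P) i
    refine ((E.triv P i).symmₗ_linearMapAt (R := ℝ) hP (E.derivAt P s v i)).symm.trans ?_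
    congr 1
    ext x
    change E.coord P ⟨i, x⟩ P (E.derivAt P s v) = _
    rw [coord_derivAt]
    have h1 : MDifferentiableAt (𝓡 m) 𝓘(ℝ, E.Model i)
        (fun Q => (E.triv P i (Bundle.TotalSpace.mk' (E.Model i) Q (s Q i))).2) P :=
      (((E.triv P i).contMDiffAt_section_iff hP).1 (hs i)).mdifferentiableAt (by simp)
    have h2 : (fun Q => E.coord P ⟨i, x⟩ Q (s Q)) =ᶠ[nhds P]
        (EuclideanSpace.proj x : E.Model i →L[ℝ] ℝ) ∘
        fun Q => (E.triv P i (Bundle.TotalSpace.mk' (E.Model i) Q (s Q i))).2 := by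
      filter_upwards [E.frameDomain_mem_nhds P] with Q hQ
      exact coord_apply hQ ⟨i, x⟩ (s Q)
    rw [realDeriv_congr h2]
    exact HasMFDerivAt.realDeriv_eq
      ((EuclideanSpace.proj x : E.Model i →L[ℝ] ℝ).hasMFDerivAt.comp P h1.hasMFDerivAt) v
  · have := E.subsingleton_fiber (E.rank_eq_zero (by omega : E.top < i)) P
    exact Subsingleton.elim _ _

end Derivative

end LInfty

namespace LInfty

/-! ### Consequences of étaleness -/

section Etale

variable {m n : ℕ} {M : Type*} [TopologicalSpace M] [ChartedSpace (EuclideanSpace ℝ (Fin m)) M]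
  {N : Type*} [TopologicalSpace N] [ChartedSpace (EuclideanSpace ℝ (Fin n)) N]
  {𝓜 : LInftyBundle m M} {𝓝 : LInftyBundle n N}

namespace LInftyBundle

/-- The curvature as a section of the total bundle. -/
noncomputable def curv (𝓜 : LInftyBundle m M) (P : M) : ∀ i, 𝓜.L i P := 𝓜.op P 0 Fin.elim0

theorem curv_eq (𝓜 : LInftyBundle m M) (P : M) : 𝓜.curv P = Pi.single 1 (𝓜.curvature P) := by
  rw [curv, (𝓜.isCurvedLInfty P).degree.curvature, curvature,
    Subsingleton.elim (fun a : Fin 0 => a.elim0) (Fin.elim0 : Fin 0 → ∀ i, 𝓜.L i P)]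

theorem curv_eq_zero_iff {P : M} : 𝓜.curv P = 0 ↔ P ∈ 𝓜.classicalLocus := by
  rw [curv_eq, Pi.single_eq_zero_iff]; rfl

theorem smoothAt_curv (𝓜 : LInftyBundle m M) (P : M) : 𝓜.toGradedBundle.SmoothAt 𝓜.curv P := by
  have h := 𝓜.smoothOps 0 Fin.elim0 P fun a => a.elim0
  refine GradedBundle.SmoothAlongAt.congr h (Filter.Eventually.of_forall fun Q => ?_)
  exact congrArg (𝓜.op Q 0) (Subsingleton.elim _ _)

theorem derivAt_curv (𝓜 : LInftyBundle m M) (P : M) (v : TangentSpace (𝓡 m) P) :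
    𝓜.toGradedBundle.derivAt P 𝓜.curv v = Pi.single 1 (𝓜.curvatureDeriv P v) := by
  funext i
  rw [GradedBundle.derivAt_apply (𝓜.smoothAt_curv P)]
  by_cases hi : i = 1
  · subst hi
    rw [Pi.single_eq_same]
    rfl
  · rw [Pi.single_eq_of_ne hi]
    have h1 : (fun Q => (𝓜.triv P i (Bundle.TotalSpace.mk' (𝓜.Model i) Q (𝓜.curv Q i))).2)
        =ᶠ[nhds P] fun _ => 0 := by
      filter_upwards [(𝓜.triv P i).open_baseSet.mem_nhds
        (FiberBundle.mem_baseSet_trivializationAt (𝓜.Model i) (𝓜.L i) P)] with Q hQ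
      rw [curv_eq, Pi.single_eq_of_ne hi]
      exact (congrFun (Bundle.Trivialization.coe_linearMapAt_of_mem (R := ℝ) (𝓜.triv P i) hQ)
        0).symm.trans (map_zero _)
    rw [h1.mfderiv_eq, mfderiv_const]
    exact map_zero ((𝓜.triv P i).symmₗ ℝ P)

end LInftyBundle

namespace LInftyBundle.Hom

variable (Φ : Hom 𝓜 𝓝)

/-- The pullback to `M` of the graded bundle of the target. -/
noncomputable abbrev target : GradedBundle m M := 𝓝.toGradedBundle.pullback Φ.base

/-- The operations of a morphism as a family over the source. -/
abbrev opFamily (P : M) : Ops (fun i => 𝓜.L i P) (fun i => Φ.target.L i P) := Φ.op P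

theorem smoothOps_opFamily : SmoothOps 𝓜.toGradedBundle Φ.target id Φ.opFamily :=
  fun k s P hs => (𝓝.toGradedBundle.smoothAt_pullback_iff Φ.base _ P).2 (Φ.smoothOps k s P hs)

theorem lin_curv (P : M) : lin (Φ.opFamily P) (𝓜.curv P) = 𝓝.curv (Φ.base P) :=
  (Φ.isMorphism P).lin_curvature

theorem derivAt_target_curv {P : M} (v : TangentSpace (𝓡 m) P) :
    Φ.target.derivAt P (fun Q => 𝓝.curv (Φ.base Q)) v =
      𝓝.toGradedBundle.derivAt (Φ.base P) 𝓝.curv (mfderiv (𝓡 m) (𝓡 n) Φ.base P v) := by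
  have hs : Φ.target.SmoothAt (fun Q => 𝓝.curv (Φ.base Q)) P :=
    (𝓝.toGradedBundle.smoothAt_pullback_iff Φ.base _ P).2
      ((𝓝.smoothAt_curv _).along Φ.base.contMDiff.contMDiffAt)
  funext i
  rw [GradedBundle.derivAt_apply hs, GradedBundle.derivAt_apply (𝓝.smoothAt_curv _)]
  have h1 : MDifferentiableAt (𝓡 n) 𝓘(ℝ, 𝓝.Model i) (fun Q => (𝓝.triv (Φ.base P) i
      (Bundle.TotalSpace.mk' (𝓝.Model i) Q (𝓝.curv Q i))).2) (Φ.base P) :=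
    (((𝓝.triv (Φ.base P) i).contMDiffAt_section_iff
      (FiberBundle.mem_baseSet_trivializationAt (𝓝.Model i) (𝓝.L i) _)).1
      (𝓝.smoothAt_curv (Φ.base P) i)).mdifferentiableAt (by simp)
  have h2 : MDifferentiableAt (𝓡 m) (𝓡 n) Φ.base P :=
    Φ.base.contMDiff.contMDiffAt.mdifferentiableAt (by simp)
  have h3 := mfderiv_comp P h1 h2
  have hb := FiberBundle.mem_baseSet_trivializationAt (𝓝.Model i) (𝓝.L i) (Φ.base P)
  have hb' := FiberBundle.mem_baseSet_trivializationAt (Φ.target.Model i) (Φ.target.L i) P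
  set u := mfderiv (𝓡 n) 𝓘(ℝ, 𝓝.Model i) (fun Q => (𝓝.triv (Φ.base P) i
      (Bundle.TotalSpace.mk' (𝓝.Model i) Q (𝓝.curv Q i))).2) (Φ.base P)
      (mfderiv (𝓡 m) (𝓡 n) Φ.base P v) with hu
  -- the trivialization of the pullback has the same fibre coordinate
  have h4 : (Φ.target.triv P i).linearMapAt ℝ P ((𝓝.triv (Φ.base P) i).symmₗ ℝ (Φ.base P) u) = u := by
    refine (congrFun (Bundle.Trivialization.coe_linearMapAt_of_mem (R := ℝ) _ hb') _).trans ?_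
    refine (congrFun (Bundle.Trivialization.coe_linearMapAt_of_mem (R := ℝ)
      (𝓝.triv (Φ.base P) i) hb) _).symm.trans ?_
    exact (𝓝.triv (Φ.base P) i).linearMapAt_symmₗ (R := ℝ) hb u
  refine Eq.trans (congrArg ((Φ.target.triv P i).symmₗ ℝ P) ?_)
    ((Φ.target.triv P i).symmₗ_linearMapAt (R := ℝ) hb' _)
  exact (DFunLike.congr_fun h3 v).trans h4.symm

theorem lin_curvatureDeriv {P : M} (hP : P ∈ 𝓜.classicalLocus) (v : TangentSpace (𝓡 m) P) :
    lin (𝓜.op P) (Pi.single 1 (𝓜.curvatureDeriv P v)) = 0 := by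
  rw [← 𝓜.derivAt_curv]
  refine ((𝓜.smoothOps.smoothLinAt_lin P).derivAt (𝓜.smoothAt_curv P)
    (curv_eq_zero_iff.2 hP) v).symm.trans ?_
  have h : (fun Q => lin (𝓜.op Q) (𝓜.curv Q)) = fun _ => 0 :=
    funext fun Q => (𝓜.isCurvedLInfty Q).lin_curvature
  rw [h]
  refine GradedBundle.ext_coord (𝓜.mem_frameDomain_self P) fun r => ?_
  rw [GradedBundle.coord_derivAt, map_zero, realDeriv_congr (g' := fun _ => 0)
    (Filter.Eventually.of_forall fun Q => map_zero _)]
  exact HasMFDerivAt.realDeriv_eq (hasMFDerivAt_const (0 : ℝ) P) v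

theorem linear_curvatureDeriv {P : M} (hP : P ∈ 𝓜.classicalLocus) (v : TangentSpace (𝓡 m) P) :
    lin (Φ.op P) (Pi.single 1 (𝓜.curvatureDeriv P v)) =
      Pi.single 1 (𝓝.curvatureDeriv (Φ.base P) (mfderiv (𝓡 m) (𝓡 n) Φ.base P v)) := by
  rw [← 𝓜.derivAt_curv, ← 𝓝.derivAt_curv, ← Φ.derivAt_target_curv]
  refine ((Φ.smoothOps_opFamily.smoothLinAt_lin P).derivAt (𝓜.smoothAt_curv P)
    (curv_eq_zero_iff.2 hP) v).symm.trans ?_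
  simp only [lin_curv]

theorem lin_single_op (P : M) (i : ℕ) (x : 𝓜.L i P) :
    lin (Φ.op P) (Pi.single i x) = Pi.single i (Φ.linear P i x) :=
  lin_single (Φ.isMorphism P).degree i x

theorem _root_.LInfty.LInftyBundle.lin_single_op (𝓜 : LInftyBundle m M) (P : M) (i : ℕ)
    (x : 𝓜.L i P) :
    lin (𝓜.op P) (Pi.single i x) = Pi.single (i + 1) (𝓜.differential P i x) :=
  lin_single (𝓜.isCurvedLInfty P).degree i x

section

variable {Φ} (hΦ : Φ.IsFibration)

include hΦ in
theorem IsFibration.surjective_lin (P : M) (y : ∀ i, 𝓝.L i (Φ.base P)) :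
    ∃ x, lin (Φ.op P) x = y := by
  choose g hg using hΦ.surjective P
  refine ⟨∑ i ∈ Finset.range (𝓝.top + 1), Pi.single i (g i (y i)), ?_⟩
  rw [map_sum]
  refine Eq.trans (Finset.sum_congr rfl fun i _ => ?_)
    (sum_projDeg (𝓝.isBounded le_rfl (Φ.base P)).high y)
  rw [lin_single_op, hg]
  rfl

variable {P : M} (hP : P ∈ 𝓜.classicalLocus)

include hP in
theorem lin_lin_op (x : ∀ i, 𝓜.L i P) : lin (𝓜.op P) (lin (𝓜.op P) x) = 0 :=
  (𝓜.isCurvedLInfty P).lin_lin (𝓜.isBounded le_rfl P).high (curv_eq_zero_iff.2 hP) x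

include hP in
theorem lin_op_lin_op (x : ∀ i, 𝓜.L i P) :
    lin (Φ.op P) (lin (𝓜.op P) x) = lin (𝓝.op (Φ.base P)) (lin (Φ.op P) x) :=
  (Φ.isMorphism P).lin_lin (𝓜.isBounded le_rfl P).high (curv_eq_zero_iff.2 hP) x

include hP in
theorem linear_differential (i : ℕ) (x : 𝓜.L i P) : Φ.linear P (i + 1) (𝓜.differential P i x) =
    𝓝.differential (Φ.base P) i (Φ.linear P i x) := by
  have h := lin_op_lin_op (Φ := Φ) hP (Pi.single i x)
  rw [𝓜.lin_single_op, lin_single_op, lin_single_op, 𝓝.lin_single_op] at h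
  exact Pi.single_injective (i + 1) h

include hP in
theorem differential_differential (i : ℕ) (x : 𝓜.L i P) :
    𝓜.differential P (i + 1) (𝓜.differential P i x) = 0 := by
  have h := lin_lin_op hP (Pi.single i x)
  rw [𝓜.lin_single_op, 𝓜.lin_single_op] at h
  exact (Pi.single_eq_zero_iff (i := _ + 1)).1 h

include hP in
theorem differential_curvatureDeriv (v : TangentSpace (𝓡 m) P) :
    𝓜.differential P 1 (𝓜.curvatureDeriv P v) = 0 := by
  have h := lin_curvatureDeriv hP v
  rw [𝓜.lin_single_op] at h
  exact (Pi.single_eq_zero_iff (i := _ + 1)).1 h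

variable (het : Φ.IsEtaleAt P)

include hΦ hP het in
/-- The kernel of `φ_1` at an étale point is exact in degrees at least two. -/
theorem IsEtaleAt.exists_differential_eq {j : ℕ} (hj : 1 ≤ j) (x : 𝓜.L (j + 1) P)
    (hx : Φ.linear P (j + 1) x = 0) (hdx : 𝓜.differential P (j + 1) x = 0) :
    ∃ k, Φ.linear P j k = 0 ∧ 𝓜.differential P j k = x := by
  obtain rfl | ⟨j, rfl⟩ : j = 1 ∨ ∃ i, j = i + 2 := by
    rcases j with _ | _ | j
    · omega
    · exact Or.inl rfl
    · exact Or.inr ⟨j, rfl⟩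
  · exact exists_of_bijectiveOnCohomology (dA := 𝓜.curvatureDeriv P)
      (fA := (mfderiv (𝓡 m) (𝓡 n) Φ.base P).toLinearMap)
      (fun v => Pi.single_injective 1
        ((Φ.lin_single_op P 1 _).symm.trans (Φ.linear_curvatureDeriv hP v)))
      (linear_differential hP 1) (differential_curvatureDeriv hP) (hΦ.submersion P)
      het.degree_one.2 (het.degree_ge_two 1 le_rfl).1 hdx hx
  · exact exists_of_bijectiveOnCohomology (dA := 𝓜.differential P (j + 1))
      (linear_differential hP (j + 1)) (linear_differential hP (j + 2))
      (differential_differential hP (j + 1)) (hΦ.surjective P (j + 1))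
      (het.degree_ge_two (j + 1) (by omega)).2 (het.degree_ge_two (j + 2) (by omega)).1 hdx hx

include hP het in
/-- At an étale point, every cocycle in the kernel of `φ_1` in degree one is the derivative of
the curvature along a vertical vector. -/
theorem IsEtaleAt.exists_curvatureDeriv_eq (x : 𝓜.L 1 P)
    (hx : Φ.linear P 1 x = 0) (hdx : 𝓜.differential P 1 x = 0) :
    ∃ v, mfderiv (𝓡 m) (𝓡 n) Φ.base P v = 0 ∧ 𝓜.curvatureDeriv P v = x :=
  exists_of_bijectiveOnCohomology (dA := 0) (dA' := 0) (fA := (LinearMap.id : ℝ →ₗ[ℝ] ℝ))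
    (fB := (mfderiv (𝓡 m) (𝓡 n) Φ.base P).toLinearMap)
    (fun _ => map_zero _) (fun v => Pi.single_injective 1
      ((Φ.lin_single_op P 1 _).symm.trans (Φ.linear_curvatureDeriv hP v)))
    (fun _ => map_zero _) Function.surjective_id
    het.degree_zero.2 het.degree_one.1 hdx hx

include het in
theorem IsEtaleAt.eq_zero_of_curvatureDeriv {v : TangentSpace (𝓡 m) P}
    (hv : mfderiv (𝓡 m) (𝓡 n) Φ.base P v = 0) (hdv : 𝓜.curvatureDeriv P v = 0) : v = 0 := by
  obtain ⟨_, h⟩ := het.degree_zero.1 v hdv ⟨0, by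
    rw [map_zero]; exact hv.symm⟩
  exact h.symm

end

end LInftyBundle.Hom

end Etale

end LInfty

namespace LInfty

/-! ### The inverse function theorem in charts -/

section InverseFunction

variable {m : ℕ} {M : Type*} [TopologicalSpace M] [ChartedSpace (EuclideanSpace ℝ (Fin m)) M]
  [IsManifold (𝓡 m) ∞ M] {F : Type*} [NormedAddCommGroup F] [NormedSpace ℝ F] [CompleteSpace F]

/-- The inverse function theorem for a map from a manifold to a vector space. -/
theorem exists_openPartialHomeomorph {G : M → F} {P : M}
    (hG : ∀ᶠ Q in nhds P, ContMDiffAt (𝓡 m) 𝓘(ℝ, F) ∞ G Q)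
    (hbij : Function.Bijective (mfderiv (𝓡 m) 𝓘(ℝ, F) G P)) :
    ∃ e : OpenPartialHomeomorph M F, P ∈ e.source ∧ (∀ Q ∈ e.source, e Q = G Q) ∧
      ContMDiffOn 𝓘(ℝ, F) (𝓡 m) ∞ e.symm e.target := by
  let c := chartAt (EuclideanSpace ℝ (Fin m)) P
  have hPc : P ∈ c.source := mem_chart_source _ P
  have hcP : c P ∈ c.target := c.map_source hPc
  have hsymm : ∀ x ∈ c.target, ContMDiffAt (𝓡 m) (𝓡 m) ∞ c.symm x := fun x hx =>
    (contMDiffOn_chart_symm (x := P)).contMDiffAt (c.open_target.mem_nhds hx)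
  let g := G ∘ c.symm
  have hg : ∀ x ∈ c.target, ContMDiffAt (𝓡 m) 𝓘(ℝ, F) ∞ G (c.symm x) → ContDiffAt ℝ ∞ g x :=
    fun x hx h => contMDiffAt_iff_contDiffAt.1 (h.comp x (hsymm x hx))
  have hgev : ∀ᶠ x in nhds (c P), ContDiffAt ℝ ∞ g x := by
    have h1 : Filter.Tendsto c.symm (nhds (c P)) (nhds P) := by
      have := c.continuousAt_symm hcP
      rwa [ContinuousAt, c.left_inv hPc] at this
    filter_upwards [h1.eventually hG, c.open_target.mem_nhds hcP] with x h2 h3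
    exact hg x h3 h2
  have hgP := hgev.self_of_nhds
  -- the derivative is bijective at the base point, hence invertible near it
  have hbij' : Function.Bijective (fderiv ℝ g (c P)) := by
    have h1 : MDifferentiableAt (𝓡 m) 𝓘(ℝ, F) G (c.symm (c P)) := by
      rw [c.left_inv hPc]
      exact hG.self_of_nhds.mdifferentiableAt (by simp)
    have h2 := mfderiv_comp (c P) h1 ((hsymm _ hcP).mdifferentiableAt (by simp))
    rw [← mfderiv_eq_fderiv, show g = G ∘ c.symm from rfl, h2]
    have h3 := (mdifferentiable_chart (I := 𝓡 m) P).symm.mfderiv_bijective (x := c P) hcP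
    have h4 : Function.Bijective (mfderiv (𝓡 m) 𝓘(ℝ, F) G (c.symm (c P))) := by
      rwa [c.left_inv hPc]
    exact h4.comp h3
  let A : EuclideanSpace ℝ (Fin m) ≃L[ℝ] F := ContinuousLinearEquiv.ofBijective (fderiv ℝ g (c P))
    (LinearMap.ker_eq_bot.2 hbij'.1) (LinearMap.range_eq_top.2 hbij'.2)
  have hA : HasFDerivAt g (A : EuclideanSpace ℝ (Fin m) →L[ℝ] F) (c P) :=
    (hgP.differentiableAt (by simp)).hasFDerivAt
  have hinv : ∀ᶠ x in nhds (c P), ∃ A' : EuclideanSpace ℝ (Fin m) ≃L[ℝ] F,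
      HasFDerivAt g (A' : EuclideanSpace ℝ (Fin m) →L[ℝ] F) x := by
    have h1 : ContinuousAt (fderiv ℝ g) (c P) :=
      (hgP.fderiv_right (m := 0) (by simp)).continuousAt
    have h2 := h1.eventually (p := fun T => T ∈ Set.range
      ((↑) : (EuclideanSpace ℝ (Fin m) ≃L[ℝ] F) → EuclideanSpace ℝ (Fin m) →L[ℝ] F))
      (A.nhds)
    filter_upwards [h2, hgev] with x h3 h4
    obtain ⟨A', hA'⟩ := h3
    exact ⟨A', hA' ▸ (h4.differentiableAt (by simp)).hasFDerivAt⟩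
  obtain ⟨O, hO, hOo, hPO⟩ := eventually_nhds_iff.1 (hinv.and hgev)
  let e₀ := (hgP.toOpenPartialHomeomorph g hA (by simp)).restrOpen O hOo
  refine ⟨c.trans e₀, ?_, fun Q hQ => ?_, ?_⟩
  · rw [OpenPartialHomeomorph.trans_source]
    exact ⟨hPc, hgP.mem_toOpenPartialHomeomorph_source hA (by simp), hPO⟩
  · rw [OpenPartialHomeomorph.trans_source] at hQ
    change G (c.symm (c Q)) = G Q
    rw [c.left_inv hQ.1]
  · intro z hz
    rw [OpenPartialHomeomorph.trans_target] at hz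
    obtain ⟨h1, h2⟩ := hz
    have h3 : e₀.symm z ∈ O := (e₀.map_target h1).2
    obtain ⟨⟨A', hA'⟩, h4⟩ := hO _ h3
    have h5 : ContDiffAt ℝ ∞ e₀.symm z := e₀.contDiffAt_symm h1 hA' h4
    exact ((hsymm _ h2).comp z h5.contMDiffAt).contMDiffWithinAt

end InverseFunction

/-! ### Contractions near étale points -/

section Etale

variable {m n : ℕ} {M : Type*} [TopologicalSpace M] [T2Space M] [SecondCountableTopology M]
  [ChartedSpace (EuclideanSpace ℝ (Fin m)) M] [IsManifold (𝓡 m) ∞ M]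
  {N : Type*} [TopologicalSpace N] [ChartedSpace (EuclideanSpace ℝ (Fin n)) N]
  {𝓜 : LInftyBundle m M} {𝓝 : LInftyBundle n N} {Φ : 𝓜.Hom 𝓝} {Z : Set M}

/-- Smooth contractions of the kernel of `φ_1` over the open set `W`. -/
structure IsSmoothContraction (Φ : 𝓜.Hom 𝓝) (W : Set M) (s : LinFamily Φ.target 𝓜.toGradedBundle)
    (δ : LinFamily 𝓜.toGradedBundle 𝓜.toGradedBundle) : Prop where
  isOpen : IsOpen W
  smooth_s : ∀ P, SmoothLinAt Φ.target 𝓜.toGradedBundle s P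
  smooth_δ : ∀ P ∈ W, SmoothLinAt 𝓜.toGradedBundle 𝓜.toGradedBundle δ P
  shift_s : ∀ P, HasShift (s P) 0 0
  lin_s : ∀ P x, lin (Φ.opFamily P) (s P x) = x
  above : ∀ P ∈ W, IsContractionAbove (𝓜.op P) (Φ.opFamily P) (s P) (δ P) 1

/-- A fibration which is étale at the points of `Z` has a smooth contraction near `Z`. -/
theorem exists_isSmoothContraction (hΦ : Φ.IsFibration) (hZ : Z ⊆ 𝓜.classicalLocus)
    (het : ∀ P ∈ Z, Φ.IsEtaleAt P) :
    ∃ (W : Set M) (s : LinFamily Φ.target 𝓜.toGradedBundle)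
      (δ : LinFamily 𝓜.toGradedBundle 𝓜.toGradedBundle), Z ⊆ W ∧
      IsSmoothContraction Φ W s δ := by
  have hφd : ∀ P, HasDegree (Φ.opFamily P) 0 := fun P => (Φ.isMorphism P).degree
  obtain ⟨s, hs⟩ := exists_smooth_splitting Φ.smoothOps_opFamily hφd
    fun P y => hΦ.surjective_lin P y
  obtain ⟨W, δ, hW, hZW, hδ⟩ := exists_contractionAbove 𝓜.smoothOps Φ.smoothOps_opFamily
    (fun P => (𝓜.isCurvedLInfty P).degree) hφd (fun P => (hs P).1) (fun P => (hs P).2.1)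
    (fun P => (hs P).2.2) (Z := Z) (fun P hP => LInftyBundle.Hom.lin_lin_op (hZ hP))
    (fun P hP x hx => by
      refine (LInftyBundle.Hom.lin_op_lin_op (hZ hP) x).trans ?_
      exact (congrArg (lin (𝓝.op (Φ.base P))) hx).trans (map_zero _))
    (fun P hP j hj x h1 h2 => by
      obtain ⟨k, hk1, hk2⟩ := LInftyBundle.Hom.IsEtaleAt.exists_differential_eq hΦ (hZ hP)
        (het P hP) hj x
        ((Pi.single_eq_zero_iff (i := j + 1)).1 ((Φ.lin_single_op P (j + 1) x).symm.trans h1))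
        ((Pi.single_eq_zero_iff (i := j + 1 + 1)).1 ((𝓜.lin_single_op P (j + 1) x).symm.trans h2))
      refine ⟨k, (Φ.lin_single_op P j k).trans ?_, (𝓜.lin_single_op P j k).trans ?_⟩
      · rw [hk1, Pi.single_zero]
        rfl
      · rw [hk2]) 𝓜.top 1 le_rfl (by omega)
  exact ⟨W, s, δ, hZW, hW, fun P => (hs P).1, fun P hP => (hδ P hP).1, fun P => (hs P).2.1,
    fun P => (hs P).2.2, fun P hP => (hδ P hP).2⟩

namespace IsSmoothContraction

variable {W : Set M} {s : LinFamily Φ.target 𝓜.toGradedBundle}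
  {δ : LinFamily 𝓜.toGradedBundle 𝓜.toGradedBundle} (h : IsSmoothContraction Φ W s δ)
include h

omit [T2Space M] [SecondCountableTopology M] [IsManifold (𝓡 m) ∞ M] in
theorem isContraction {P : M} (hP : P ∈ W) :
    IsContraction (𝓜.op P) (Φ.opFamily P) (s P) (δ P) where
  shift_s := h.shift_s P
  shift_δ := (h.above P hP).shift_δ
  lin_s := h.lin_s P
  lin_δ := (h.above P hP).lin_δ
  δ_δ := (h.above P hP).δ_δ
  δ_s := (h.above P hP).δ_s
  δ_lin_δ := (h.above P hP).δ_lin_δ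
  exact i hi := (h.above P hP).exact i (by omega)

end IsSmoothContraction

end Etale

end LInfty

namespace LInfty

/-! ### Local sections -/

section LocalSections

variable {m n : ℕ} {M : Type*} [TopologicalSpace M]
  [ChartedSpace (EuclideanSpace ℝ (Fin m)) M]
  {N : Type*} [TopologicalSpace N] [ChartedSpace (EuclideanSpace ℝ (Fin n)) N]
  {𝓜 : LInftyBundle m M} {𝓝 : LInftyBundle n N} {Φ : 𝓜.Hom 𝓝} {W : Set M}
  {s : LinFamily Φ.target 𝓜.toGradedBundle} {δ : LinFamily 𝓜.toGradedBundle 𝓜.toGradedBundle}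

/-- The points of `W` at which the vertical part of the curvature lies in the image of the
homotopy `δ`. -/
def reducedLocus (Φ : 𝓜.Hom 𝓝) (W : Set M) (s : LinFamily Φ.target 𝓜.toGradedBundle)
    (δ : LinFamily 𝓜.toGradedBundle 𝓜.toGradedBundle) : Set M :=
  {P | P ∈ W ∧ ∃ c, 𝓜.curv P - s P (lin (Φ.opFamily P) (𝓜.curv P)) = δ P c}

namespace IsSmoothContraction

variable (h : IsSmoothContraction Φ W s δ)

variable (s δ) in
/-- The projection to the harmonic part of degree one of the kernel of `φ_1`. -/
noncomputable def harm : LinFamily 𝓜.toGradedBundle 𝓜.toGradedBundle := fun P =>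
  projDeg 1 ∘ₗ harmProj (𝓜.op P) (Φ.opFamily P) (s P) (δ P)

theorem harm_apply (P : M) (x : ∀ i, 𝓜.L i P) : harm s δ P x =
    projDeg 1 (harmProj (𝓜.op P) (Φ.opFamily P) (s P) (δ P) x) := rfl

include h

theorem smoothLinAt_harm {P : M} (hP : P ∈ W) :
    SmoothLinAt 𝓜.toGradedBundle 𝓜.toGradedBundle (harm s δ) P :=
  (smoothLinAt_projDeg 1).comp
    ((h.smooth_s P).harmProj 𝓜.smoothOps Φ.smoothOps_opFamily (h.smooth_δ P hP))

theorem harm_harm {P : M} (hP : P ∈ W) (x : ∀ i, 𝓜.L i P) :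
    harm s δ P (harm s δ P x) = harm s δ P x :=
  (h.above P hP).projDeg_harmProj_idem (𝓜.isBounded le_rfl P).high (𝓜.isCurvedLInfty P).degree
    (Φ.isMorphism P).degree (h.shift_s P) (h.lin_s P) 1 x

theorem harm_curv {P : M} (hP : P ∈ W) : harm s δ P (𝓜.curv P) =
    harmProj (𝓜.op P) (Φ.opFamily P) (s P) (δ P) (𝓜.curv P) := by
  have hd : HasDegree (Φ.opFamily P) 0 := (Φ.isMorphism P).degree
  rw [harm_apply, (h.above P hP).projDeg_harmProj (𝓜.isBounded le_rfl P).high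
    (𝓜.isCurvedLInfty P).degree hd (h.shift_s P), 𝓜.curv_eq, projDeg_single]

/-- The reduced locus is the zero set of the harmonic part of the curvature. -/
theorem mem_reducedLocus_iff {P : M} (hP : P ∈ W) :
    P ∈ reducedLocus Φ W s δ ↔ harm s δ P (𝓜.curv P) = 0 := by
  rw [h.harm_curv hP, harmProj_apply, kerProj_apply]
  constructor
  · rintro ⟨-, c, hc⟩
    rw [hc, (h.above P hP).δ_lin_δ, sub_self]
  · intro h0
    exact ⟨hP, _, sub_eq_zero.1 h0⟩

omit h in
theorem harm_eq_self {P : M} {x : 𝓜.L 1 P} (h1 : Φ.linear P 1 x = 0)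
    (h2 : 𝓜.differential P 1 x = 0) : harm s δ P (Pi.single 1 x) = Pi.single 1 x := by
  have h3 : lin (Φ.opFamily P) (Pi.single 1 x) = 0 := by
    refine (Φ.lin_single_op P 1 x).trans ?_
    rw [h1]
    exact Pi.single_zero _
  rw [harm_apply, harmProj_apply, kerProj_of_lin_eq_zero h3, 𝓜.lin_single_op, h2, Pi.single_zero,
    map_zero, sub_zero, projDeg_single]

/-- At a classical point the harmonic part in degree one consists of cocycles of the kernel of
`φ_1`. -/
theorem harm_cocycle {P : M} (hP : P ∈ W) (hcl : P ∈ 𝓜.classicalLocus) (x : ∀ i, 𝓜.L i P) :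
    ∃ y : 𝓜.L 1 P, harm s δ P x = Pi.single 1 y ∧ Φ.linear P 1 y = 0 ∧
      𝓜.differential P 1 y = 0 := by
  refine ⟨_, rfl, ?_, ?_⟩
  · refine (Pi.single_eq_zero_iff (i := 1)).1 ((Φ.lin_single_op P 1 _).symm.trans ?_)
    have hd : HasDegree (Φ.opFamily P) 0 := (Φ.isMorphism P).degree
    have h1 := hd.lin.projDeg_apply (𝓜.isBounded le_rfl P).high
      (i := 1) (j := 1) rfl (harmProj (𝓜.op P) (Φ.opFamily P) (s P) (δ P) x)
    refine h1.symm.trans ?_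
    exact (congrArg (projDeg 1) (lin_harmProj (h.lin_s P) (h.above P hP).lin_δ x)).trans
      (map_zero _)
  · refine (Pi.single_eq_zero_iff (i := 1 + 1)).1 ((𝓜.lin_single_op P 1 _).symm.trans ?_)
    exact IsContractionAbove.lin_projDeg_harmProj (𝓜.isBounded le_rfl P).high
      (𝓜.isCurvedLInfty P).degree (Φ.isMorphism P).degree (h.shift_s P) (h.lin_s P)
      (h.above P hP) (LInftyBundle.Hom.lin_lin_op hcl)
      (fun x hx => (LInftyBundle.Hom.lin_op_lin_op hcl x).trans
        ((congrArg (lin (𝓝.op (Φ.base P))) hx).trans (map_zero _))) x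

variable [IsManifold (𝓡 m) ∞ M] [IsManifold (𝓡 n) ∞ N]

set_option maxHeartbeats 800000 in
/-- Near an étale point the reduced locus is the image of a smooth local section of `f`. -/
theorem exists_local_section (hΦ : Φ.IsFibration) {P : M} (hP : P ∈ W)
    (hcl : P ∈ 𝓜.classicalLocus) (het : Φ.IsEtaleAt P) :
    ∃ (O : Set M) (V : Set N) (σ : N → M), IsOpen O ∧ P ∈ O ∧ IsOpen V ∧
      ContMDiffOn (𝓡 n) (𝓡 m) ∞ σ V ∧
      (∀ y ∈ V, σ y ∈ O ∧ σ y ∈ reducedLocus Φ W s δ ∧ Φ.base (σ y) = y) ∧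
      ∀ Q ∈ O, Q ∈ reducedLocus Φ W s δ → Φ.base Q ∈ V ∧ σ (Φ.base Q) = Q := by
  classical
  let E := 𝓜.toGradedBundle
  let p : LinFamily E E := harm s δ
  have hPd := E.mem_frameDomain_self P
  let A := matOf P p P
  let L : (E.FrameIndex → ℝ) →L[ℝ] LinearMap.range (Matrix.toLin' A) :=
    LinearMap.toContinuousLinearMap (Matrix.toLin' A).rangeRestrict
  have hL : ∀ t, ((L t : LinearMap.range (Matrix.toLin' A)) : E.FrameIndex → ℝ) = A.mulVec t :=
    fun t => rfl
  let u : M → E.FrameIndex → ℝ := fun Q r => E.coord P r Q (p Q (𝓜.curv Q))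
  let c := chartAt (EuclideanSpace ℝ (Fin n)) (Φ.base P)
  have hcs : Φ.base P ∈ c.source := mem_chart_source _ _
  let G : M → EuclideanSpace ℝ (Fin n) × LinearMap.range (Matrix.toLin' A) :=
    fun Q => (c (Φ.base Q), L (u Q))
  have hf : ∀ Q, ContMDiffAt (𝓡 m) (𝓡 n) ∞ Φ.base Q := fun Q => Φ.base.contMDiff.contMDiffAt
  have hcsm : ∀ y ∈ c.source, ContMDiffAt (𝓡 n) (𝓡 n) ∞ c y := fun y hy =>
    (contMDiffOn_chart (x := Φ.base P)).contMDiffAt (c.open_source.mem_nhds hy)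
  have hus : ∀ Q ∈ W, E.SmoothAt (fun Q => p Q (𝓜.curv Q)) Q := fun Q hQ =>
    h.smoothLinAt_harm hQ _ (𝓜.smoothAt_curv Q)
  -- the matrix `1 - p(Q) + p(P)` is injective near `P`, so that `p(P) u = 0` implies `u = 0` for `u`
  -- in the image of `p(Q)`
  have hdet : ∀ᶠ Q in nhds P, (1 - matOf P p Q + A).det ≠ 0 := by
    have h1 : ContMDiffAt (𝓡 m) 𝓘(ℝ, ℝ) ∞ (fun Q => (1 - matOf P p Q + A).det) P := by
      refine contMDiffAt_det fun r q => ?_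
      simp only [Matrix.add_apply, Matrix.sub_apply]
      exact (contMDiffAt_const.sub ((smoothLinAt_iff hPd hPd).1 (h.smoothLinAt_harm hP) r q)).add
        contMDiffAt_const
    refine h1.continuousAt.eventually_ne ?_
    rw [show matOf P p P = A from rfl, sub_add_cancel, Matrix.det_one]
    exact one_ne_zero
  have hWn : ∀ᶠ Q in nhds P, Q ∈ W := h.isOpen.mem_nhds hP
  have hdn : ∀ᶠ Q in nhds P, Q ∈ E.frameDomain P := E.frameDomain_mem_nhds P
  have hcn : ∀ᶠ Q in nhds P, Φ.base Q ∈ c.source :=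
    (hf P).continuousAt (c.open_source.mem_nhds hcs)
  obtain ⟨O₀, hO₀, hO₀o, hPO₀⟩ := eventually_nhds_iff.1 (hdet.and (hWn.and (hdn.and hcn)))
  have hGs : ∀ᶠ Q in nhds P, ContMDiffAt (𝓡 m)
      𝓘(ℝ, EuclideanSpace ℝ (Fin n) × LinearMap.range (Matrix.toLin' A)) ∞ G Q := by
    filter_upwards [hO₀o.mem_nhds hPO₀] with Q hQ
    obtain ⟨-, hQW, hQd, hQc⟩ := hO₀ Q hQ
    refine ((hcsm _ hQc).comp Q (hf Q)).prodMk_space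
      (L.contMDiff.contMDiffAt.comp Q (contMDiffAt_pi_space.2 fun r => ?_))
    exact (GradedBundle.smoothAt_iff hQd _).1 (hus Q hQW) r
  -- the components of the derivative of `G`
  set G' := mfderiv (𝓡 m) 𝓘(ℝ, EuclideanSpace ℝ (Fin n) × LinearMap.range (Matrix.toLin' A)) G P
    with hG'
  have hGd := (hGs.self_of_nhds.mdifferentiableAt (by simp)).hasMFDerivAt
  let C := mfderiv (𝓡 n) (𝓡 n) c (Φ.base P)
  have hC : Function.Bijective C :=
    (mdifferentiable_chart (I := 𝓡 n) (Φ.base P)).mfderiv_bijective hcs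
  let D := mfderiv (𝓡 m) (𝓡 n) Φ.base P
  have hG1 : ∀ v, (G' v).1 = C (D v) := by
    intro v
    have h1 := (ContinuousLinearMap.fst ℝ (EuclideanSpace ℝ (Fin n))
      (LinearMap.range (Matrix.toLin' A))).hasMFDerivAt (x := G P)
    have h2 := h1.comp P hGd
    have h3 := (((hcsm _ hcs).mdifferentiableAt (by simp)).hasMFDerivAt).comp P
      ((hf P).mdifferentiableAt (by simp)).hasMFDerivAt
    exact DFunLike.congr_fun (hasMFDerivAt_unique h2 h3) v
  have hu0 : p P (𝓜.curv P) = 0 := by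
    rw [LInftyBundle.curv_eq_zero_iff.2 hcl, map_zero]
  have hG2 : ∀ v r, ((G' v).2 : E.FrameIndex → ℝ) r =
      E.coord P r P (p P (Pi.single 1 (𝓜.curvatureDeriv P v))) := by
    intro v r
    have h1 := (((ContinuousLinearMap.proj r : (E.FrameIndex → ℝ) →L[ℝ] ℝ) ∘L
      (LinearMap.range (Matrix.toLin' A)).subtypeL) ∘L
      ContinuousLinearMap.snd ℝ (EuclideanSpace ℝ (Fin n))
      (LinearMap.range (Matrix.toLin' A))).hasMFDerivAt (x := G P)
    have h2 := HasMFDerivAt.realDeriv_eq (h1.comp P hGd) v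
    refine h2.symm.trans ?_
    have h3 : ∀ q, realDeriv (fun Q => u Q q) P v =
        E.coord P q P (p P (Pi.single 1 (𝓜.curvatureDeriv P v))) := by
      intro q
      rw [← 𝓜.derivAt_curv, ← (h.smoothLinAt_harm hP).derivAt (𝓜.smoothAt_curv P)
        (LInftyBundle.curv_eq_zero_iff.2 hcl), GradedBundle.coord_derivAt]
    rw [← h.harm_harm hP, coord_eq_matOf (P₀ := P) p hPd]
    refine Eq.trans ?_ ((realDeriv_sum_mul (a := fun q _ => A r q) (b := fun q Q => u Q q)
      (fun q => mdifferentiableAt_const) (fun q => (hus P hP).mdifferentiableAt_coord q)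
      (fun q => by simp only [u, hu0, map_zero]) v).trans
      (Finset.sum_congr rfl fun q _ => by rw [h3 q]))
    rfl
  have hharm : ∀ v, D v = 0 → p P (Pi.single 1 (𝓜.curvatureDeriv P v)) =
      Pi.single 1 (𝓜.curvatureDeriv P v) := by
    intro v hv
    refine harm_eq_self ((Pi.single_eq_zero_iff (i := 1)).1 ((Φ.lin_single_op P 1 _).symm.trans
      ((Φ.linear_curvatureDeriv hcl v).trans ?_)))
      (LInftyBundle.Hom.differential_curvatureDeriv hcl v)
    rw [show mfderiv (𝓡 m) (𝓡 n) Φ.base P v = 0 from hv, map_zero, Pi.single_zero]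
  have hbij : Function.Bijective G' := by
    constructor
    · refine (injective_iff_map_eq_zero G').2 fun v hv => ?_
      have hDv : D v = 0 := hC.1 (by rw [← hG1, hv, map_zero]; rfl)
      refine het.eq_zero_of_curvatureDeriv hDv ?_
      refine (Pi.single_eq_zero_iff (i := 1)).1 ((hharm v hDv).symm.trans ?_)
      refine GradedBundle.ext_coord hPd fun r => ?_
      rw [map_zero, ← hG2, hv]
      rfl
    · rintro ⟨w, z⟩
      obtain ⟨w', rfl⟩ := hC.2 w
      obtain ⟨v₀, rfl⟩ := hΦ.submersion P w'
      obtain ⟨t, ht⟩ := (z - (G' v₀).2).2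
      obtain ⟨y, hy1, hy2, hy3⟩ := h.harm_cocycle hP hcl (∑ q, t q • E.frame P q P)
      obtain ⟨v₁, hv1, hv2⟩ := LInftyBundle.Hom.IsEtaleAt.exists_curvatureDeriv_eq hcl het y hy2 hy3
      refine ⟨v₀ + v₁, ?_⟩
      rw [map_add]
      refine Prod.ext ?_ (Subtype.ext (funext fun r => ?_))
      · change (G' v₀).1 + (G' v₁).1 = _
        rw [hG1, hG1, show D v₁ = 0 from hv1, map_zero]
        exact add_zero _
      · change ((G' v₀).2 : E.FrameIndex → ℝ) r + ((G' v₁).2 : E.FrameIndex → ℝ) r =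
          (z : E.FrameIndex → ℝ) r
        have h5 : ((G' v₁).2 : E.FrameIndex → ℝ) r = A.mulVec t r := by
          rw [hG2, hharm v₁ hv1, hv2, ← hy1, coord_eq_matOf (P₀ := P) (harm s δ) hPd]
          refine Finset.sum_congr rfl fun q _ => ?_
          congr 1
          rw [map_sum, Finset.sum_eq_single q]
          · rw [map_smul, GradedBundle.coord_frame hPd, if_pos rfl, smul_eq_mul, mul_one]
          · intro q' _ hq'
            rw [map_smul, GradedBundle.coord_frame hPd, if_neg hq'.symm, smul_zero]
          · simp
        have h6 : A.mulVec t r = (z : E.FrameIndex → ℝ) r - ((G' v₀).2 : E.FrameIndex → ℝ) r :=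
          congrFun ht r
        rw [h5, h6, add_sub_cancel]
  obtain ⟨e, hPe, heG, hes⟩ := exists_openPartialHomeomorph hGs hbij
  have hi : Continuous fun x : EuclideanSpace ℝ (Fin n) =>
      (x, (0 : LinearMap.range (Matrix.toLin' A))) := by fun_prop
  refine ⟨e.source ∩ O₀, c.source ∩ c ⁻¹' ((fun x => (x, 0)) ⁻¹' (e.target ∩ e.symm ⁻¹' O₀)),
    fun y => e.symm (c y, 0), e.open_source.inter hO₀o, ⟨hPe, hPO₀⟩,
    c.isOpen_inter_preimage ((e.isOpen_inter_preimage_symm hO₀o).preimage hi), ?_, ?_, ?_⟩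
  · intro y hy
    have h1 := (hes _ hy.2.1).contMDiffAt (e.open_target.mem_nhds hy.2.1)
    exact (h1.comp y ((hcsm y hy.1).prodMk_space contMDiffAt_const)).contMDiffWithinAt
  · rintro y ⟨hyc, hy1, hy2⟩
    have hs1 := e.map_target hy1
    obtain ⟨hQdet, hQW, hQd, hQc⟩ := hO₀ _ hy2
    have h1 : G (e.symm (c y, 0)) = (c y, 0) := (heG _ hs1).symm.trans (e.right_inv hy1)
    refine ⟨⟨hs1, hy2⟩, (h.mem_reducedLocus_iff hQW).2 ?_, c.injOn hQc hyc (congrArg Prod.fst h1)⟩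
    set Q := e.symm (c y, 0)
    have h2 : A.mulVec (u Q) = 0 := (hL _).symm.trans
      (congrArg Subtype.val (congrArg Prod.snd h1))
    have h3 : (matOf P p Q).mulVec (u Q) = u Q := by
      funext r
      refine (coord_eq_matOf (P₀ := P) p hQd r (p Q (𝓜.curv Q))).symm.trans ?_
      exact congrArg (E.coord P r Q) (h.harm_harm hQW (𝓜.curv Q))
    have h4 : u Q = 0 := by
      refine Matrix.eq_zero_of_mulVec_eq_zero hQdet ?_
      rw [Matrix.add_mulVec, Matrix.sub_mulVec, Matrix.one_mulVec, h2, h3, sub_self, add_zero]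
    exact GradedBundle.ext_coord hQd fun r => (congrFun h4 r).trans (map_zero _).symm
  · rintro Q ⟨hQe, hQ0⟩ hQl
    obtain ⟨-, hQW, hQd, hQc⟩ := hO₀ Q hQ0
    have h1 : u Q = 0 := funext fun r => by
      simp only [u]
      rw [(h.mem_reducedLocus_iff hQW).1 hQl, map_zero]; rfl
    have h2 : e Q = (c (Φ.base Q), 0) := by
      rw [heG Q hQe]
      change (c (Φ.base Q), L (u Q)) = _
      rw [h1, map_zero]
    have h3 : e.symm (c (Φ.base Q), 0) = Q := by rw [← h2, e.left_inv hQe]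
    have h4 : (c (Φ.base Q), 0) ∈ e.target := by rw [← h2]; exact e.map_source hQe
    have h5 : e.symm (c (Φ.base Q), 0) ∈ O₀ := by rw [h3]; exact hQ0
    exact ⟨⟨hQc, h4, h5⟩, h3⟩

end IsSmoothContraction

end LocalSections

end LInfty

namespace LInfty

/-! ### Smoothness of the transferred morphism -/

section SmoothTransfer

variable {l m : ℕ}
  {M : Type*} [TopologicalSpace M] [ChartedSpace (EuclideanSpace ℝ (Fin m)) M]
  {Y : Type*} [TopologicalSpace Y] [ChartedSpace (EuclideanSpace ℝ (Fin l)) Y]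
  {E E' E'' : GradedBundle m M}

/-- A family of operations along a map `a` to the base is smooth at `y₀` if it takes sections which
are smooth at `y₀` to sections which are smooth at `y₀`. -/
def SmoothOpsAlongAt (E E' : GradedBundle m M) (a : Y → M)
    (φ : ∀ y, Ops (fun i => E.L i (a y)) (fun i => E'.L i (a y))) (y₀ : Y) : Prop :=
  ∀ (k : ℕ) (s : Fin k → ∀ y, ∀ i, E.L i (a y)), (∀ t, E.SmoothAlongAt (m := l) a (s t) y₀) →
    E'.SmoothAlongAt (m := l) a (fun y => φ y k fun t => s t y) y₀

theorem SmoothLinAt.neg {T : LinFamily E E'} {P : M} (hT : SmoothLinAt E E' T P) :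
    SmoothLinAt E E' (fun Q => -T Q) P :=
  (smoothLinAt_zero.sub hT).congr (Filter.Eventually.of_forall fun Q => (zero_sub (T Q)).symm)

variable {a : Y → M} {y₀ : Y} (ha : ContMDiffAt (𝓡 l) (𝓡 m) ∞ a y₀)

include ha in
theorem SmoothLinAt.linOps {T : LinFamily E E'} (hT : SmoothLinAt E E' T (a y₀)) :
    SmoothOpsAlongAt (l := l) E E' a (fun y => LInfty.linOps (T (a y))) y₀ := by
  intro k s hs
  by_cases hk : k = 1
  · subst hk
    exact hT.along ha (hs 0)
  · simp only [linOps_of_ne _ hk]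
    exact GradedBundle.smoothAlongAt_zero ha

namespace SmoothOpsAlongAt

variable {φ φ' : ∀ y, Ops (fun i => E.L i (a y)) (fun i => E'.L i (a y))}
  (hφ : SmoothOpsAlongAt (l := l) E E' a φ y₀)
include ha hφ

theorem postOps {T : LinFamily E' E''} (hT : SmoothLinAt E' E'' T (a y₀)) :
    SmoothOpsAlongAt (l := l) E E'' a (fun y => LInfty.postOps (T (a y)) (φ y)) y₀ :=
  fun k s hs => hT.along ha (hφ k s hs)

theorem higherOps : SmoothOpsAlongAt (l := l) E E' a (fun y => LInfty.higherOps (φ y)) y₀ := by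
  intro k s hs
  by_cases hk : 2 ≤ k
  · simp only [LInfty.higherOps, if_pos hk]
    exact hφ k s hs
  · simp only [LInfty.higherOps, if_neg hk]
    exact GradedBundle.smoothAlongAt_zero ha

theorem add (hφ' : SmoothOpsAlongAt (l := l) E E' a φ' y₀) :
    SmoothOpsAlongAt (l := l) E E' a (fun y => φ y + φ' y) y₀ :=
  fun k s hs => GradedBundle.SmoothAlongAt.add ha (hφ k s hs) (hφ' k s hs)

theorem bulletOps (r : ℕ) {ψ : ∀ y, Ops (fun i => E'.L i (a y)) (fun i => E''.L i (a y))}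
    (hψ : SmoothOpsAlongAt (l := l) E' E'' a ψ y₀) :
    SmoothOpsAlongAt (l := l) E E'' a (fun y => LInfty.bulletOps r (ψ y) (φ y)) y₀ := by
  intro k s hs
  simp only [bulletOps_apply, bullet]
  refine GradedBundle.smoothAlongAt_sum ha _ fun d _ => GradedBundle.smoothAlongAt_sum ha _
    fun j _ => GradedBundle.SmoothAlongAt.const_smul ha
      (GradedBundle.smoothAlongAt_sum ha _ fun p _ => GradedBundle.SmoothAlongAt.const_smul ha
        (hψ j (fun c y => φ y _ (sub (homog (fun t => (d t : ℕ)) fun t => s t y (d t))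
          (block p c))) fun c => ?_) _) _
  exact hφ _ (fun i y => Pi.single _ (s ((block p c).orderEmbOfFin rfl i) y _)) fun i =>
    GradedBundle.SmoothAlongAt.single ha (hs _) _

end SmoothOpsAlongAt

include ha in
/-- The transferred morphism depends smoothly on the parameters. -/
theorem smoothOpsAlongAt_transfer {lam : ∀ P, Ops (fun i => E.L i P) (fun i => E.L i P)}
    {φ : ∀ P, Ops (fun i => E.L i P) (fun i => E'.L i P)} {s : LinFamily E' E}
    {δ : LinFamily E E} (hlam : SmoothOps E E id lam) (hφ : SmoothOps E E' id φ)
    (hs : SmoothLinAt E' E s (a y₀)) (hδ : SmoothLinAt E E δ (a y₀)) (r : ℕ) :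
    SmoothOpsAlongAt (l := l) E' E a
      (fun y => transfer (lam (a y)) (φ (a y)) (s (a y)) (δ (a y)) r) y₀ := by
  have hlin : SmoothLinAt E' E (fun P => transferLin (lam P) (s P) (δ P)) (a y₀) :=
    hs.sub (hδ.comp ((hlam.smoothLinAt_lin _).comp hs))
  have hlam' : SmoothOpsAlongAt (l := l) E E a (fun y => lam (a y)) y₀ := fun k t ht =>
    hlam.along contMDiff_id ha t ht
  have hφ' : SmoothOpsAlongAt (l := l) E E' a (fun y => φ (a y)) y₀ := fun k t ht =>
    hφ.along contMDiff_id ha t ht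
  have hops : SmoothOpsAlongAt (l := l) E E a
      (fun y => transferOps (lam (a y)) (φ (a y)) (s (a y)) (δ (a y))) y₀ :=
    (SmoothOpsAlongAt.postOps (T := fun P => -transferLin (lam P) (s P) (δ P)) ha
      (hφ'.higherOps ha) hlin.neg).add ha
      (SmoothOpsAlongAt.postOps (T := fun P => -δ P) ha (hlam'.higherOps ha) hδ.neg)
  have hiter : ∀ j, SmoothOpsAlongAt (l := l) E' E a
      (fun y => transferIter (lam (a y)) (φ (a y)) (s (a y)) (δ (a y)) r j) y₀ := by
    intro j
    induction j with
    | zero => exact fun k t _ => GradedBundle.smoothAlongAt_zero ha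
    | succ j ih => exact (hlin.linOps ha).add ha (ih.bulletOps ha r hops)
  exact hiter (r + 1)

end SmoothTransfer

/-! ### The morphism over the reduced locus -/

section Morphism

variable {l m n : ℕ} {M : Type*} [TopologicalSpace M]
  [ChartedSpace (EuclideanSpace ℝ (Fin m)) M]
  {N : Type*} [TopologicalSpace N] [ChartedSpace (EuclideanSpace ℝ (Fin n)) N]
  {Y : Type*} [TopologicalSpace Y] [ChartedSpace (EuclideanSpace ℝ (Fin l)) Y]
  {𝓜 : LInftyBundle m M} {𝓝 : LInftyBundle n N} {Φ : 𝓜.Hom 𝓝} {W : Set M}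
  {s : LinFamily Φ.target 𝓜.toGradedBundle} {δ : LinFamily 𝓜.toGradedBundle 𝓜.toGradedBundle}

theorem GradedBundle.smoothAlongAt_pullback_iff (E : GradedBundle n N)
    (f : C^∞⟮𝓡 m, M; 𝓡 n, N⟯) (τ : C^∞⟮𝓡 l, Y; 𝓡 m, M⟯) (s : ∀ y, ∀ i, E.L i (f (τ y))) (y₀ : Y) :
    (E.pullback f).SmoothAlongAt (m := l) τ s y₀ ↔
      E.SmoothAlongAt (m := l) (fun y => f (τ y)) s y₀ := by
  refine forall_congr' fun i => ?_
  refine Bundle.contMDiffAt_totalSpace.trans (Iff.trans ?_ Bundle.contMDiffAt_totalSpace.symm)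
  exact and_congr (iff_of_true τ.contMDiff.contMDiffAt
    (f.contMDiff.contMDiffAt.comp y₀ τ.contMDiff.contMDiffAt)) Iff.rfl

/-- A map `τ` to the reduced locus underlies a morphism from the pullback of the target along
`f ∘ τ`, given by homotopy transfer, which is a section of `(f, φ)`. -/
theorem IsSmoothContraction.exists_hom (h : IsSmoothContraction Φ W s δ)
    (τ : C^∞⟮𝓡 l, Y; 𝓡 m, M⟯) (hτ : ∀ y, τ y ∈ reducedLocus Φ W s δ)
    (g : C^∞⟮𝓡 l, Y; 𝓡 n, N⟯) (hg : ∀ y, Φ.base (τ y) = g y) :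
    ∃ Ψ : LInftyBundle.Hom (𝓝.pullback g) 𝓜, (∀ y, Ψ.base y = τ y) ∧
      LInftyBundle.Hom.IsComposition Φ Ψ (LInftyBundle.Hom.pullbackProj 𝓝 g) := by
  obtain rfl : Φ.base.comp τ = g := ContMDiffMap.ext hg
  let r := max 𝓜.top 𝓝.top
  have hV : ∀ y, IsBounded (fun i => Φ.target.L i (τ y)) r := fun y =>
    𝓝.isBounded (le_max_right 𝓜.top 𝓝.top) (Φ.base (τ y))
  have hW : ∀ y, IsBounded (fun i => 𝓜.L i (τ y)) r := fun y =>
    𝓜.isBounded (le_max_left 𝓜.top 𝓝.top) (τ y)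
  have hφ : ∀ y, IsLInftyMorphism (𝓜.op (τ y)) (𝓝.op (Φ.base (τ y))) (Φ.opFamily (τ y)) :=
    fun y => Φ.isMorphism (τ y)
  let Ψ : LInftyBundle.Hom (𝓝.pullback (Φ.base.comp τ)) 𝓜 :=
  { base := τ
    op := fun y => transfer (𝓜.op (τ y)) (Φ.opFamily (τ y)) (s (τ y)) (δ (τ y)) r
    isMorphism := fun y => transfer_isMorphism (hV y) (hW y) (𝓜.isCurvedLInfty (τ y)) (hφ y)
      (h.isContraction (hτ y).1) (𝓝.isCurvedLInfty (Φ.base (τ y))) (hτ y).2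
    smoothOps := fun k t y ht => smoothOpsAlongAt_transfer τ.contMDiff.contMDiffAt 𝓜.smoothOps
      Φ.smoothOps_opFamily (h.smooth_s (τ y)) (h.smooth_δ (τ y) (hτ y).1) r k t fun c =>
        (𝓝.toGradedBundle.smoothAlongAt_pullback_iff Φ.base τ (t c) y).2
          ((𝓝.toGradedBundle.smoothAt_pullback_iff (Φ.base.comp τ) (t c) y).1 (ht c)) }
  refine ⟨Ψ, fun _ => rfl, fun _ => rfl, fun y k _ d v => ?_⟩
  let μ : Ops (fun i => Φ.target.L i (τ y)) (fun i => Φ.target.L i (τ y)) :=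
    𝓝.op (Φ.base (τ y))
  have hlam' : IsCurvedLInfty μ := 𝓝.isCurvedLInfty (Φ.base (τ y))
  have hb := transfer_bullet (V := fun i => Φ.target.L i (τ y)) (lam' := μ)
    (v := fun a => (v a : Φ.target.L (d a) (τ y))) (hV y) (hW y) (𝓜.isCurvedLInfty (τ y)) (hφ y)
    (h.isContraction (hτ y).1) hlam' d
  exact congrArg (Sigma.mk (Φ.base (τ y))) hb

end Morphism

end LInfty

namespace LInfty

/-! ### Manifold structures pulled back along local homeomorphisms -/

section Etale

variable {𝕜 : Type*} [NontriviallyNormedField 𝕜]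
  {E : Type*} [NormedAddCommGroup E] [NormedSpace 𝕜 E] {H : Type*} [TopologicalSpace H]
  {N : Type*} [TopologicalSpace N] [ChartedSpace H N]
  {Y : Type*} [TopologicalSpace Y]

/-- A local homeomorphism to a manifold pulls back the manifold structure: its local inverses are
smooth, and so is the local homeomorphism itself. -/
theorem exists_isManifold_of_isLocalHomeomorph (I : ModelWithCorners 𝕜 E H) (k : ℕ∞ω)
    [IsManifold I k N] {g : Y → N} (hg : IsLocalHomeomorph g) :
    ∃ (_ : ChartedSpace H Y) (_ : IsManifold I k Y), ∀ e : OpenPartialHomeomorph Y N,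
      ⇑e = g → ContMDiffOn I I k e e.source ∧ ContMDiffOn I I k e.symm e.target := by
  choose c hc hcg using hg
  let cN : ChartedSpace N Y :=
  { atlas := {e | ⇑e = g}
    chartAt := c
    mem_chart_source := hc
    chart_mem_atlas := fun x => (hcg x).symm }
  have : HasGroupoid Y (idRestrGroupoid (H := N)) := by
    refine ⟨fun {e e'} he he' => ?_⟩
    refine ⟨(e.symm ≫ₕ e').source, (e.symm ≫ₕ e').open_source, ?_⟩
    refine ⟨by simp, fun x hx => ?_⟩
    have hx' : x ∈ e.target := by simp at hx; exact hx.1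
    change e' (e.symm x) = x
    rw [show ⇑e' = ⇑e from he'.trans he.symm, e.right_inv hx']
  let cH : ChartedSpace H Y := ChartedSpace.comp H N Y
  have hG : HasGroupoid Y (contDiffGroupoid k I) := by
    refine StructureGroupoid.HasGroupoid.comp (G₁ := contDiffGroupoid k I) (idRestrGroupoid (H := N))
      fun e he => ?_
    obtain ⟨t, ht, het⟩ := he
    have hP := StructureGroupoid.isLocalStructomorphWithinAt_localInvariantProp
      (contDiffGroupoid k I)
    have hid : ChartedSpace.LiftProp (contDiffGroupoid k I).IsLocalStructomorphWithinAt
        (id : N → N) :=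
      hP.liftProp_id fun y _ => ⟨OpenPartialHomeomorph.refl H, (contDiffGroupoid k I).id_mem,
        fun _ _ => rfl, trivial⟩
    exact fun x hx => hP.liftPropWithinAt_congr
      (hP.liftPropWithinAt_of_liftPropAt_of_mem_nhds (hid x) (e.open_source.mem_nhds hx))
      (fun y hy => het.2 hy) (het.2 hx)
  have hM : IsManifold I k Y := { hG with }
  refine ⟨cH, hM, fun e he => ?_⟩
  have hmem : ∀ y : N, e ≫ₕ chartAt H y ∈ IsManifold.maximalAtlas I k Y := fun y =>
    StructureGroupoid.subset_maximalAtlas _ ⟨e, he, _, chart_mem_atlas H y, rfl⟩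
  constructor
  · intro x hx
    have hx' : x ∈ (e ≫ₕ chartAt H (e x)).source := by simp [hx]
    have h1 := (contMDiffOn_of_mem_maximalAtlas (hmem (e x))).contMDiffAt
      ((e ≫ₕ chartAt H (e x)).open_source.mem_nhds hx')
    have h2 := (contMDiffOn_chart_symm (I := I) (n := k) (x := e x)).contMDiffAt
      ((chartAt H (e x)).open_target.mem_nhds (mem_chart_target H (e x)))
    refine ((h2.comp x h1).congr_of_eventuallyEq ?_).contMDiffWithinAt
    filter_upwards [(e ≫ₕ chartAt H (e x)).open_source.mem_nhds hx'] with z hz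
    simp only [OpenPartialHomeomorph.trans_source, Set.mem_inter_iff, Set.mem_preimage] at hz
    exact ((chartAt H (e x)).left_inv hz.2).symm
  · intro y hy
    have hy' : chartAt H y y ∈ (e ≫ₕ chartAt H y).target := by simp [hy]
    have h1 := (contMDiffOn_symm_of_mem_maximalAtlas (hmem y)).contMDiffAt
      ((e ≫ₕ chartAt H y).open_target.mem_nhds hy')
    have h2 := (contMDiffOn_chart (I := I) (n := k) (x := y)).contMDiffAt
      ((chartAt H y).open_source.mem_nhds (mem_chart_source H y))
    refine ((h1.comp y h2).congr_of_eventuallyEq ?_).contMDiffWithinAt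
    filter_upwards [(chartAt H y).open_source.mem_nhds (mem_chart_source H y)] with z hz
    exact (congrArg e.symm ((chartAt H y).left_inv hz)).symm

/-- `S` is locally the image of a smooth section of `f` defined on an open set. -/
def HasLocalSections {E' : Type*} [NormedAddCommGroup E'] [NormedSpace 𝕜 E'] {H' : Type*}
    [TopologicalSpace H'] {M : Type*} [TopologicalSpace M] [ChartedSpace H' M]
    (I' : ModelWithCorners 𝕜 E' H') (I : ModelWithCorners 𝕜 E H) (k : ℕ∞ω) (f : M → N)
    (S : Set M) : Prop :=
  ∀ P ∈ S, ∃ (O : Set M) (V : Set N) (σ : N → M), IsOpen O ∧ P ∈ O ∧ IsOpen V ∧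
    ContMDiffOn I I' k σ V ∧ (∀ y ∈ V, σ y ∈ O ∧ σ y ∈ S ∧ f (σ y) = y) ∧
    ∀ Q ∈ O, Q ∈ S → f Q ∈ V ∧ σ (f Q) = Q

variable {E' : Type*} [NormedAddCommGroup E'] [NormedSpace 𝕜 E'] {H' : Type*}
  [TopologicalSpace H'] {M : Type*} [TopologicalSpace M] [ChartedSpace H' M]
  {I' : ModelWithCorners 𝕜 E' H'} {I : ModelWithCorners 𝕜 E H} {k : ℕ∞ω} {f : M → N} {S : Set M}

/-- The local inverses of `f` on `S`, as local homeomorphisms of the subspace `S`. -/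
theorem HasLocalSections.exists_openPartialHomeomorph (hS : HasLocalSections I' I k f S)
    (hf : Continuous f) (x : S) : ∃ e : OpenPartialHomeomorph S N, x ∈ e.source ∧
      (⇑e = fun Q : S => f Q) ∧ ∃ σ : N → M, ContMDiffOn I I' k σ e.target ∧
        ∀ y ∈ e.target, (e.symm y : M) = σ y := by
  classical
  obtain ⟨O, V, σ, hO, hxO, hV, hσ, h1, h2⟩ := hS x x.2
  have hinv : ∀ y ∈ V, ((if h : σ y ∈ S then (⟨σ y, h⟩ : S) else x : S) : M) = σ y :=
    fun y hy => by rw [dif_pos (h1 y hy).2.1]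
  let e : OpenPartialHomeomorph S N :=
  { toFun := fun Q => f Q
    invFun := fun y => if h : σ y ∈ S then ⟨σ y, h⟩ else x
    source := Subtype.val ⁻¹' O
    target := V
    map_source' := fun Q hQ => (h2 Q hQ Q.2).1
    map_target' := fun y hy => by
      rw [Set.mem_preimage, hinv y hy]
      exact (h1 y hy).1
    left_inv' := fun Q hQ => Subtype.ext ((hinv _ (h2 Q hQ Q.2).1).trans (h2 Q hQ Q.2).2)
    right_inv' := fun y hy => by
      rw [hinv y hy]
      exact (h1 y hy).2.2
    open_source := hO.preimage continuous_subtype_val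
    open_target := hV
    continuousOn_toFun := (hf.comp continuous_subtype_val).continuousOn
    continuousOn_invFun := by
      refine Topology.IsInducing.subtypeVal.continuousOn_iff.2 (hσ.continuousOn.congr hinv) }
  exact ⟨e, hxO, rfl, σ, hσ, hinv⟩

theorem HasLocalSections.isLocalHomeomorph (hS : HasLocalSections I' I k f S)
    (hf : Continuous f) : IsLocalHomeomorph fun Q : S => f Q := fun x =>
  let ⟨e, hx, he, _⟩ := hS.exists_openPartialHomeomorph hf x
  ⟨e, hx, he.symm⟩

/-- A subset which is locally the image of a smooth section of `f` is a manifold for which the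
inclusion is smooth and `f` is a local diffeomorphism. -/
theorem HasLocalSections.exists_isManifold [IsManifold I k N] (hS : HasLocalSections I' I k f S)
    (hf : Continuous f) : ∃ (_ : ChartedSpace H S) (_ : IsManifold I k S),
      ContMDiff I I' k (Subtype.val : S → M) ∧ IsLocalDiffeomorph I I k fun Q : S => f Q := by
  obtain ⟨cS, mS, h⟩ := exists_isManifold_of_isLocalHomeomorph I k (hS.isLocalHomeomorph hf)
  refine ⟨cS, mS, fun x => ?_, fun x => ?_⟩
  · obtain ⟨e, hx, he, σ, hσ, heσ⟩ := hS.exists_openPartialHomeomorph hf x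
    have h1 := (h e he).1.contMDiffAt (e.open_source.mem_nhds hx)
    have h2 := hσ.contMDiffAt (e.open_target.mem_nhds (e.map_source hx))
    refine (h2.comp x h1).congr_of_eventuallyEq ?_
    filter_upwards [e.open_source.mem_nhds hx] with z hz
    exact (congrArg Subtype.val (e.left_inv hz)).symm.trans (heσ _ (e.map_source hz))
  · obtain ⟨e, hx, he, -⟩ := hS.exists_openPartialHomeomorph hf x
    exact ⟨{ e.toPartialEquiv with
      open_source := e.open_source
      open_target := e.open_target
      contMDiffOn_toFun := (h e he).1
      contMDiffOn_invFun := (h e he).2 }, hx, fun z _ => (congrFun he z).symm⟩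

end Etale

end LInfty

namespace LInfty

/-! ### Injectivity near a set -/

/-- A local homeomorphism of metrizable spaces which is injective over `A` is injective on a
neighborhood of the preimage of `A`. -/
theorem exists_isOpen_injOn {Y N : Type*} [TopologicalSpace Y] [TopologicalSpace N]
    [TopologicalSpace.MetrizableSpace Y] [TopologicalSpace.MetrizableSpace N] {g : Y → N}
    (hg : IsLocalHomeomorph g) {A : Set N} (hA : Set.InjOn g (g ⁻¹' A)) :
    ∃ O : Set Y, IsOpen O ∧ g ⁻¹' A ⊆ O ∧ Set.InjOn g O := by
  let _ := TopologicalSpace.metrizableSpaceMetric Y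
  let _ := TopologicalSpace.metrizableSpaceMetric N
  have h1 : ∀ y, ∃ r > 0, Set.InjOn g (Metric.ball y r) := fun y => by
    obtain ⟨e, hy, rfl⟩ := hg y
    obtain ⟨r, hr, hb⟩ := Metric.isOpen_iff.1 e.open_source y hy
    exact ⟨r, hr, e.injOn.mono hb⟩
  choose r hr hinj using h1
  have h2 : ∀ y, ∃ ε > 0, ε ≤ r y ∧ Metric.ball (g y) ε ⊆ g '' Metric.ball y (r y / 3) := by
    intro y
    obtain ⟨ε, hε, hb⟩ := Metric.isOpen_iff.1 (hg.isOpenMap _ (Metric.isOpen_ball (x := y)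
      (ε := r y / 3))) (g y) ⟨y, Metric.mem_ball_self (div_pos (hr y) three_pos), rfl⟩
    exact ⟨min ε (r y), lt_min hε (hr y), min_le_right _ _,
      (Metric.ball_subset_ball (min_le_left _ _)).trans hb⟩
  choose ε hε hεr hball using h2
  let B : Y → Set Y := fun y => Metric.ball y (ε y / 3) ∩ g ⁻¹' Metric.ball (g y) (ε y / 2)
  -- if the radius at `y` is the larger one, then `z` lies in the ball around `y` on which `g` is
  -- injective
  have key : ∀ y z, g z ∈ A → ε z ≤ ε y → ∀ p ∈ B y, ∀ q ∈ B z, g p = g q →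
      g y ∈ A → p = q := by
    intro y z hz hle p hp q hq hpq hy
    have hd : dist (g z) (g y) < ε y := by
      have hp2 : dist (g p) (g y) < ε y / 2 := hp.2
      have hq2 : dist (g q) (g z) < ε z / 2 := hq.2
      rw [← hpq] at hq2
      linarith [dist_triangle_left (g z) (g y) (g p)]
    obtain ⟨w, hw, hwz⟩ := hball y hd
    have hwz' : w = z := hA (by rwa [Set.mem_preimage, hwz]) hz hwz
    subst hwz'
    have hp1 : dist p y < ε y / 3 := hp.1
    have hq1 : dist q w < ε w / 3 := hq.1
    have hw1 : dist w y < r y / 3 := hw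
    have := hεr y
    refine hinj y (Metric.mem_ball.2 ?_) (Metric.mem_ball.2 ?_) hpq
    · linarith [hr y]
    · linarith [dist_triangle q w y, hr y]
  refine ⟨⋃ y ∈ g ⁻¹' A, B y, isOpen_biUnion fun y _ =>
    Metric.isOpen_ball.inter (Metric.isOpen_ball.preimage hg.continuous), fun y hy => ?_, ?_⟩
  · exact Set.mem_biUnion hy ⟨Metric.mem_ball_self (div_pos (hε y) three_pos),
      Metric.mem_ball_self (half_pos (hε y))⟩
  · intro p hp q hq hpq
    obtain ⟨y, hy, hpy⟩ := Set.mem_iUnion₂.1 hp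
    obtain ⟨z, hz, hqz⟩ := Set.mem_iUnion₂.1 hq
    rcases le_total (ε z) (ε y) with hle | hle
    · exact key y z hz hle p hpy q hqz hpq hy
    · exact (key z y hy hle q hqz p hpy hpq.symm hz).symm

section InjectiveSections

variable {𝕜 : Type*} [NontriviallyNormedField 𝕜]
  {E : Type*} [NormedAddCommGroup E] [NormedSpace 𝕜 E] {H : Type*} [TopologicalSpace H]
  {E' : Type*} [NormedAddCommGroup E'] [NormedSpace 𝕜 E'] {H' : Type*} [TopologicalSpace H']
  {N : Type*} [TopologicalSpace N] [ChartedSpace H N]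
  {M : Type*} [TopologicalSpace M] [ChartedSpace H' M]
  {I' : ModelWithCorners 𝕜 E' H'} {I : ModelWithCorners 𝕜 E H} {k : ℕ∞ω} {f : M → N} {S : Set M}

theorem HasLocalSections.inter (hS : HasLocalSections I' I k f S) {O : Set M} (hO : IsOpen O) :
    HasLocalSections I' I k f (S ∩ O) := by
  rintro P ⟨hP, hPO⟩
  obtain ⟨O', V, σ, hO', hPO', hV, hσ, h1, h2⟩ := hS P hP
  refine ⟨O' ∩ O, V ∩ σ ⁻¹' O, σ, hO'.inter hO, ⟨hPO', hPO⟩,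
    hσ.continuousOn.isOpen_inter_preimage hV hO, hσ.mono Set.inter_subset_left,
    fun y hy => ?_, fun Q hQ hQS => ?_⟩
  · obtain ⟨h3, h4, h5⟩ := h1 y hy.1
    exact ⟨⟨h3, hy.2⟩, ⟨h4, hy.2⟩, h5⟩
  · obtain ⟨h3, h4⟩ := h2 Q hQ.1 hQS.1
    refine ⟨⟨h3, ?_⟩, h4⟩
    rw [Set.mem_preimage, h4]
    exact hQS.2

/-- If `f` is injective on `S`, then the local sections glue to a section over the image of
`S`. -/
theorem HasLocalSections.exists_section (hS : HasLocalSections I' I k f S)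
    (hinj : Set.InjOn f S) : ∃ U : TopologicalSpace.Opens N, (U : Set N) = f '' S ∧
      ∃ τ : U → M, ContMDiff I I' k τ ∧ (∀ y, τ y ∈ S ∧ f (τ y) = y) := by
  have hopen : IsOpen (f '' S) := by
    refine isOpen_iff_mem_nhds.2 ?_
    rintro _ ⟨P, hP, rfl⟩
    obtain ⟨O, V, σ, -, hPO, hV, -, h1, h2⟩ := hS P hP
    exact Filter.mem_of_superset (hV.mem_nhds (h2 P hPO hP).1)
      fun y hy => ⟨σ y, (h1 y hy).2.1, (h1 y hy).2.2⟩
  choose τ hτS hτ using fun y : (⟨f '' S, hopen⟩ : TopologicalSpace.Opens N) => y.2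
  refine ⟨⟨f '' S, hopen⟩, rfl, τ, fun y => ?_, fun y => ⟨hτS y, hτ y⟩⟩
  obtain ⟨O, V, σ, -, hPO, hV, hσ, h1, h2⟩ := hS (τ y) (hτS y)
  have hy : (y : N) ∈ V := hτ y ▸ (h2 _ hPO (hτS y)).1
  have h3 := (hσ.contMDiffAt (hV.mem_nhds hy)).comp y (contMDiff_subtype_val y)
  refine h3.congr_of_eventuallyEq ?_
  filter_upwards [(hV.preimage continuous_subtype_val).mem_nhds hy] with z hz
  exact hinj (hτS z) (h1 z hz).2.1 ((hτ z).trans (h1 z hz).2.2.symm)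

theorem isLocalDiffeomorph_subtype_val (U : TopologicalSpace.Opens N) :
    IsLocalDiffeomorph I I ∞ (Subtype.val : U → N) := by
  intro x
  let e := U.openPartialHomeomorphSubtypeCoe ⟨x⟩
  refine ⟨{ e.toPartialEquiv with
      open_source := e.open_source
      open_target := e.open_target
      contMDiffOn_toFun := contMDiff_subtype_val.contMDiffOn
      contMDiffOn_invFun := fun y hy => ?_ }, Set.mem_univ x, fun z _ => rfl⟩
  refine ((ContMDiffAt.subtypeVal_comp_iff (I := I) (I' := I) U e.symm y).1
    (contMDiffAt_id.congr_of_eventuallyEq ?_)).contMDiffWithinAt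
  filter_upwards [e.open_target.mem_nhds hy] with z hz
  exact e.right_inv hz

end InjectiveSections

end LInfty

namespace LInfty

/-! ### Partial sections over the reduced locus -/

section PartialSections

variable {m n : ℕ} {M : Type*} [TopologicalSpace M]
  [ChartedSpace (EuclideanSpace ℝ (Fin m)) M]
  {N : Type*} [TopologicalSpace N] [ChartedSpace (EuclideanSpace ℝ (Fin n)) N]
  {𝓜 : LInftyBundle m M} {𝓝 : LInftyBundle n N} {Φ : 𝓜.Hom 𝓝} {W : Set M}
  {s : LinFamily Φ.target 𝓜.toGradedBundle} {δ : LinFamily 𝓜.toGradedBundle 𝓜.toGradedBundle}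

namespace IsSmoothContraction

variable (h : IsSmoothContraction Φ W s δ)
include h

omit h in
/-- At points over the classical locus, the curvature has no horizontal part. -/
theorem curv_eq_of_base_mem {P : M} (hP : P ∈ reducedLocus Φ W s δ)
    (hcl : Φ.base P ∈ 𝓝.classicalLocus) : ∃ c, 𝓜.curv P = δ P c := by
  obtain ⟨-, c, hc⟩ := hP
  refine ⟨c, hc ▸ ?_⟩
  have h0 : lin (Φ.opFamily P) (𝓜.curv P) = 0 :=
    (Φ.lin_curv P).trans (LInftyBundle.curv_eq_zero_iff.2 hcl)
  rw [h0, map_zero, sub_zero]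

/-- A point of the reduced locus is classical as soon as its image is: then `λ_0 = δ c`, and
hence `λ_0 = δ λ_1 δ c = δ λ_1 λ_0 = 0`. -/
theorem mem_classicalLocus {P : M} (hP : P ∈ reducedLocus Φ W s δ)
    (hcl : Φ.base P ∈ 𝓝.classicalLocus) : P ∈ 𝓜.classicalLocus := by
  obtain ⟨c, hc⟩ := curv_eq_of_base_mem hP hcl
  refine LInftyBundle.curv_eq_zero_iff.1 ?_
  have h1 : lin (𝓜.op P) (𝓜.curv P) = 0 := (𝓜.isCurvedLInfty P).lin_curvature
  rw [hc, ← (h.above P hP.1).δ_lin_δ, ← hc, h1, map_zero]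

theorem mem_reducedLocus {P : M} (hP : P ∈ W) (hcl : P ∈ 𝓜.classicalLocus) :
    P ∈ reducedLocus Φ W s δ := by
  rw [h.mem_reducedLocus_iff hP, LInftyBundle.curv_eq_zero_iff.2 hcl, map_zero]

variable [IsManifold (𝓡 m) ∞ M] [IsManifold (𝓡 n) ∞ N]

/-- The part of the reduced locus near the étale points is locally the image of a section. -/
theorem exists_hasLocalSections (hΦ : Φ.IsFibration) {Z : Set M} (hZW : Z ⊆ W)
    (hZ : Z ⊆ 𝓜.classicalLocus) (het : ∀ P ∈ Z, Φ.IsEtaleAt P) :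
    ∃ S : Set M, Z ⊆ S ∧ S ⊆ reducedLocus Φ W s δ ∧
      HasLocalSections (𝓡 m) (𝓡 n) ∞ Φ.base S := by
  choose O V σ hO hPO hV hσ h1 h2 using fun P : Z =>
    h.exists_local_section hΦ (hZW P.2) (hZ P.2) (het P P.2)
  refine ⟨reducedLocus Φ W s δ ∩ ⋃ P, O P, fun P hP => ⟨h.mem_reducedLocus (hZW hP) (hZ hP),
    Set.mem_iUnion.2 ⟨⟨P, hP⟩, hPO ⟨P, hP⟩⟩⟩, Set.inter_subset_left, fun Q hQ => ?_⟩
  obtain ⟨P, hQP⟩ := Set.mem_iUnion.1 hQ.2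
  exact ⟨O P, V P, σ P, hO P, hQP, hV P, hσ P, fun y hy => ⟨(h1 P y hy).1,
    ⟨(h1 P y hy).2.1, Set.mem_iUnion.2 ⟨P, (h1 P y hy).1⟩⟩, (h1 P y hy).2.2⟩,
    fun Q hQO hQS => h2 P Q hQO hQS.1⟩

end IsSmoothContraction

end PartialSections

end LInfty

theorem theorem3p1 {m n : ℕ}
    {M : Type u} [TopologicalSpace M] [T2Space M] [SecondCountableTopology M]
    [ChartedSpace (EuclideanSpace ℝ (Fin m)) M] [IsManifold (𝓡 m) ∞ M]
    {N : Type v} [TopologicalSpace N] [T2Space N] [SecondCountableTopology N]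
    [ChartedSpace (EuclideanSpace ℝ (Fin n)) N] [IsManifold (𝓡 n) ∞ N]
    (𝓜 : LInfty.LInftyBundle m M) (𝓝 : LInfty.LInftyBundle n N)
    (Φ : LInfty.LInftyBundle.Hom 𝓜 𝓝) (hΦ : Φ.IsFibration)
    (Z : Set M) (hZ : Z ⊆ 𝓜.classicalLocus) (hZet : ∀ P ∈ Z, Φ.IsEtaleAt P) :
    (∃ (Y : Type u) (_ : TopologicalSpace Y) (_ : T2Space Y) (_ : SecondCountableTopology Y)
      (_ : ChartedSpace (EuclideanSpace ℝ (Fin n)) Y) (_ : IsManifold (𝓡 n) ∞ Y)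
      (g : C^∞⟮𝓡 n, Y; 𝓡 n, N⟯), Φ.HasPartialSection Z g) ∧
    (Set.InjOn Φ.base 𝓜.classicalLocus →
      ∃ (U : TopologicalSpace.Opens N) (g : C^∞⟮𝓡 n, U; 𝓡 n, N⟯),
        (∀ y, g y = y) ∧ Φ.HasPartialSection Z g) := by
  obtain ⟨W, s, δ, hZW, h⟩ := LInfty.exists_isSmoothContraction hΦ hZ hZet
  obtain ⟨S, hZS, hS, hloc⟩ := h.exists_hasLocalSections hΦ hZW hZ hZet
  have hf : Continuous Φ.base := Φ.base.contMDiff.continuous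
  constructor
  · obtain ⟨_, _, hτ, hg⟩ := hloc.exists_isManifold hf
    let τ : C^∞⟮𝓡 n, S; 𝓡 m, M⟯ := ⟨Subtype.val, hτ⟩
    obtain ⟨Ψ, hΨ, hc⟩ := h.exists_hom τ (fun y => hS y.2) (Φ.base.comp τ) fun _ => rfl
    exact ⟨S, inferInstance, inferInstance, inferInstance, inferInstance, inferInstance,
      Φ.base.comp τ, hg, Ψ, Set.inclusion hZS, continuous_inclusion hZS, fun P => hΨ _, hc⟩
  · intro hinj
    have : LocallyCompactSpace M := Manifold.locallyCompact_of_finiteDimensional (𝓡 m)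
    have : TopologicalSpace.MetrizableSpace M := Manifold.metrizableSpace (𝓡 m) M
    have : LocallyCompactSpace N := Manifold.locallyCompact_of_finiteDimensional (𝓡 n)
    have : TopologicalSpace.MetrizableSpace N := Manifold.metrizableSpace (𝓡 n) N
    have hA : Set.InjOn (fun Q : S => Φ.base Q)
        ((fun Q : S => Φ.base Q) ⁻¹' 𝓝.classicalLocus) := fun P hP Q hQ hPQ =>
      Subtype.ext (hinj (h.mem_classicalLocus (hS P.2) hP) (h.mem_classicalLocus (hS Q.2) hQ) hPQ)
    obtain ⟨O', hO', hAO, hO'inj⟩ := LInfty.exists_isOpen_injOn (hloc.isLocalHomeomorph hf) hA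
    obtain ⟨O, hO, rfl⟩ := isOpen_induced_iff.1 hO'
    have hinjO : Set.InjOn Φ.base (S ∩ O) := fun P hP Q hQ hPQ =>
      congrArg Subtype.val (@hO'inj ⟨P, hP.1⟩ hP.2 ⟨Q, hQ.1⟩ hQ.2 hPQ)
    obtain ⟨U, hU, τ, hτ, hτS⟩ := (hloc.inter hO).exists_section hinjO
    have hZO : Z ⊆ S ∩ O := fun P hP => ⟨hZS hP, @hAO ⟨P, hZS hP⟩
      (LInfty.LInftyBundle.curv_eq_zero_iff.1 ((Φ.lin_curv P).symm.trans
        ((congrArg _ (LInfty.LInftyBundle.curv_eq_zero_iff.2 (hZ hP))).trans (map_zero _))))⟩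
    obtain ⟨Ψ, hΨ, hc⟩ := h.exists_hom ⟨τ, hτ⟩ (fun y => hS (hτS y).1.1)
      ⟨Subtype.val, contMDiff_subtype_val⟩ fun y => (hτS y).2
    have hZU : ∀ P ∈ Z, Φ.base P ∈ U := fun P hP =>
      (Set.ext_iff.1 hU _).2 ⟨P, hZO hP, rfl⟩
    refine ⟨U, ⟨Subtype.val, contMDiff_subtype_val⟩, fun _ => rfl,
      LInfty.isLocalDiffeomorph_subtype_val U, Ψ, fun P => ⟨Φ.base P, hZU P P.2⟩,
      (hf.comp continuous_subtype_val).subtype_mk _, fun P => ?_, hc⟩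
    exact (hΨ _).trans (hinjO (hτS _).1 (hZO P.2) (hτS _).2)
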